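/- There are infinite dimer models that are CY-3 but not cancellation. Explicitly, let $\mathcal Q$ be the following infinite dimer model, drawn in the plane with straight arrows. Its vertices are the points $(i,j)\in\mathbb Z^2$ together with $A=(\tfrac13,\tfrac12)$ and $B=(\tfrac23,\tfrac12)$. Its arrows are $(i,j)\to(i+1,j)$ and $(i,j)\to(i,j+1)$ for all $i,j\in\mathbb Z$, the diagonals $(i+1,j+1)\to(i,j)$ for all $(i,j)\neq(0,0)$, and, inside the central square with corners $(0,0),(1,0),(0,1),(1,1)$, the seven arrows $(0,1)\to A$, $(1,0)\to A$, $(1,1)\to B$, $A\to B$, $A\to(0,0)$, $B\to(0,1)$, $B\to(1,0)$. These arrows cut the plane into oriented triangles, and $Q_2^+$ (resp. $Q_2^-$) is the set of the anticlockwise (resp. clockwise) triangles. Paths are composed from right to left: $pq$ is defined if $t(p)=h(q)$, where $h$, $t$ denote head and tail. For an arrow $a$ let $r_a=p^+-p^-$, where $p^{\pm}a$ is the cycle in $Q_2^{\pm}$ that contains $a$, and let $A_{\mathcal Q}=\mathbb C Q/\langle r_a\mid a\in Q_1\rangle$ be the Jacobi algebra. Put $F_p=A_{\mathcal Q}h(p)\otimes_{\mathbb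 C} t(p)A_{\mathcal Q}$ and let $\mathcal C^\bullet$ be the Davison complex $$\bigoplus_{v\in Q_0}F_{v\ell}\xrightarrow{\delta_3}\bigoplus_{a\in Q_1}F_{r_a}\xrightarrow{\delta_2}\bigoplus_{b\in Q_1}F_b\xrightarrow{\delta_1}\bigoplus_{i\in Q_0}F_i ,$$ where $F_{v\ell}=A_{\mathcal Q}v\otimes vA_{\mathcal Q}$ and, for $r_a=a_1\cdots a_n-b_1\cdots b_m$, $$\delta_1(q_1\otimes b\otimes q_2)=q_1b\otimes t(b)\otimes q_2-q_1\otimes h(b)\otimes bq_2,$$ $$\delta_2(q_1\otimes r_a\otimes q_2)=\sum_k q_1a_1\cdots a_{k-1}\otimes a_k\otimes a_{k+1}\cdots a_nq_2-\sum_k q_1b_1\cdots b_{k-1}\otimes b_k\otimes b_{k+1}\cdots b_mq_2,$$ $$\delta_3(q_1\otimes v\ell\otimes q_2)=\sum_{h(a)=v}q_1a\otimes r_a\otimes q_2-\sum_{t(a)=v}q_1\otimes r_a\otimes aq_2 .$$ Then the drawn triangles tile the plane, and $\mathcal C^\bullet$ is a resolution of the bimodule $A_{\mathcal Q}$, i.e.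 with the multiplication map $\bigoplus_iF_i\to A_{\mathcal Q}$ the sequence $0\to\mathcal C^\bullet\to A_{\mathcal Q}\to0$ is exact (so $A_{\mathcal Q}$ is CY-3 in the generalized sense for infinite dimer models). Nevertheless $A_{\mathcal Q}$ is not a cancellation algebra, where a cancellation algebra is one in which, for every arrow $a$ and all paths $p,q$, $pa=qa$ with $t(p)=t(q)=h(a)$ implies $p=q$, and $ap=aq$ with $h(p)=h(q)=t(a)$ implies $p=q$ (equalities in the algebra). -/

import Mathlib

open scoped TensorProduct DirectSum

noncomputable section

/-! ### Quivers and path algebras -/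

/-- A quiver, given by its sets of vertices and arrows and its head and tail maps. -/
structure ArrowQuiver where
  V : Type
  E : Type
  head : E → V
  tail : E → V

namespace ArrowQuiver

variable (Q : ArrowQuiver)

/-- `Q.IsPath u [a₁, …, aₖ] v` says that `a₁ ⋯ aₖ` is a path with head `u` and tail `v`:
`u = h(a₁)`, `t(aᵢ) = h(aᵢ₊₁)` and `t(aₖ) = v`. The empty list is the trivial path at `u = v`. -/
def IsPath : Q.V → List Q.E → Q.V → Prop
  | u, [], v => u = v
  | u, a :: l, v => Q.head a = u ∧ IsPath (Q.tail a) l v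

variable {Q} in
theorem IsPath.append : ∀ {l m : List Q.E} {u v w : Q.V},
    Q.IsPath u l v → Q.IsPath v m w → Q.IsPath u (l ++ m) w
  | [], _, _, _, _, h, h' => by cases h; exact h'
  | _ :: _, _, _, _, _, h, h' => ⟨h.1, h.2.append h'⟩

/-- A path, possibly trivial, with its head and its tail. -/
@[ext]
structure Path where
  head : Q.V
  tail : Q.V
  arrows : List Q.E
  isPath : Q.IsPath head arrows tail

variable {Q}

/-- The trivial path at a vertex. -/
def Path.triv (v : Q.V) : Q.Path := ⟨v, v, [], rfl⟩

/-- An arrow as a path. -/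
def Path.ofArrow (a : Q.E) : Q.Path := ⟨Q.head a, Q.tail a, [a], rfl, rfl⟩

/-- The concatenation `pq` of two paths with `t(p) = h(q)`. -/
def Path.comp (p q : Q.Path) (h : p.tail = q.head) : Q.Path :=
  ⟨p.head, q.tail, p.arrows ++ q.arrows, p.isPath.append (h ▸ q.isPath)⟩

variable (Q)

/-- The path algebra `ℂQ`: the complex vector space with the paths as a basis. -/
def PathAlgebra : Type := Q.Path →₀ ℂ

instance : AddCommGroup Q.PathAlgebra := inferInstanceAs (AddCommGroup (Q.Path →₀ ℂ))
instance : Module ℂ Q.PathAlgebra := inferInstanceAs (Module ℂ (Q.Path →₀ ℂ))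

variable {Q}

/-- A path as an element of the path algebra. -/
def ofPath (p : Q.Path) : Q.PathAlgebra := Finsupp.single p (1 : ℂ)

open Classical in
/-- The product of two basis elements: the concatenation if `t(p) = h(q)`, and `0` otherwise. -/
def pathMul (p q : Q.Path) : Q.PathAlgebra :=
  if h : p.tail = q.head then ofPath (p.comp q h) else 0

variable (Q)

/-- The bilinear extension of the concatenation of paths. -/
def mulBilin : Q.PathAlgebra →ₗ[ℂ] Q.PathAlgebra →ₗ[ℂ] Q.PathAlgebra :=
  Finsupp.linearCombination ℂ (fun p : Q.Path =>
    (Finsupp.linearCombination ℂ (fun q : Q.Path => pathMul p q) :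
      (Q.Path →₀ ℂ) →ₗ[ℂ] Q.PathAlgebra))

instance : Mul Q.PathAlgebra := ⟨fun x y => Q.mulBilin x y⟩

variable {Q}

theorem ofPath_mul_ofPath (p q : Q.Path) : ofPath p * ofPath q = pathMul p q := by
  change Q.mulBilin (ofPath p) (ofPath q) = _
  unfold mulBilin ofPath
  erw [Finsupp.linearCombination_single, one_smul, Finsupp.linearCombination_single, one_smul]

theorem hom_ext {M : Type*} [AddCommGroup M] [Module ℂ M] {f g : Q.PathAlgebra →ₗ[ℂ] M}
    (h : ∀ p, f (ofPath p) = g (ofPath p)) : f = g := by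
  refine Finsupp.lhom_ext' (M := ℂ) fun p => LinearMap.ext_ring ?_
  exact h p

theorem pathMul_assoc (p q r : Q.Path) :
    ofPath p * ofPath q * ofPath r = ofPath p * (ofPath q * ofPath r) := by
  have z1 : ∀ x : Q.PathAlgebra, (0 : Q.PathAlgebra) * x = 0 := fun x => by
    change Q.mulBilin 0 x = 0
    simp
  have z2 : ∀ x : Q.PathAlgebra, x * (0 : Q.PathAlgebra) = 0 := fun x => by
    change Q.mulBilin x 0 = 0
    simp
  rw [ofPath_mul_ofPath, ofPath_mul_ofPath]
  by_cases h : p.tail = q.head <;> by_cases h' : q.tail = r.head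
  · rw [pathMul, pathMul, dif_pos h, dif_pos h', ofPath_mul_ofPath, ofPath_mul_ofPath, pathMul,
      pathMul, dif_pos (show (p.comp q h).tail = r.head from h'),
      dif_pos (show p.tail = (q.comp r h').head from h)]
    congr 1
    ext1
    · rfl
    · rfl
    · exact List.append_assoc _ _ _
  · rw [pathMul, pathMul, dif_pos h, dif_neg h', ofPath_mul_ofPath, pathMul,
      dif_neg (show ¬ (p.comp q h).tail = r.head from h'), z2]
  · rw [pathMul, pathMul, dif_neg h, dif_pos h', ofPath_mul_ofPath, pathMul,
      dif_neg (show ¬ p.tail = (q.comp r h').head from h), z1]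
  · rw [pathMul, pathMul, dif_neg h, dif_neg h', z1, z2]

/-- The path algebra is an associative algebra; it has no unit if there are infinitely many
vertices. -/
instance : NonUnitalRing Q.PathAlgebra :=
  { (inferInstance : AddCommGroup Q.PathAlgebra), (inferInstance : Mul Q.PathAlgebra) with
    left_distrib := fun x y z => (Q.mulBilin x).map_add y z
    right_distrib := fun x y z => by
      change Q.mulBilin (x + y) z = Q.mulBilin x z + Q.mulBilin y z
      rw [map_add, LinearMap.add_apply]
    zero_mul := fun x => by
      change Q.mulBilin 0 x = 0
      rw [map_zero, LinearMap.zero_apply]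
    mul_zero := fun x => (Q.mulBilin x).map_zero
    mul_assoc := fun x y z => by
      have h : (Q.mulBilin.compr₂ Q.mulBilin) =
          ((LinearMap.llcomp ℂ Q.PathAlgebra Q.PathAlgebra Q.PathAlgebra).flip.comp
            Q.mulBilin).flip.comp Q.mulBilin := by
        refine hom_ext fun p => hom_ext fun q => hom_ext fun r => ?_
        exact pathMul_assoc p q r
      exact congrArg (fun f => f x y z) h }

instance : IsScalarTower ℂ Q.PathAlgebra Q.PathAlgebra :=
  ⟨fun c x y => by
    change Q.mulBilin (c • x) y = c • Q.mulBilin x y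
    rw [map_smul, LinearMap.smul_apply]⟩

instance : SMulCommClass ℂ Q.PathAlgebra Q.PathAlgebra :=
  ⟨fun c x y => ((Q.mulBilin x).map_smul c y).symm⟩

/-- The element `v a₁ ⋯ aₖ` of the path algebra; it is the path `a₁ ⋯ aₖ` if the arrows form a
path with head `v`. -/
def word : Q.V → List Q.E → Q.PathAlgebra
  | v, [] => ofPath (Path.triv v)
  | v, a :: l => ofPath (Path.triv v) * (ofPath (Path.ofArrow a) * word (Q.tail a) l)

/-- The incidence graph of a set `F` of cycles and the arrows meeting the vertex `v`: its
nodes are the arrows with head or tail `v` and the cycles in `F` through `v`; an arrow and a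
cycle are joined if the cycle contains the arrow. -/
def incidenceGraph (F : Set (Cycle Q.E)) (v : Q.V) :
    SimpleGraph ({a : Q.E // Q.head a = v ∨ Q.tail a = v} ⊕
      {c : Cycle Q.E // c ∈ F ∧ ∃ a ∈ c, Q.head a = v ∨ Q.tail a = v}) :=
  SimpleGraph.fromRel fun x y =>
    match x, y with
    | Sum.inl a, Sum.inr c => a.1 ∈ c.1
    | _, _ => False

end ArrowQuiver

/-! ### Dimer models -/

/-- A dimer model, possibly infinite: a strongly connected quiver with two disjoint sets
`pos`, `neg` of cycles `a₁ ⋯ aₖ` (up to rotation) of length at least `3`. For infinite quivers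
we ask that only finitely many arrows meet in a vertex. -/
structure DimerModel extends ArrowQuiver where
  pos : Set (Cycle E)
  neg : Set (Cycle E)
  strongly_connected : ∀ u v : V, ∃ l, toArrowQuiver.IsPath u l v
  disjoint : Disjoint pos neg
  isCycle : ∀ c ∈ pos ∪ neg, c.Chain fun a b => tail a = head b
  three_le_length : ∀ c ∈ pos ∪ neg, 3 ≤ c.length
  nodup : ∀ c ∈ pos ∪ neg, c.Nodup
  existsUnique_pos : ∀ a : E, ∃! c, c ∈ pos ∧ a ∈ c
  existsUnique_neg : ∀ a : E, ∃! c, c ∈ neg ∧ a ∈ c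
  manifold : ∀ v, (toArrowQuiver.incidenceGraph (pos ∪ neg) v).Connected
  finite_head : ∀ v, {a | head a = v}.Finite
  finite_tail : ∀ v, {a | tail a = v}.Finite

namespace DimerModel

open ArrowQuiver

variable (Q : DimerModel)

theorem existsUnique_cons_of_mem {E : Type} {a : E} {c : Cycle E} (hc : c.Nodup) (ha : a ∈ c) :
    ∃! l : List E, ((a :: l : List E) : Cycle E) = c := by
  induction c using Quotient.inductionOn' with
  | h m =>
    obtain ⟨s, t, rfl⟩ := List.append_of_mem (show a ∈ m from ha)
    refine ⟨t ++ s, Cycle.coe_eq_coe.2 (List.IsRotated.symm ⟨s.length, ?_⟩), ?_⟩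
    · simp
    · intro l hl
      obtain ⟨n, hn⟩ : (a :: l) ~r (s ++ a :: t) := Cycle.coe_eq_coe.1 hl
      have h2 : (a :: (t ++ s)) ~r (s ++ a :: t) := List.IsRotated.symm ⟨s.length, by simp⟩
      obtain ⟨k, hk⟩ : (a :: l) ~r (a :: (t ++ s)) := List.IsRotated.trans ⟨n, hn⟩ h2.symm
      have hnd : (a :: l).Nodup := by
        refine (List.IsRotated.nodup_iff ⟨n, hn⟩).2 hc
      have hlen : k % (a :: l).length < (a :: l).length := Nat.mod_lt _ (by simp)
      rw [← List.rotate_mod] at hk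
      have h0 : (a :: l)[k % (a :: l).length] = (a :: l)[0] := by
        have := congrArg List.head? hk
        rw [List.head?_rotate hlen] at this
        rw [List.getElem?_eq_getElem hlen] at this
        simpa using this
      have hk0 : k % (a :: l).length = 0 := (hnd.getElem_inj_iff).1 h0
      rw [hk0, List.rotate_zero] at hk
      exact (List.cons.inj hk).2

theorem existsUnique_posPath (a : Q.E) :
    ∃! l : List Q.E, ((a :: l : List Q.E) : Cycle Q.E) ∈ Q.pos := by
  obtain ⟨c, ⟨hc, hac⟩, huniq⟩ := Q.existsUnique_pos a
  obtain ⟨l, hl, hl'⟩ := existsUnique_cons_of_mem (Q.nodup c (Or.inl hc)) hac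
  refine ⟨l, by subst hl; exact hc, fun m hm => hl' m ?_⟩
  exact huniq _ ⟨hm, Cycle.mem_coe_iff.2 (List.mem_cons_self)⟩

theorem existsUnique_negPath (a : Q.E) :
    ∃! l : List Q.E, ((a :: l : List Q.E) : Cycle Q.E) ∈ Q.neg := by
  obtain ⟨c, ⟨hc, hac⟩, huniq⟩ := Q.existsUnique_neg a
  obtain ⟨l, hl, hl'⟩ := existsUnique_cons_of_mem (Q.nodup c (Or.inr hc)) hac
  refine ⟨l, by subst hl; exact hc, fun m hm => hl' m ?_⟩
  exact huniq _ ⟨hm, Cycle.mem_coe_iff.2 (List.mem_cons_self)⟩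

/-- The arrows of the path `p⁺` for which `p⁺a` is (up to rotation) the cycle of `pos`
containing `a`. -/
def posPath (a : Q.E) : List Q.E := (Q.existsUnique_posPath a).choose

/-- The arrows of the path `p⁻` for which `p⁻a` is (up to rotation) the cycle of `neg`
containing `a`. -/
def negPath (a : Q.E) : List Q.E := (Q.existsUnique_negPath a).choose

/-- The relation `rₐ = p⁺ - p⁻`; both paths have head `t(a)` and tail `h(a)`. -/
def relation (a : Q.E) : Q.PathAlgebra :=
  word (Q.tail a) (Q.posPath a) - word (Q.tail a) (Q.negPath a)

/-- The two-sided ideal generated by the relations. As a relation is fixed by multiplication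
with suitable trivial paths, it is itself of the form `x * rₐ * y`. -/
def jacobiIdeal : Submodule ℂ Q.PathAlgebra :=
  Submodule.span ℂ {z | ∃ (x y : Q.PathAlgebra) (a : Q.E), z = x * Q.relation a * y}

theorem mul_mem_jacobiIdeal (w : Q.PathAlgebra) {z : Q.PathAlgebra} (hz : z ∈ Q.jacobiIdeal) :
    w * z ∈ Q.jacobiIdeal := by
  induction hz using Submodule.span_induction with
  | mem z hz =>
    obtain ⟨x, y, a, rfl⟩ := hz
    exact Submodule.subset_span ⟨w * x, y, a, by rw [mul_assoc, mul_assoc, mul_assoc]⟩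
  | zero => rw [mul_zero]; exact zero_mem _
  | add x y _ _ hx hy => rw [mul_add]; exact add_mem hx hy
  | smul c x _ hx => rw [mul_smul_comm]; exact Submodule.smul_mem _ c hx

theorem jacobiIdeal_mul_mem (w : Q.PathAlgebra) {z : Q.PathAlgebra} (hz : z ∈ Q.jacobiIdeal) :
    z * w ∈ Q.jacobiIdeal := by
  induction hz using Submodule.span_induction with
  | mem z hz =>
    obtain ⟨x, y, a, rfl⟩ := hz
    exact Submodule.subset_span ⟨x, y * w, a, by rw [mul_assoc]⟩
  | zero => rw [zero_mul]; exact zero_mem _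
  | add x y _ _ hx hy => rw [add_mul]; exact add_mem hx hy
  | smul c x _ hx => rw [smul_mul_assoc]; exact Submodule.smul_mem _ c hx

/-- The Jacobi algebra `ℂQ / ⟨rₐ⟩`. -/
def Jacobi : Type := Q.PathAlgebra ⧸ Q.jacobiIdeal

instance : AddCommGroup Q.Jacobi := inferInstanceAs (AddCommGroup (Q.PathAlgebra ⧸ Q.jacobiIdeal))
instance : Module ℂ Q.Jacobi := inferInstanceAs (Module ℂ (Q.PathAlgebra ⧸ Q.jacobiIdeal))

/-- The projection of the path algebra onto the Jacobi algebra. -/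
def proj : Q.PathAlgebra →ₗ[ℂ] Q.Jacobi := Q.jacobiIdeal.mkQ

theorem proj_surjective : Function.Surjective Q.proj := Q.jacobiIdeal.mkQ_surjective

theorem proj_eq_iff {x y : Q.PathAlgebra} : Q.proj x = Q.proj y ↔ x - y ∈ Q.jacobiIdeal :=
  Submodule.Quotient.eq _

theorem proj_mul_congr {x x' y y' : Q.PathAlgebra} (h : Q.proj x = Q.proj x')
    (h' : Q.proj y = Q.proj y') : Q.proj (x * y) = Q.proj (x' * y') := by
  rw [proj_eq_iff] at *
  have : x * y - x' * y' = (x - x') * y + x' * (y - y') := by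
    rw [sub_mul, mul_sub]
    abel
  rw [this]
  exact add_mem (Q.jacobiIdeal_mul_mem _ h) (Q.mul_mem_jacobiIdeal _ h')

instance : Mul Q.Jacobi :=
  ⟨Quotient.map₂ (· * ·) fun _ _ h _ _ h' =>
    Quotient.exact (Q.proj_mul_congr (Quotient.sound h) (Quotient.sound h'))⟩

theorem proj_mul (x y : Q.PathAlgebra) : Q.proj (x * y) = Q.proj x * Q.proj y := rfl

instance : NonUnitalRing Q.Jacobi :=
  { (inferInstance : AddCommGroup Q.Jacobi), (inferInstance : Mul Q.Jacobi) with
    left_distrib := fun x y z => by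
      obtain ⟨x, rfl⟩ := Q.proj_surjective x
      obtain ⟨y, rfl⟩ := Q.proj_surjective y
      obtain ⟨z, rfl⟩ := Q.proj_surjective z
      rw [← map_add, ← proj_mul, ← proj_mul, ← proj_mul, ← map_add, mul_add]
    right_distrib := fun x y z => by
      obtain ⟨x, rfl⟩ := Q.proj_surjective x
      obtain ⟨y, rfl⟩ := Q.proj_surjective y
      obtain ⟨z, rfl⟩ := Q.proj_surjective z
      rw [← map_add, ← proj_mul, ← proj_mul, ← proj_mul, ← map_add, add_mul]
    zero_mul := fun x => by
      obtain ⟨x, rfl⟩ := Q.proj_surjective x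
      rw [← map_zero Q.proj, ← proj_mul, zero_mul]
    mul_zero := fun x => by
      obtain ⟨x, rfl⟩ := Q.proj_surjective x
      rw [← map_zero Q.proj, ← proj_mul, mul_zero]
    mul_assoc := fun x y z => by
      obtain ⟨x, rfl⟩ := Q.proj_surjective x
      obtain ⟨y, rfl⟩ := Q.proj_surjective y
      obtain ⟨z, rfl⟩ := Q.proj_surjective z
      rw [← proj_mul, ← proj_mul, ← proj_mul, ← proj_mul, mul_assoc] }

instance : IsScalarTower ℂ Q.Jacobi Q.Jacobi :=
  ⟨fun c x y => by
    obtain ⟨x, rfl⟩ := Q.proj_surjective x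
    obtain ⟨y, rfl⟩ := Q.proj_surjective y
    simp only [smul_eq_mul, ← map_smul, ← proj_mul, smul_mul_assoc]⟩

instance : SMulCommClass ℂ Q.Jacobi Q.Jacobi :=
  ⟨fun c x y => by
    obtain ⟨x, rfl⟩ := Q.proj_surjective x
    obtain ⟨y, rfl⟩ := Q.proj_surjective y
    simp only [smul_eq_mul, ← map_smul, ← proj_mul, mul_smul_comm]⟩

variable {Q}

/-- The class of a path in the Jacobi algebra. -/
def cls (p : Q.Path) : Q.Jacobi := Q.proj (ofPath p)

/-- The class of a trivial path. -/
def idem (v : Q.V) : Q.Jacobi := cls (Path.triv v)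

/-- The class of an arrow. -/
def arr (a : Q.E) : Q.Jacobi := cls (Path.ofArrow a)

variable (Q)

/-- The Jacobi algebra is a cancellation algebra: `pa = qa → p = q` and `ap = aq → p = q` for
all arrows `a` and all paths `p`, `q` for which these are products of composable paths. -/
def IsCancellation : Prop :=
  ∀ a : Q.E,
    (∀ p q : Q.Path, p.tail = Q.head a → q.tail = Q.head a →
      cls p * arr a = cls q * arr a → cls p = cls q) ∧
    (∀ p q : Q.Path, p.head = Q.tail a → q.head = Q.tail a →
      arr a * cls p = arr a * cls q → cls p = cls q)

/-! ### The Davison complex -/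

variable {Q}

theorem idem_mul_idem (v : Q.V) : idem v * idem v = idem v := by
  have h : ofPath (Path.triv v) * ofPath (Path.triv v) = ofPath (Path.triv v) :=
    (ofPath_mul_ofPath _ _).trans (dif_pos rfl)
  rw [idem, cls, ← proj_mul, h]

/-- The left module `A v`. -/
def leftMod (v : Q.V) : Submodule ℂ Q.Jacobi := LinearMap.range (LinearMap.mulRight ℂ (idem v))

/-- The right module `v A`. -/
def rightMod (v : Q.V) : Submodule ℂ Q.Jacobi := LinearMap.range (LinearMap.mulLeft ℂ (idem v))

/-- The bimodule `A u ⊗ w A`. -/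
def Bimod (u w : Q.V) : Type := leftMod u ⊗[ℂ] rightMod w

instance (u w : Q.V) : AddCommGroup (Bimod u w) :=
  inferInstanceAs (AddCommGroup (leftMod u ⊗[ℂ] rightMod w))
instance (u w : Q.V) : Module ℂ (Bimod u w) :=
  inferInstanceAs (Module ℂ (leftMod u ⊗[ℂ] rightMod w))

/-- The map `q₁ ⊗ q₂ ↦ q₁ x u' ⊗ w' y q₂` from `A u ⊗ w A` to `A u' ⊗ w' A`. (Below `x` always ends
in `u'` and `y` always starts in `w'`, so that this is `q₁ x ⊗ y q₂`.) -/
def sandwich (u w u' w' : Q.V) (x y : Q.Jacobi) : Bimod u w →ₗ[ℂ] Bimod u' w' :=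
  TensorProduct.map
    ((LinearMap.mulRight ℂ (idem u')).rangeRestrict ∘ₗ LinearMap.mulRight ℂ x ∘ₗ
      (leftMod u).subtype)
    ((LinearMap.mulLeft ℂ (idem w')).rangeRestrict ∘ₗ LinearMap.mulLeft ℂ y ∘ₗ
      (rightMod w).subtype)

variable (Q)

/-- `⨁ F_i` over the vertices `i`, with `F_i = A i ⊗ i A`. -/
abbrev C0 : Type := ⨁ v : Q.V, Bimod v v

/-- `⨁ F_b` over the arrows `b`, with `F_b = A h(b) ⊗ t(b) A`. -/
abbrev C1 : Type := ⨁ b : Q.E, Bimod (Q.head b) (Q.tail b)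

/-- `⨁ F_r` over the relations `r = rₐ`, with `F_r = A h(r) ⊗ t(r) A = A t(a) ⊗ h(a) A`. -/
abbrev C2 : Type := ⨁ a : Q.E, Bimod (Q.tail a) (Q.head a)

/-- `⨁ F_s` over the elements `s = vℓ`, `v` a vertex, with `F_s = A v ⊗ v A`. -/
abbrev C3 : Type := ⨁ v : Q.V, Bimod v v

open Classical in
/-- The multiplication `q₁ ⊗ q₂ ↦ q₁ q₂`. -/
def augmentation : Q.C0 →ₗ[ℂ] Q.Jacobi :=
  DirectSum.toModule ℂ Q.V Q.Jacobi fun v =>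
    LinearMap.mul' ℂ Q.Jacobi ∘ₗ TensorProduct.map (leftMod v).subtype (rightMod v).subtype

open Classical in
/-- `δ₁(q₁ ⊗ b ⊗ q₂) = q₁ b ⊗ t(b) ⊗ q₂ - q₁ ⊗ h(b) ⊗ b q₂`. -/
def delta1 : Q.C1 →ₗ[ℂ] Q.C0 :=
  DirectSum.toModule ℂ Q.E Q.C0 fun b =>
    DirectSum.lof ℂ Q.V (fun v => Bimod v v) (Q.tail b) ∘ₗ
        sandwich _ _ _ _ (arr b) (idem (Q.tail b)) -
      DirectSum.lof ℂ Q.V (fun v => Bimod v v) (Q.head b) ∘ₗ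
        sandwich _ _ _ _ (idem (Q.head b)) (arr b)

open Classical in
/-- For the path `a₁ ⋯ aₙ` with head `u`, tail `w` and arrows `l`, the map
`q₁ ⊗ q₂ ↦ ∑ₖ q₁ a₁ ⋯ aₖ₋₁ ⊗ aₖ ⊗ aₖ₊₁ ⋯ aₙ q₂`. -/
def pathDerivation (u w : Q.V) (l : List Q.E) : Bimod u w →ₗ[ℂ] Q.C1 :=
  ∑ k : Fin l.length,
    DirectSum.lof ℂ Q.E (fun b => Bimod (Q.head b) (Q.tail b)) l[k] ∘ₗ
      sandwich _ _ _ _ (Q.proj (word u (l.take k)))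
        (Q.proj (word (Q.tail l[k]) (l.drop (k + 1))))

open Classical in
/-- `δ₂(q₁ ⊗ r ⊗ q₂) = ∑ₖ q₁ a₁ ⋯ ⊗ aₖ ⊗ ⋯ aₙ q₂ - ∑ₖ q₁ b₁ ⋯ ⊗ bₖ ⊗ ⋯ bₘ q₂` for the relation
`r = rₐ = a₁ ⋯ aₙ - b₁ ⋯ bₘ`. -/
def delta2 : Q.C2 →ₗ[ℂ] Q.C1 :=
  DirectSum.toModule ℂ Q.E Q.C1 fun a =>
    Q.pathDerivation (Q.tail a) (Q.head a) (Q.posPath a) -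
      Q.pathDerivation (Q.tail a) (Q.head a) (Q.negPath a)

open Classical in
/-- `δ₃(q₁ ⊗ s ⊗ q₂) = ∑_{h(a) = v} q₁ a ⊗ rₐ ⊗ q₂ - ∑_{t(a) = v} q₁ ⊗ rₐ ⊗ a q₂` for `s = vℓ`. -/
def delta3 : Q.C3 →ₗ[ℂ] Q.C2 :=
  DirectSum.toModule ℂ Q.V Q.C2 fun v =>
    ∑ a ∈ (Q.finite_head v).toFinset,
        DirectSum.lof ℂ Q.E (fun a => Bimod (Q.tail a) (Q.head a)) a ∘ₗ
          sandwich _ _ _ _ (arr a) (idem v) -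
      ∑ a ∈ (Q.finite_tail v).toFinset,
        DirectSum.lof ℂ Q.E (fun a => Bimod (Q.tail a) (Q.head a)) a ∘ₗ
          sandwich _ _ _ _ (idem v) (arr a)

/-- The generalized Calabi-Yau-3 condition: the complex `C3 → C2 → C1 → C0` is a resolution of the
bimodule `A`, that is, `0 → C3 → C2 → C1 → C0 → A → 0` is exact. -/
structure IsCY3 : Prop where
  injective_delta3 : Function.Injective Q.delta3
  exact_delta3_delta2 : Function.Exact Q.delta3 Q.delta2
  exact_delta2_delta1 : Function.Exact Q.delta2 Q.delta1
  exact_delta1_augmentation : Function.Exact Q.delta1 Q.augmentation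
  surjective_augmentation : Function.Surjective Q.augmentation

/-! ### Planar dimer models -/

/-- Twice the signed area of the triangle `p q r`; it is positive if `r` lies strictly to the left
of the line from `p` to `q`. -/
def signedArea (p q r : ℝ × ℝ) : ℝ := (q.1 - p.1) * (r.2 - p.2) - (q.2 - p.2) * (r.1 - p.1)

/-- The polygon spanned by a cycle when the vertices are placed at the points `φ v`. -/
def polygon (φ : Q.V → ℝ × ℝ) (c : Cycle Q.E) : Set (ℝ × ℝ) :=
  convexHull ℝ {x | ∃ a ∈ c, x = φ (Q.head a)}

/-- Placing the vertices at the points `φ v` and drawing the arrows as line segments, one obtains a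
tiling of the plane: the cycles in `pos` (in `neg`) run anticlockwise (clockwise) around strictly
convex polygons, and these polygons cover the plane without overlap. -/
structure IsPlaneTiling (φ : Q.V → ℝ × ℝ) : Prop where
  corners : ∀ c ∈ Q.pos ∪ Q.neg, ∀ a ∈ c, ∀ b ∈ c, Q.head a = Q.head b → a = b
  anticlockwise : ∀ c ∈ Q.pos, ∀ a ∈ c, ∀ b ∈ c, Q.head b ≠ Q.tail a → Q.head b ≠ Q.head a →
    0 < signedArea (φ (Q.tail a)) (φ (Q.head a)) (φ (Q.head b))
  clockwise : ∀ c ∈ Q.neg, ∀ a ∈ c, ∀ b ∈ c, Q.head b ≠ Q.tail a → Q.head b ≠ Q.head a →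
    signedArea (φ (Q.tail a)) (φ (Q.head a)) (φ (Q.head b)) < 0
  no_overlap : (Q.pos ∪ Q.neg).Pairwise fun c d =>
    Disjoint (interior (Q.polygon φ c)) (interior (Q.polygon φ d))
  cover : ⋃ c ∈ Q.pos ∪ Q.neg, Q.polygon φ c = Set.univ

end DimerModel

/-! ### The square grid with a modified central square -/

namespace ModifiedGrid

/-- The points of the grid, and two further vertices inside the central square, which has the
corners `(0,0)`, `(1,0)`, `(0,1)`, `(1,1)`. -/
inductive Vertex : Type
  | grid (i j : ℤ)
  | A
  | B

/-- Every square but the central one has one diagonal arrow, from its upper right to its lower left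
corner. Inside the central square there are seven arrows instead. -/
inductive Arrow : Type
  | right (i j : ℤ)
  | up (i j : ℤ)
  | diag (i j : ℤ) (h : (i, j) ≠ (0, 0))
  | x01A
  | x10A
  | x11B
  | xAB
  | xA00
  | xB01
  | xB10

open Vertex Arrow

/-- The quiver: `right i j : (i,j) → (i+1,j)`, `up i j : (i,j) → (i,j+1)`,
`diag i j : (i+1,j+1) → (i,j)`, and inside the central square `(0,1) → A`, `(1,0) → A`,
`(1,1) → B`, `A → B`, `A → (0,0)`, `B → (0,1)`, `B → (1,0)`. -/
def quiver : ArrowQuiver where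
  V := Vertex
  E := Arrow
  tail
    | right i j => grid i j
    | up i j => grid i j
    | diag i j _ => grid (i + 1) (j + 1)
    | x01A => grid 0 1
    | x10A => grid 1 0
    | x11B => grid 1 1
    | xAB => A
    | xA00 => A
    | xB01 => B
    | xB10 => B
  head
    | right i j => grid (i + 1) j
    | up i j => grid i (j + 1)
    | diag i j _ => grid i j
    | x01A => A
    | x10A => A
    | x11B => B
    | xAB => B
    | xA00 => grid 0 0
    | xB01 => grid 0 1
    | xB10 => grid 1 0

/-- The anticlockwise triangles. -/
def posFaces : Set (Cycle Arrow) :=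
  {c | (∃ i j h, c = ([diag i j h, up (i + 1) j, right i j] : List Arrow)) ∨
    c = ([xB01, xAB, x01A] : List Arrow) ∨
    c = ([xA00, x10A, right 0 0] : List Arrow) ∨
    c = ([xB10, x11B, up 1 0] : List Arrow)}

/-- The clockwise triangles. -/
def negFaces : Set (Cycle Arrow) :=
  {c | (∃ i j h, c = ([diag i j h, right i (j + 1), up i j] : List Arrow)) ∨
    c = ([xB01, x11B, right 0 1] : List Arrow) ∨
    c = ([xA00, x01A, up 0 0] : List Arrow) ∨
    c = ([xB10, xAB, x10A] : List Arrow)}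

/-- `Reach u v` says that there is a path with head `u` and tail `v`. -/
def Reach (u v : Vertex) : Prop := ∃ l, quiver.IsPath u l v

theorem Reach.trans {u v w : Vertex} : Reach u v → Reach v w → Reach u w :=
  fun ⟨l, hl⟩ ⟨m, hm⟩ => ⟨l ++ m, hl.append hm⟩

theorem Reach.refl (u : Vertex) : Reach u u := ⟨[], rfl⟩

theorem Reach.arrow (a : Arrow) {u v : Vertex} (hu : quiver.head a = u) (hv : quiver.tail a = v) :
    Reach u v := ⟨[a], hu, hv⟩

theorem reach_right (i j : ℤ) : Reach (grid (i + 1) j) (grid i j) := .arrow (right i j) rfl rfl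

theorem reach_up (i j : ℤ) : Reach (grid i (j + 1)) (grid i j) := .arrow (up i j) rfl rfl

theorem reach_diag (i j : ℤ) : Reach (grid i j) (grid (i + 1) (j + 1)) := by
  by_cases h : (i, j) = (0, 0)
  · obtain ⟨rfl, rfl⟩ := Prod.mk.inj h
    have h1 : Reach (grid 0 0) A := .arrow xA00 rfl rfl
    have h2 : Reach A (grid 0 1) := .arrow x01A rfl rfl
    have h3 : Reach (grid 0 1) B := .arrow xB01 rfl rfl
    have h4 : Reach B (grid 1 1) := .arrow x11B rfl rfl
    exact ((h1.trans h2).trans h3).trans h4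
  · exact .arrow (diag i j h) rfl rfl

theorem reach_left (i j : ℤ) : Reach (grid i j) (grid (i + 1) j) :=
  (reach_diag i j).trans (reach_up (i + 1) j)

theorem reach_down (i j : ℤ) : Reach (grid i j) (grid i (j + 1)) :=
  (reach_diag i j).trans (reach_right i (j + 1))

theorem reach_grid (i j : ℤ) : Reach (grid 0 0) (grid i j) ∧ Reach (grid i j) (grid 0 0) := by
  have h1 : Reach (grid 0 0) (grid i 0) ∧ Reach (grid i 0) (grid 0 0) := by
    induction i using Int.induction_on with
    | zero => exact ⟨.refl _, .refl _⟩
    | succ n ih => exact ⟨ih.1.trans (reach_left _ _), (reach_right _ _).trans ih.2⟩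
    | pred n ih =>
      have h := reach_left (-(n : ℤ) - 1) 0
      have h' := reach_right (-(n : ℤ) - 1) 0
      rw [sub_add_cancel] at h h'
      exact ⟨ih.1.trans h', h.trans ih.2⟩
  have h2 : Reach (grid i 0) (grid i j) ∧ Reach (grid i j) (grid i 0) := by
    induction j using Int.induction_on with
    | zero => exact ⟨.refl _, .refl _⟩
    | succ n ih => exact ⟨ih.1.trans (reach_down _ _), (reach_up _ _).trans ih.2⟩
    | pred n ih =>
      have h := reach_down i (-(n : ℤ) - 1)
      have h' := reach_up i (-(n : ℤ) - 1)
      rw [sub_add_cancel] at h h'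
      exact ⟨ih.1.trans h', h.trans ih.2⟩
  exact ⟨h1.1.trans h2.1, h2.2.trans h1.2⟩

theorem reach_origin (v : Vertex) : Reach (grid 0 0) v ∧ Reach v (grid 0 0) := by
  cases v with
  | grid i j => exact reach_grid i j
  | A => exact ⟨.arrow xA00 rfl rfl, .trans (.arrow x01A rfl rfl) (reach_grid 0 1).2⟩
  | B => exact ⟨(reach_grid 0 1).1.trans (.arrow xB01 rfl rfl),
      .trans (.arrow x11B rfl rfl) (reach_grid 1 1).2⟩

theorem disjoint_faces : Disjoint posFaces negFaces := by
  refine Set.disjoint_left.2 ?_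
  rintro c (⟨i, j, h, rfl⟩ | rfl | rfl | rfl) (⟨i', j', h', hc⟩ | hc | hc | hc)
  · have h1 := congrArg (fun c : Cycle Arrow => up (i + 1) j ∈ c) hc
    have h2 := congrArg (fun c : Cycle Arrow => diag i j h ∈ c) hc
    simp only [Cycle.mem_coe_iff, List.mem_cons, List.not_mem_nil, reduceCtorEq, up.injEq,
      diag.injEq, or_false, false_or, or_true, eq_iff_iff, true_iff] at h1 h2
    lia
  all_goals
    have h1 := congrArg (fun c : Cycle Arrow => x01A ∈ c) hc
    have h2 := congrArg (fun c : Cycle Arrow => x10A ∈ c) hc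
    have h3 := congrArg (fun c : Cycle Arrow => x11B ∈ c) hc
    have h4 := congrArg (fun c : Cycle Arrow => xAB ∈ c) hc
    have h5 := congrArg (fun c : Cycle Arrow => xA00 ∈ c) hc
    have h6 := congrArg (fun c : Cycle Arrow => xB01 ∈ c) hc
    simp at h1 h2 h3 h4 h5 h6

/-- The anticlockwise triangle containing a given arrow. -/
def posFaceOf (a : Arrow) : Cycle Arrow :=
  match a with
  | right i j =>
    if h : (i, j) ≠ (0, 0) then ([diag i j h, up (i + 1) j, right i j] : List Arrow)
    else ([xA00, x10A, right 0 0] : List Arrow)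
  | up i j =>
    if h : (i - 1, j) ≠ (0, 0) then ([diag (i - 1) j h, up i j, right (i - 1) j] : List Arrow)
    else ([xB10, x11B, up 1 0] : List Arrow)
  | diag i j h => ([diag i j h, up (i + 1) j, right i j] : List Arrow)
  | x01A => ([xB01, xAB, x01A] : List Arrow)
  | x10A => ([xA00, x10A, right 0 0] : List Arrow)
  | x11B => ([xB10, x11B, up 1 0] : List Arrow)
  | xAB => ([xB01, xAB, x01A] : List Arrow)
  | xA00 => ([xA00, x10A, right 0 0] : List Arrow)
  | xB01 => ([xB01, xAB, x01A] : List Arrow)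
  | xB10 => ([xB10, x11B, up 1 0] : List Arrow)

theorem eq_pos_of_mem {c : Cycle Arrow} (hc : c ∈ posFaces) {a : Arrow} (ha : a ∈ c) :
    c = posFaceOf a := by
  obtain ⟨i, j, h, rfl⟩ | rfl | rfl | rfl := hc <;>
    simp only [Cycle.mem_coe_iff, List.mem_cons, List.not_mem_nil, or_false] at ha <;>
    obtain rfl | rfl | rfl := ha
  · rfl
  · simp only [posFaceOf, add_sub_cancel_right]
    rw [dif_pos h]
  · simp only [posFaceOf, dif_pos h]
  all_goals rfl

/-- The clockwise triangle containing a given arrow. -/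
def negFaceOf (a : Arrow) : Cycle Arrow :=
  match a with
  | up i j =>
    if h : (i, j) ≠ (0, 0) then ([diag i j h, right i (j + 1), up i j] : List Arrow)
    else ([xA00, x01A, up 0 0] : List Arrow)
  | right i j =>
    if h : (i, j - 1) ≠ (0, 0) then ([diag i (j - 1) h, right i j, up i (j - 1)] : List Arrow)
    else ([xB01, x11B, right 0 1] : List Arrow)
  | diag i j h => ([diag i j h, right i (j + 1), up i j] : List Arrow)
  | x01A => ([xA00, x01A, up 0 0] : List Arrow)
  | x10A => ([xB10, xAB, x10A] : List Arrow)
  | x11B => ([xB01, x11B, right 0 1] : List Arrow)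
  | xAB => ([xB10, xAB, x10A] : List Arrow)
  | xA00 => ([xA00, x01A, up 0 0] : List Arrow)
  | xB01 => ([xB01, x11B, right 0 1] : List Arrow)
  | xB10 => ([xB10, xAB, x10A] : List Arrow)

theorem eq_neg_of_mem {c : Cycle Arrow} (hc : c ∈ negFaces) {a : Arrow} (ha : a ∈ c) :
    c = negFaceOf a := by
  obtain ⟨i, j, h, rfl⟩ | rfl | rfl | rfl := hc <;>
    simp only [Cycle.mem_coe_iff, List.mem_cons, List.not_mem_nil, or_false] at ha <;>
    obtain rfl | rfl | rfl := ha
  · rfl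
  · simp only [negFaceOf, add_sub_cancel_right]
    rw [dif_pos h]
  · simp only [negFaceOf, dif_pos h]
  all_goals rfl

theorem exists_pos_mem (a : Arrow) : ∃ c ∈ posFaces, a ∈ c := by
  cases a with
  | right i j =>
    by_cases h : (i, j) = (0, 0)
    · obtain ⟨rfl, rfl⟩ := Prod.mk.inj h
      exact ⟨_, .inr (.inr (.inl rfl)), by simp⟩
    · exact ⟨_, .inl ⟨i, j, h, rfl⟩, by simp⟩
  | up i j =>
    by_cases h : (i - 1, j) = (0, 0)
    · obtain ⟨h, rfl⟩ := Prod.mk.inj h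
      obtain rfl : i = 1 := by lia
      exact ⟨_, .inr (.inr (.inr rfl)), by simp⟩
    · exact ⟨_, .inl ⟨i - 1, j, h, rfl⟩, by simp⟩
  | diag i j h => exact ⟨_, .inl ⟨i, j, h, rfl⟩, by simp⟩
  | x01A => exact ⟨_, .inr (.inl rfl), by simp⟩
  | x10A => exact ⟨_, .inr (.inr (.inl rfl)), by simp⟩
  | x11B => exact ⟨_, .inr (.inr (.inr rfl)), by simp⟩
  | xAB => exact ⟨_, .inr (.inl rfl), by simp⟩
  | xA00 => exact ⟨_, .inr (.inr (.inl rfl)), by simp⟩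
  | xB01 => exact ⟨_, .inr (.inl rfl), by simp⟩
  | xB10 => exact ⟨_, .inr (.inr (.inr rfl)), by simp⟩

theorem exists_neg_mem (a : Arrow) : ∃ c ∈ negFaces, a ∈ c := by
  cases a with
  | up i j =>
    by_cases h : (i, j) = (0, 0)
    · obtain ⟨rfl, rfl⟩ := Prod.mk.inj h
      exact ⟨_, .inr (.inr (.inl rfl)), by simp⟩
    · exact ⟨_, .inl ⟨i, j, h, rfl⟩, by simp⟩
  | right i j =>
    by_cases h : (i, j - 1) = (0, 0)
    · obtain ⟨rfl, h⟩ := Prod.mk.inj h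
      obtain rfl : j = 1 := by lia
      exact ⟨_, .inr (.inl rfl), by simp⟩
    · exact ⟨_, .inl ⟨i, j - 1, h, rfl⟩, by simp⟩
  | diag i j h => exact ⟨_, .inl ⟨i, j, h, rfl⟩, by simp⟩
  | x01A => exact ⟨_, .inr (.inr (.inl rfl)), by simp⟩
  | x10A => exact ⟨_, .inr (.inr (.inr rfl)), by simp⟩
  | x11B => exact ⟨_, .inr (.inl rfl), by simp⟩
  | xAB => exact ⟨_, .inr (.inr (.inr rfl)), by simp⟩
  | xA00 => exact ⟨_, .inr (.inr (.inl rfl)), by simp⟩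
  | xB01 => exact ⟨_, .inr (.inl rfl), by simp⟩
  | xB10 => exact ⟨_, .inr (.inr (.inr rfl)), by simp⟩

/-- Two arrows meeting `v` lie in the same component of the incidence graph at `v`. -/
def Linked (v : Vertex) (a b : Arrow) : Prop :=
  ∃ (ha : quiver.head a = v ∨ quiver.tail a = v) (hb : quiver.head b = v ∨ quiver.tail b = v),
    (quiver.incidenceGraph (posFaces ∪ negFaces) v).Reachable (.inl ⟨a, ha⟩) (.inl ⟨b, hb⟩)

theorem Linked.symm {v : Vertex} {a b : Arrow} : Linked v a b → Linked v b a :=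
  fun ⟨ha, hb, h⟩ => ⟨hb, ha, h.symm⟩

theorem Linked.trans {v : Vertex} {a b c : Arrow} : Linked v a b → Linked v b c → Linked v a c :=
  fun ⟨ha, _, h⟩ ⟨_, hc, h'⟩ => ⟨ha, hc, h.trans h'⟩

theorem Linked.of_mem {v : Vertex} {a b : Arrow} (c : Cycle Arrow)
    (hc : c ∈ posFaces ∪ negFaces) (hac : a ∈ c) (hbc : b ∈ c)
    (ha : quiver.head a = v ∨ quiver.tail a = v) (hb : quiver.head b = v ∨ quiver.tail b = v) :
    Linked v a b := by
  have h1 : (quiver.incidenceGraph (posFaces ∪ negFaces) v).Adj (.inl ⟨a, ha⟩)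
      (.inr ⟨c, hc, a, hac, ha⟩) := ⟨by simp, .inl hac⟩
  have h2 : (quiver.incidenceGraph (posFaces ∪ negFaces) v).Adj (.inl ⟨b, hb⟩)
      (.inr ⟨c, hc, a, hac, ha⟩) := ⟨by simp, .inl hbc⟩
  exact ⟨ha, hb, h1.reachable.trans h2.symm.reachable⟩

theorem connected_of {v : Vertex} (a : Arrow) (ha : quiver.head a = v ∨ quiver.tail a = v)
    (h : ∀ b, quiver.head b = v ∨ quiver.tail b = v → Linked v b a) :
    (quiver.incidenceGraph (posFaces ∪ negFaces) v).Connected := by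
  have key : ∀ x, (quiver.incidenceGraph (posFaces ∪ negFaces) v).Reachable x (.inl ⟨a, ha⟩) := by
    rintro (⟨b, hb⟩ | ⟨c, hc, b, hbc, hb⟩)
    · exact (h b hb).2.2
    · have h1 : (quiver.incidenceGraph (posFaces ∪ negFaces) v).Adj (.inl ⟨b, hb⟩)
        (.inr ⟨c, hc, b, hbc, hb⟩) := ⟨by simp, .inl hbc⟩
      exact h1.symm.reachable.trans (h b hb).2.2
  exact { preconnected := fun x y => (key x).trans (key y).symm, nonempty := ⟨.inl ⟨a, ha⟩⟩ }

theorem pos_mem (i j : ℤ) (h : (i, j) ≠ (0, 0)) :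
    (([diag i j h, up (i + 1) j, right i j] : List Arrow) : Cycle Arrow) ∈ posFaces ∪ negFaces :=
  .inl (.inl ⟨i, j, h, rfl⟩)

theorem neg_mem (i j : ℤ) (h : (i, j) ≠ (0, 0)) :
    (([diag i j h, right i (j + 1), up i j] : List Arrow) : Cycle Arrow) ∈ posFaces ∪ negFaces :=
  .inr (.inl ⟨i, j, h, rfl⟩)

theorem pos_mem₁ : (([xB01, xAB, x01A] : List Arrow) : Cycle Arrow) ∈ posFaces ∪ negFaces :=
  .inl (.inr (.inl rfl))

theorem pos_mem₂ : (([xA00, x10A, right 0 0] : List Arrow) : Cycle Arrow) ∈ posFaces ∪ negFaces :=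
  .inl (.inr (.inr (.inl rfl)))

theorem pos_mem₃ : (([xB10, x11B, up 1 0] : List Arrow) : Cycle Arrow) ∈ posFaces ∪ negFaces :=
  .inl (.inr (.inr (.inr rfl)))

theorem neg_mem₁ : (([xB01, x11B, right 0 1] : List Arrow) : Cycle Arrow) ∈ posFaces ∪ negFaces :=
  .inr (.inr (.inl rfl))

theorem neg_mem₂ : (([xA00, x01A, up 0 0] : List Arrow) : Cycle Arrow) ∈ posFaces ∪ negFaces :=
  .inr (.inr (.inr (.inl rfl)))

theorem neg_mem₃ : (([xB10, xAB, x10A] : List Arrow) : Cycle Arrow) ∈ posFaces ∪ negFaces :=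
  .inr (.inr (.inr (.inr rfl)))

/-- The upper right square at a grid point. -/
theorem linked_ne (i j : ℤ) : Linked (grid i j) (right i j) (up i j) := by
  by_cases h : (i, j) = (0, 0)
  · obtain ⟨rfl, rfl⟩ := Prod.mk.inj h
    exact (Linked.of_mem (b := xA00) _ pos_mem₂ (by simp) (by simp) (.inr rfl) (.inl rfl)).trans
      (.of_mem _ neg_mem₂ (by simp) (by simp) (.inl rfl) (.inr rfl))
  · exact (Linked.of_mem (b := diag i j h) _ (pos_mem i j h) (by simp) (by simp) (.inr rfl)
      (.inl rfl)).trans (.of_mem _ (neg_mem i j h) (by simp) (by simp) (.inl rfl) (.inr rfl))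

/-- The upper left square at a grid point. -/
theorem linked_nw (i j : ℤ) : Linked (grid (i + 1) j) (right i j) (up (i + 1) j) := by
  by_cases h : (i, j) = (0, 0)
  · obtain ⟨rfl, rfl⟩ := Prod.mk.inj h
    have h1 : Linked (grid 1 0) (right 0 0) x10A :=
      .of_mem _ pos_mem₂ (by simp) (by simp) (.inl rfl) (.inr rfl)
    have h2 : Linked (grid 1 0) x10A xB10 :=
      .of_mem _ neg_mem₃ (by simp) (by simp) (.inr rfl) (.inl rfl)
    have h3 : Linked (grid 1 0) xB10 (up 1 0) :=
      .of_mem _ pos_mem₃ (by simp) (by simp) (.inl rfl) (.inr rfl)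
    exact (h1.trans h2).trans h3
  · exact .of_mem _ (pos_mem i j h) (by simp) (by simp) (.inl rfl) (.inr rfl)

/-- The lower right square at a grid point. -/
theorem linked_se (i j : ℤ) : Linked (grid i (j + 1)) (up i j) (right i (j + 1)) := by
  by_cases h : (i, j) = (0, 0)
  · obtain ⟨rfl, rfl⟩ := Prod.mk.inj h
    have h1 : Linked (grid 0 1) (up 0 0) x01A :=
      .of_mem _ neg_mem₂ (by simp) (by simp) (.inl rfl) (.inr rfl)
    have h2 : Linked (grid 0 1) x01A xB01 :=
      .of_mem _ pos_mem₁ (by simp) (by simp) (.inr rfl) (.inl rfl)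
    have h3 : Linked (grid 0 1) xB01 (right 0 1) :=
      .of_mem _ neg_mem₁ (by simp) (by simp) (.inl rfl) (.inr rfl)
    exact (h1.trans h2).trans h3
  · exact .of_mem _ (neg_mem i j h) (by simp) (by simp) (.inl rfl) (.inr rfl)

/-- The lower left square at a grid point. -/
theorem linked_sw (i j : ℤ) :
    Linked (grid (i + 1) (j + 1)) (up (i + 1) j) (right i (j + 1)) := by
  by_cases h : (i, j) = (0, 0)
  · obtain ⟨rfl, rfl⟩ := Prod.mk.inj h
    have h1 : Linked (grid 1 1) (up 1 0) x11B :=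
      .of_mem _ pos_mem₃ (by simp) (by simp) (.inl rfl) (.inr rfl)
    have h2 : Linked (grid 1 1) x11B (right 0 1) :=
      .of_mem _ neg_mem₁ (by simp) (by simp) (.inr rfl) (.inl rfl)
    exact h1.trans h2
  · exact (Linked.of_mem (b := diag i j h) _ (pos_mem i j h) (by simp) (by simp) (.inl rfl)
      (.inr rfl)).trans (.of_mem _ (neg_mem i j h) (by simp) (by simp) (.inr rfl) (.inl rfl))

theorem manifold_grid (i j : ℤ) (b : Arrow)
    (hb : quiver.head b = grid i j ∨ quiver.tail b = grid i j) :
    Linked (grid i j) b (up i j) := by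
  obtain hb | hb := hb <;> cases b <;> cases hb
  · exact linked_nw _ _
  · exact (linked_se _ _).trans (linked_ne _ _)
  · exact .of_mem _ (neg_mem _ _ ‹_›) (by simp) (by simp) (.inl rfl) (.inr rfl)
  · exact .of_mem _ neg_mem₂ (by simp) (by simp) (.inl rfl) (.inr rfl)
  · have h : Linked (grid 0 1) xB01 (right 0 1) :=
      .of_mem _ neg_mem₁ (by simp) (by simp) (.inl rfl) (.inr rfl)
    exact h.trans (linked_ne 0 1)
  · exact .of_mem _ pos_mem₃ (by simp) (by simp) (.inl rfl) (.inr rfl)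
  · exact linked_ne _ _
  · exact (linked_ne _ _).symm.trans (linked_ne _ _)
  · exact (Linked.of_mem _ (neg_mem _ _ ‹_›) (by simp) (by simp) (.inr rfl) (.inl rfl)).trans
      (linked_nw _ _)
  · have h : Linked (grid 0 1) x01A (up 0 0) :=
      .of_mem _ neg_mem₂ (by simp) (by simp) (.inr rfl) (.inl rfl)
    exact (h.trans (linked_se 0 0)).trans (linked_ne 0 1)
  · have h : Linked (grid 1 0) x10A (right 0 0) :=
      .of_mem _ pos_mem₂ (by simp) (by simp) (.inr rfl) (.inl rfl)
    exact h.trans (linked_nw 0 0)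
  · have h : Linked (grid 1 1) x11B (right 0 1) :=
      .of_mem _ neg_mem₁ (by simp) (by simp) (.inr rfl) (.inl rfl)
    exact h.trans (linked_nw 0 1)

theorem manifold_A (b : Arrow) (hb : quiver.head b = A ∨ quiver.tail b = A) :
    Linked A b xAB := by
  have h : Linked A x10A xAB := .of_mem _ neg_mem₃ (by simp) (by simp) (.inl rfl) (.inr rfl)
  obtain hb | hb := hb <;> cases b <;> cases hb
  · exact .of_mem _ pos_mem₁ (by simp) (by simp) (.inl rfl) (.inr rfl)
  · exact h
  · exact h.symm.trans h
  · exact (Linked.of_mem _ pos_mem₂ (by simp) (by simp) (.inr rfl) (.inl rfl)).trans h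

theorem manifold_B (b : Arrow) (hb : quiver.head b = B ∨ quiver.tail b = B) :
    Linked B b xAB := by
  have h : Linked B xB01 xAB := .of_mem _ pos_mem₁ (by simp) (by simp) (.inr rfl) (.inl rfl)
  obtain hb | hb := hb <;> cases b <;> cases hb
  · exact (Linked.of_mem _ neg_mem₁ (by simp) (by simp) (.inl rfl) (.inr rfl)).trans h
  · exact h.symm.trans h
  · exact h
  · exact .of_mem _ neg_mem₃ (by simp) (by simp) (.inr rfl) (.inl rfl)

theorem manifold (v : Vertex) :
    (quiver.incidenceGraph (posFaces ∪ negFaces) v).Connected := by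
  cases v with
  | grid i j => exact connected_of (up i j) (.inr rfl) (manifold_grid i j)
  | A => exact connected_of xAB (.inr rfl) manifold_A
  | B => exact connected_of xAB (.inl rfl) manifold_B

theorem face_props (c : Cycle Arrow) (hc : c ∈ posFaces ∪ negFaces) :
    (c.Chain fun a b => quiver.tail a = quiver.head b) ∧ 3 ≤ c.length ∧ c.Nodup := by
  obtain (⟨i, j, h, rfl⟩ | rfl | rfl | rfl) | (⟨i, j, h, rfl⟩ | rfl | rfl | rfl) := hc <;>
    refine ⟨?_, le_rfl, by simp⟩ <;> simp [quiver]

/-- The square grid with the modified central square, as a dimer model. -/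
def dimer : DimerModel where
  toArrowQuiver := quiver
  pos := posFaces
  neg := negFaces
  strongly_connected u v := (reach_origin u).2.trans (reach_origin v).1
  disjoint := disjoint_faces
  isCycle c hc := (face_props c hc).1
  three_le_length c hc := (face_props c hc).2.1
  nodup c hc := (face_props c hc).2.2
  existsUnique_pos a :=
    let ⟨c, hc, ha⟩ := exists_pos_mem a
    ⟨c, ⟨hc, ha⟩, fun _ hd => (eq_pos_of_mem hd.1 hd.2).trans (eq_pos_of_mem hc ha).symm⟩
  existsUnique_neg a :=
    let ⟨c, hc, ha⟩ := exists_neg_mem a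
    ⟨c, ⟨hc, ha⟩, fun _ hd => (eq_neg_of_mem hd.1 hd.2).trans (eq_neg_of_mem hc ha).symm⟩
  manifold := manifold
  finite_head v := by
    classical
    cases v with
    | grid i j =>
      refine Set.Finite.subset (s := {right (i - 1) j, up i (j - 1), xA00, xB01, xB10} ∪
        {a | ∃ h, a = diag i j h}) ?_ ?_
      · refine Set.Finite.union (Set.toFinite _) (Set.Subsingleton.finite ?_)
        rintro _ ⟨_, rfl⟩ _ ⟨_, rfl⟩
        rfl
      · intro a ha
        cases a <;> cases ha <;> simp [*]
    | A =>
      refine Set.Finite.subset (s := {x01A, x10A}) (Set.toFinite _) ?_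
      intro a ha
      cases a <;> cases ha <;> simp
    | B =>
      refine Set.Finite.subset (s := {x11B, xAB}) (Set.toFinite _) ?_
      intro a ha
      cases a <;> cases ha <;> simp
  finite_tail v := by
    classical
    cases v with
    | grid i j =>
      refine Set.Finite.subset (s := {right i j, up i j, x01A, x10A, x11B} ∪
        {a | ∃ h, a = diag (i - 1) (j - 1) h}) ?_ ?_
      · refine Set.Finite.union (Set.toFinite _) (Set.Subsingleton.finite ?_)
        rintro _ ⟨_, rfl⟩ _ ⟨_, rfl⟩
        rfl
      · intro a ha
        cases a <;> cases ha <;> simp [*]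
    | A =>
      refine Set.Finite.subset (s := {xAB, xA00}) (Set.toFinite _) ?_
      intro a ha
      cases a <;> cases ha <;> simp
    | B =>
      refine Set.Finite.subset (s := {xB01, xB10}) (Set.toFinite _) ?_
      intro a ha
      cases a <;> cases ha <;> simp

/-- The position of the vertices in the plane. -/
def drawing : dimer.V → ℝ × ℝ
  | grid i j => (i, j)
  | A => (1 / 3, 1 / 2)
  | B => (2 / 3, 1 / 2)

end ModifiedGrid

end

noncomputable section

/-! ### Paths and the path algebra. -/

namespace ArrowQuiver

variable {Q : ArrowQuiver}

/-! Reduction to one vertex. All faces are triangles, so the relations are homogeneous and the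
Jacobi algebra A is graded by path length. In each δ the summands that multiply an arrow into the
left tensor factor raise the length of that factor by one, and the other summands preserve it. The
leading parts are therefore, for each vertex v, the maps of left modules A v → ⨁_{h(a)=v} A t(a) →
⨁_{t(b)=v} A h(b) → A v given by right multiplication with arrows. Descending induction on the
length of the left factor (`mem_range_of_step`) transfers exactness from these complexes to the
bimodule complex; functionals on the right factor (`slice`) turn tensors into elements of A. At the
third place the one-vertex complex is always exact, because the relations generate the ideal
(`exists_syzygy`), and the augmented end of the bimodule complex is elementary
(`exact_delta1_augmentation`). What remains are the two conditions `LocallyInjective` and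
`LocallyExact`.

The algebra of the modified grid. The perfect matching `zdeg` gives every path a degree. The degrees
that occur between two vertices are listed in `Admissible`. Let κ be the difference of the two paths
around the central square from (0,0) to (1,1). It satisfies κ·(A→(0,0)) = 0 and ((1,1)→B)·κ = 0, and
by commuting diagonals towards the centre one finds that the ideal of κ is spanned by the elements
`defect k l i j`: κ extended by monotone paths from the lower left quadrant and into the upper right
one. Modulo this span a path is determined by its head, tail and degree (`Walk.sub_mem_defects`).

Two invariants control A. The `mass` counts paths by head and degree; on A v its kernel consists of
defects (`mem_defects_of_mass_eq_zero`). The functional `top` counts monotone paths that pass above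
the central square; it is well defined because the central square is the only one without a
commutation relation, and it shows that the defects are linearly independent (`eq_zero_of_top`). In
particular κ ≠ 0, while κ·(A→(0,0)) = 0, so cancellation fails.

Local exactness. Right multiplication by an arrow only shifts masses, so a compatible family has
masses that come from a common source v. They are realised by an element of A v as soon as the
degrees involved are admissible at v. By `admissible_of_forall` this is automatic except for paths
of degree 0 from A to the upper right quadrant. There the relation of A→(0,0) equates paths through
(0,1), which lie above the central square, with paths through (1,0), which do not, and `top` forces
the masses to vanish: the same functional that detects κ rescues exactness. After subtraction of
this element only a family of defects is left, and it is lifted by hand using `top`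
(`exists_mul_cl_of_mem_defects`).

Tiling. `faceAt` assigns to every point a triangle that contains it, and to an interior point of a
triangle that very triangle, which gives covering and disjointness at once. -/

theorem IsPath.of_append : ∀ {l m : List Q.E} {u w : Q.V}, Q.IsPath u (l ++ m) w →
    ∃ v, Q.IsPath u l v ∧ Q.IsPath v m w
  | [], _, u, _, h => ⟨u, rfl, h⟩
  | _ :: _, _, _, _, h =>
    let ⟨v, h1, h2⟩ := IsPath.of_append h.2
    ⟨v, ⟨h.1, h1⟩, h2⟩

/-- Paths are built from trivial paths by appending arrows on the right. -/
theorem Path.snoc_induction {P : Q.Path → Prop} (triv : ∀ v, P (Path.triv v))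
    (snoc : ∀ (p : Q.Path) (b : Q.E) (h : p.tail = Q.head b), P p → P (p.comp (Path.ofArrow b) h))
    (p : Q.Path) : P p := by
  obtain ⟨u, v, l, h⟩ := p
  induction l using List.reverseRecOn generalizing v with
  | nil => obtain rfl : u = v := h; exact triv u
  | append_singleton l b ih =>
    obtain ⟨w, h1, h2⟩ := IsPath.of_append h
    obtain ⟨rfl, rfl⟩ : Q.head b = w ∧ Q.tail b = v := h2
    exact snoc ⟨u, Q.head b, l, h1⟩ b rfl (ih _ h1)

theorem pathAlgebra_induction {P : Q.PathAlgebra → Prop} (path : ∀ p, P (ofPath p))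
    (zero : P 0) (add : ∀ x y, P x → P y → P (x + y)) (smul : ∀ (c : ℂ) x, P x → P (c • x))
    (x : Q.PathAlgebra) : P x := by
  refine Finsupp.induction_linear (motive := P) x zero (fun f g => add f g) fun p c => ?_
  have h : (Finsupp.single p c : Q.Path →₀ ℂ) = c • Finsupp.single p 1 := by simp
  rw [h]
  exact smul c _ (path p)

theorem isPath_cons {a : Q.E} {l : List Q.E} {u v : Q.V} (h : Q.head a = u)
    (h' : Q.IsPath (Q.tail a) l v) : Q.IsPath u (a :: l) v := ⟨h, h'⟩

theorem isPath_pair {a b : Q.E} {u v : Q.V} (h : Q.head a = u) (h' : Q.head b = Q.tail a)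
    (h'' : Q.tail b = v) : Q.IsPath u [a, b] v := ⟨h, h', h''⟩

theorem ofPath_mul_ofPath_of_eq {p q : Q.Path} (h : p.tail = q.head) :
    ofPath p * ofPath q = ofPath (p.comp q h) :=
  (ofPath_mul_ofPath p q).trans (dif_pos h)

theorem ofPath_mul_ofPath_of_ne {p q : Q.Path} (h : p.tail ≠ q.head) :
    ofPath p * ofPath q = 0 :=
  (ofPath_mul_ofPath p q).trans (dif_neg h)

theorem word_eq_ofPath : ∀ {l : List Q.E} {u v : Q.V} (h : Q.IsPath u l v),
    word u l = ofPath ⟨u, v, l, h⟩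
  | [], u, v, h => by obtain rfl : u = v := h; rfl
  | a :: l, u, v, h => by
    have h1 : Q.head a = u := h.1
    have h2 : Q.IsPath (Q.tail a) l v := h.2
    rw [word, word_eq_ofPath h2]
    refine (congrArg _ (ofPath_mul_ofPath_of_eq rfl)).trans ?_
    refine (ofPath_mul_ofPath_of_eq h1.symm).trans ?_
    rfl

end ArrowQuiver

namespace DimerModel

open ArrowQuiver

variable {Q : DimerModel}

/-! ### The Jacobi algebra is spanned by classes of paths -/

theorem jacobi_induction {P : Q.Jacobi → Prop} (path : ∀ p, P (cls p))
    (zero : P 0) (add : ∀ x y, P x → P y → P (x + y)) (smul : ∀ (c : ℂ) x, P x → P (c • x))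
    (x : Q.Jacobi) : P x := by
  obtain ⟨x, rfl⟩ := Q.proj_surjective x
  induction x using pathAlgebra_induction with
  | path p => exact path p
  | zero => rw [map_zero]; exact zero
  | add x y hx hy => rw [map_add]; exact add _ _ hx hy
  | smul c x hx => rw [map_smul]; exact smul _ _ hx

theorem cls_mul_cls (p q : Q.Path) (h : p.tail = q.head) : cls p * cls q = cls (p.comp q h) := by
  rw [cls, cls, ← proj_mul, ofPath_mul_ofPath, pathMul, dif_pos h]
  rfl

theorem cls_mul_cls_of_ne (p q : Q.Path) (h : p.tail ≠ q.head) : cls p * cls q = 0 := by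
  rw [cls, cls, ← proj_mul, ofPath_mul_ofPath, pathMul, dif_neg h, map_zero]

theorem cls_mul_arr (p : Q.Path) (b : Q.E) (h : p.tail = Q.head b) :
    cls p * arr b = cls (p.comp (Path.ofArrow b) h) := cls_mul_cls p (Path.ofArrow b) h

theorem arr_mul_cls (p : Q.Path) (b : Q.E) (h : Q.tail b = p.head) :
    arr b * cls p = cls ((Path.ofArrow b).comp p h) := cls_mul_cls (Path.ofArrow b) p h

theorem cls_mul_idem (p : Q.Path) : cls p * idem p.tail = cls p := by
  rw [idem, cls_mul_cls _ _ rfl]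
  congr 1
  ext1
  · rfl
  · rfl
  · exact List.append_nil _

theorem idem_mul_cls (p : Q.Path) : idem p.head * cls p = cls p := by
  rw [idem, cls_mul_cls _ _ rfl]
  rfl

theorem cls_mul_idem_of_ne (p : Q.Path) {v : Q.V} (h : p.tail ≠ v) : cls p * idem v = 0 :=
  cls_mul_cls_of_ne _ _ h

theorem idem_mul_cls_of_ne (p : Q.Path) {v : Q.V} (h : v ≠ p.head) : idem v * cls p = 0 :=
  cls_mul_cls_of_ne _ _ h

theorem idem_mul_idem_of_ne {u v : Q.V} (h : u ≠ v) : idem u * idem v = (0 : Q.Jacobi) :=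
  cls_mul_cls_of_ne _ _ h

theorem arr_mul_idem (b : Q.E) : arr b * idem (Q.tail b) = arr b := cls_mul_idem (Path.ofArrow b)

theorem idem_mul_arr (b : Q.E) : idem (Q.head b) * arr b = arr b := idem_mul_cls (Path.ofArrow b)

theorem arr_mul_idem_of_ne {b : Q.E} {v : Q.V} (h : Q.tail b ≠ v) : arr b * idem v = 0 :=
  cls_mul_idem_of_ne (Path.ofArrow b) h

theorem idem_mul_arr_of_ne {b : Q.E} {v : Q.V} (h : v ≠ Q.head b) : idem v * arr b = 0 :=
  idem_mul_cls_of_ne (Path.ofArrow b) h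

theorem cls_mul_arr_of_ne (p : Q.Path) {b : Q.E} (h : p.tail ≠ Q.head b) : cls p * arr b = 0 :=
  cls_mul_cls_of_ne _ _ h

theorem mul_arr_eq_zero {x : Q.Jacobi} {v : Q.V} (hx : x * idem v = x) {b : Q.E}
    (h : v ≠ Q.head b) : x * arr b = 0 := by
  rw [← hx, mul_assoc, idem_mul_arr_of_ne h, mul_zero]

theorem arr_mul_eq_zero {x : Q.Jacobi} {v : Q.V} (hx : idem v * x = x) {b : Q.E}
    (h : Q.tail b ≠ v) : arr b * x = 0 := by
  rw [← hx, ← mul_assoc, arr_mul_idem_of_ne h, zero_mul]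

theorem mul_arr_mul_idem (x : Q.Jacobi) (b : Q.E) : x * arr b * idem (Q.tail b) = x * arr b := by
  rw [mul_assoc, arr_mul_idem]

theorem mul_idem_of_ne {x : Q.Jacobi} {v w : Q.V} (hx : x * idem v = x) (h : v ≠ w) :
    x * idem w = 0 := by
  rw [← hx, mul_assoc, idem_mul_idem_of_ne h, mul_zero]

theorem mem_leftMod {v : Q.V} {x : Q.Jacobi} : x ∈ leftMod v ↔ x * idem v = x := by
  constructor
  · rintro ⟨y, rfl⟩
    simp only [LinearMap.mulRight_apply, mul_assoc, idem_mul_idem]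
  · exact fun h => ⟨x, h⟩

theorem mem_rightMod {v : Q.V} {x : Q.Jacobi} : x ∈ rightMod v ↔ idem v * x = x := by
  constructor
  · rintro ⟨y, rfl⟩
    simp only [LinearMap.mulLeft_apply, ← mul_assoc, idem_mul_idem]
  · exact fun h => ⟨x, h⟩

/-! ### Dimer models whose faces are triangles -/

variable (Q) in
/-- The faces of the dimer model are the triangles `a, φ a, φ² a` (in `pos`) and `a, ψ a, ψ² a`
(in `neg`), so that `rₐ = φ a · φ² a - ψ a · ψ² a`. -/
structure Triangulation where
  φ : Q.E → Q.E
  ψ : Q.E → Q.E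
  φ_φ_φ : ∀ a, φ (φ (φ a)) = a
  ψ_ψ_ψ : ∀ a, ψ (ψ (ψ a)) = a
  head_φ : ∀ a, Q.head (φ a) = Q.tail a
  head_ψ : ∀ a, Q.head (ψ a) = Q.tail a
  posPath_eq : ∀ a, Q.posPath a = [φ a, φ (φ a)]
  negPath_eq : ∀ a, Q.negPath a = [ψ a, ψ (ψ a)]

namespace Triangulation

variable (T : Q.Triangulation)

theorem tail_φ_φ (a : Q.E) : Q.tail (T.φ (T.φ a)) = Q.head a := by
  rw [← T.head_φ, T.φ_φ_φ]

theorem tail_ψ_ψ (a : Q.E) : Q.tail (T.ψ (T.ψ a)) = Q.head a := by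
  rw [← T.head_ψ, T.ψ_ψ_ψ]

theorem isPath_φ (a : Q.E) : Q.IsPath (Q.tail a) [T.φ a, T.φ (T.φ a)] (Q.head a) :=
  isPath_pair (T.head_φ a) (T.head_φ _) (T.tail_φ_φ a)

theorem isPath_ψ (a : Q.E) : Q.IsPath (Q.tail a) [T.ψ a, T.ψ (T.ψ a)] (Q.head a) :=
  isPath_pair (T.head_ψ a) (T.head_ψ _) (T.tail_ψ_ψ a)

theorem relation_eq (a : Q.E) : Q.relation a =
    ofPath ⟨_, _, _, T.isPath_φ a⟩ - ofPath ⟨_, _, _, T.isPath_ψ a⟩ := by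
  rw [relation, T.posPath_eq, T.negPath_eq, word_eq_ofPath (T.isPath_φ a),
    word_eq_ofPath (T.isPath_ψ a)]

theorem arr_mul_arr_φ (b : Q.E) : arr b * arr (T.φ b) =
    cls ⟨Q.head b, Q.tail (T.φ b), [b, T.φ b], isPath_pair rfl (T.head_φ b) rfl⟩ :=
  cls_mul_cls (Path.ofArrow b) (Path.ofArrow (T.φ b)) (T.head_φ b).symm

theorem arr_mul_arr_ψ (b : Q.E) : arr b * arr (T.ψ b) =
    cls ⟨Q.head b, Q.tail (T.ψ b), [b, T.ψ b], isPath_pair rfl (T.head_ψ b) rfl⟩ :=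
  cls_mul_cls (Path.ofArrow b) (Path.ofArrow (T.ψ b)) (T.head_ψ b).symm

theorem relation_mem (T : Q.Triangulation) (a : Q.E) : Q.relation a ∈ Q.jacobiIdeal := by
  refine Submodule.subset_span ⟨ofPath (Path.triv (Q.tail a)), ofPath (Path.triv (Q.head a)), a, ?_⟩
  have h (p : Q.Path) : ofPath (Path.triv p.head) * ofPath p * ofPath (Path.triv p.tail) =
      ofPath p := by
    rw [ofPath_mul_ofPath_of_eq (p := Path.triv p.head) (q := p) rfl,
      ofPath_mul_ofPath_of_eq (by rfl)]
    congr 1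
    ext1
    · rfl
    · rfl
    · exact List.append_nil _
  rw [T.relation_eq, mul_sub, sub_mul]
  exact congrArg₂ _ (h _).symm (h _).symm

theorem arr_mul_arr (a : Q.E) :
    arr (T.φ a) * arr (T.φ (T.φ a)) = arr (T.ψ a) * arr (T.ψ (T.ψ a)) := by
  rw [T.arr_mul_arr_φ, T.arr_mul_arr_ψ, cls, cls, proj_eq_iff]
  convert T.relation_mem a
  rw [T.relation_eq]
  exact congrArg₂ (fun p q : Q.Path => ofPath p - ofPath q)
    (ArrowQuiver.Path.ext (T.head_φ a) (T.tail_φ_φ a) rfl) (ArrowQuiver.Path.ext (T.head_ψ a) (T.tail_ψ_ψ a) rfl)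

/-! ### Linear maps out of the Jacobi algebra from invariants of paths. -/

variable {M : Type*} [AddCommGroup M] [Module ℂ M]

/-- A map on paths that takes the same value on the two sides of each relation. -/
def Invariant {α : Type*} (f : Q.Path → α) : Prop :=
  ∀ (a : Q.E) (u v : Q.V) (l m : List Q.E)
    (h : Q.IsPath u (l ++ [T.φ a, T.φ (T.φ a)] ++ m) v)
    (h' : Q.IsPath u (l ++ [T.ψ a, T.ψ (T.ψ a)] ++ m) v), f ⟨u, v, _, h⟩ = f ⟨u, v, _, h'⟩

/-- The linear extension of a map on paths. -/
def linearExt (f : Q.Path → M) : Q.PathAlgebra →ₗ[ℂ] M :=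
  (Finsupp.linearCombination ℂ f : (Q.Path →₀ ℂ) →ₗ[ℂ] M)

theorem linearExt_ofPath (f : Q.Path → M) (p : Q.Path) : linearExt f (ofPath p) = f p := by
  unfold linearExt ofPath
  erw [Finsupp.linearCombination_single, one_smul]

/-- By linearity in both outer factors it suffices to treat p·rₐ·q with paths p and q. Such a
product is either 0 or the difference of two paths on which the invariant agrees. -/
theorem linearExt_eq_zero {f : Q.Path → M} (hf : T.Invariant f) {z : Q.PathAlgebra}
    (hz : z ∈ Q.jacobiIdeal) : linearExt f z = 0 := by
  induction hz using Submodule.span_induction with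
  | zero => exact map_zero _
  | add x y _ _ hx hy => rw [map_add, hx, hy, add_zero]
  | smul c x _ hx => rw [map_smul, hx, smul_zero]
  | mem z hz =>
    obtain ⟨x, y, a, rfl⟩ := hz
    induction x using pathAlgebra_induction with
    | zero => rw [zero_mul, zero_mul, map_zero]
    | add x y hx hy => rw [add_mul, add_mul, map_add, hx, hy, add_zero]
    | smul c x hx => rw [smul_mul_assoc, smul_mul_assoc, map_smul, hx, smul_zero]
    | path p =>
    induction y using pathAlgebra_induction with
    | zero => rw [mul_zero, map_zero]
    | add x y hx hy => rw [mul_add, map_add, hx, hy, add_zero]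
    | smul c x hx => rw [mul_smul_comm, map_smul, hx, smul_zero]
    | path q =>
    rw [T.relation_eq, mul_sub, sub_mul, map_sub]
    by_cases h : p.tail = Q.tail a
    · rw [ofPath_mul_ofPath_of_eq (q := ⟨_, _, _, T.isPath_φ a⟩) h,
        ofPath_mul_ofPath_of_eq (q := ⟨_, _, _, T.isPath_ψ a⟩) h]
      by_cases h' : Q.head a = q.head
      · rw [ofPath_mul_ofPath_of_eq (by exact h'), ofPath_mul_ofPath_of_eq (by exact h'),
          linearExt_ofPath, linearExt_ofPath]
        exact sub_eq_zero.2 (hf a _ _ p.arrows q.arrows _ _)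
      · rw [ofPath_mul_ofPath_of_ne (by exact h'), ofPath_mul_ofPath_of_ne (by exact h'), sub_self]
    · rw [ofPath_mul_ofPath_of_ne (q := ⟨_, _, _, T.isPath_φ a⟩) h,
        ofPath_mul_ofPath_of_ne (q := ⟨_, _, _, T.isPath_ψ a⟩) h, sub_self]

/-- The linear map on the Jacobi algebra induced by an invariant map on paths. -/
def lift (f : Q.Path → M) (hf : T.Invariant f) : Q.Jacobi →ₗ[ℂ] M :=
  Q.jacobiIdeal.liftQ (linearExt f) fun _ hz => T.linearExt_eq_zero hf hz

theorem lift_cls (f : Q.Path → M) (hf : T.Invariant f) (p : Q.Path) : T.lift f hf (cls p) = f p :=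
  (Q.jacobiIdeal.liftQ_apply _ _).trans (linearExt_ofPath f p)

/-! ### The grading by length -/

theorem invariant_cls : T.Invariant (cls : Q.Path → Q.Jacobi) := by
  intro a u v l m h h'
  obtain ⟨w, h1, h2⟩ := h.of_append
  obtain ⟨w', h3, h4⟩ := h1.of_append
  obtain ⟨rfl, h5, rfl⟩ := h4
  have e : cls ⟨u, v, l ++ [T.φ a, T.φ (T.φ a)] ++ m, h⟩ = cls ⟨u, _, l, h3⟩ *
      (arr (T.φ a) * arr (T.φ (T.φ a))) * cls ⟨_, v, m, h2⟩ := by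
    rw [T.arr_mul_arr_φ, cls_mul_cls _ _ (by rfl), cls_mul_cls _ _ (by rfl)]
    rfl
  have e' : cls ⟨u, v, l ++ [T.ψ a, T.ψ (T.ψ a)] ++ m, h'⟩ = cls ⟨u, _, l, h3⟩ *
      (arr (T.ψ a) * arr (T.ψ (T.ψ a))) * cls ⟨_, v, m, h2⟩ := by
    rw [T.arr_mul_arr_ψ, cls_mul_cls _ _ ((T.head_φ a).trans (T.head_ψ a).symm),
      cls_mul_cls _ _ ((T.tail_ψ_ψ a).trans (T.tail_φ_φ a).symm)]
    rfl
  rw [e, e', T.arr_mul_arr]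

/-- Both sides of a relation have length two, which is where the triangular shape of the faces
enters. -/
theorem invariant_graded (n : ℕ) : T.Invariant fun p : Q.Path =>
    if p.arrows.length = n then (cls p : Q.Jacobi) else 0 := by
  intro a u v l m h h'
  simp only [T.invariant_cls a u v l m h h', List.length_append, List.length_cons]

/-- The component of degree `n` of an element of the Jacobi algebra. -/
def graded (n : ℕ) : Q.Jacobi →ₗ[ℂ] Q.Jacobi := T.lift _ (T.invariant_graded n)

theorem graded_cls (n : ℕ) (p : Q.Path) :
    T.graded n (cls p) = if p.arrows.length = n then cls p else 0 := T.lift_cls _ _ p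

theorem graded_mul_arr (n : ℕ) (x : Q.Jacobi) (b : Q.E) :
    T.graded (n + 1) (x * arr b) = T.graded n x * arr b := by
  induction x using jacobi_induction with
  | zero => simp
  | add x y hx hy => simp only [add_mul, map_add, hx, hy]
  | smul c x hx => simp only [smul_mul_assoc, map_smul, hx]
  | path p =>
    by_cases h : p.tail = Q.head b
    · rw [cls_mul_arr p b h, T.graded_cls, T.graded_cls, ite_mul, cls_mul_arr p b h, zero_mul]
      simp [Path.comp, Path.ofArrow]
    · rw [cls_mul_arr_of_ne p h, T.graded_cls, ite_mul, cls_mul_arr_of_ne p h]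
      simp

theorem graded_zero_mul_arr (x : Q.Jacobi) (b : Q.E) : T.graded 0 (x * arr b) = 0 := by
  induction x using jacobi_induction with
  | zero => simp
  | add x y hx hy => simp only [add_mul, map_add, hx, hy, add_zero]
  | smul c x hx => simp only [smul_mul_assoc, map_smul, hx, smul_zero]
  | path p =>
    by_cases h : p.tail = Q.head b
    · rw [cls_mul_arr p b h, T.graded_cls]
      simp [Path.comp, Path.ofArrow]
    · rw [cls_mul_arr_of_ne p h, map_zero]

theorem graded_mul_idem (n : ℕ) (x : Q.Jacobi) (v : Q.V) :
    T.graded n (x * idem v) = T.graded n x * idem v := by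
  induction x using jacobi_induction with
  | zero => simp
  | add x y hx hy => simp only [add_mul, map_add, hx, hy]
  | smul c x hx => simp only [smul_mul_assoc, map_smul, hx]
  | path p =>
    by_cases h : p.tail = v
    · subst h
      rw [cls_mul_idem p, T.graded_cls, ite_mul, cls_mul_idem p, zero_mul]
    · rw [cls_mul_idem_of_ne p h, T.graded_cls, ite_mul, cls_mul_idem_of_ne p h]
      simp

theorem graded_graded (m n : ℕ) (x : Q.Jacobi) :
    T.graded m (T.graded n x) = if m = n then T.graded n x else 0 := by
  induction x using jacobi_induction with
  | zero => simp
  | add x y hx hy => simp only [map_add, hx, hy]; split_ifs <;> simp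
  | smul c x hx => simp only [map_smul, hx]; split_ifs <;> simp
  | path p =>
    rw [T.graded_cls]
    by_cases h : p.arrows.length = n
    · rw [if_pos h, T.graded_cls, h]
      simp only [eq_comm]
    · rw [if_neg h, map_zero, ite_self]

theorem exists_graded_eq_zero (x : Q.Jacobi) : ∃ N, ∀ n, N ≤ n → T.graded n x = 0 := by
  induction x using jacobi_induction with
  | zero => exact ⟨0, by simp⟩
  | add x y hx hy =>
    obtain ⟨N, hN⟩ := hx
    obtain ⟨N', hN'⟩ := hy
    refine ⟨max N N', fun n hn => ?_⟩
    rw [map_add, hN n (by omega), hN' n (by omega), add_zero]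
  | smul c x hx =>
    obtain ⟨N, hN⟩ := hx
    exact ⟨N, fun n hn => by rw [map_smul, hN n hn, smul_zero]⟩
  | path p =>
    refine ⟨p.arrows.length + 1, fun n hn => ?_⟩
    rw [T.graded_cls, if_neg (by omega)]

theorem exists_sum_graded (x : Q.Jacobi) :
    ∃ N, ∀ n, N ≤ n → x = ∑ k ∈ Finset.range n, T.graded k x := by
  induction x using jacobi_induction with
  | zero => exact ⟨0, by simp⟩
  | add x y hx hy =>
    obtain ⟨N, hN⟩ := hx
    obtain ⟨N', hN'⟩ := hy
    refine ⟨max N N', fun n hn => ?_⟩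
    simp only [map_add, Finset.sum_add_distrib]
    rw [← hN n (by omega), ← hN' n (by omega)]
  | smul c x hx =>
    obtain ⟨N, hN⟩ := hx
    refine ⟨N, fun n hn => ?_⟩
    simp only [map_smul, ← Finset.smul_sum]
    rw [← hN n hn]
  | path p =>
    refine ⟨p.arrows.length + 1, fun n hn => ?_⟩
    simp only [T.graded_cls]
    rw [Finset.sum_ite_eq, if_pos (by simp; omega)]

theorem eq_zero_of_graded {x : Q.Jacobi} (h : ∀ n, T.graded n x = 0) : x = 0 := by
  obtain ⟨N, hN⟩ := T.exists_sum_graded x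
  rw [hN N le_rfl]
  exact Finset.sum_eq_zero fun k _ => h k

end Triangulation

end DimerModel

/-! ### Separating tensors by functionals on the right factor. -/

section

variable {A : Type*} [AddCommGroup A] [Module ℂ A] (M N : Submodule ℂ A)

/-- The map `m ⊗ n ↦ f(n) m`. -/
def TensorProduct.sliceMap (f : A →ₗ[ℂ] ℂ) : M ⊗[ℂ] N →ₗ[ℂ] A :=
  (TensorProduct.rid ℂ A).toLinearMap ∘ₗ TensorProduct.map M.subtype (f ∘ₗ N.subtype)

theorem TensorProduct.sliceMap_tmul (f : A →ₗ[ℂ] ℂ) (m : M) (n : N) :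
    TensorProduct.sliceMap M N f (m ⊗ₜ n) = f n • (m : A) := by
  simp [TensorProduct.sliceMap]

variable {M N} in
open Classical in
-- In a basis of the right factor a tensor is a finite family of left factors. These are its slices
-- along the coordinate functionals, which extend from N to A over a field.
theorem TensorProduct.eq_zero_of_sliceMap {t : M ⊗[ℂ] N}
    (h : ∀ f, TensorProduct.sliceMap M N f t = 0) : t = 0 := by
  let B := Module.Basis.ofVectorSpace ℂ N
  refine (TensorProduct.equivFinsuppOfBasisRight (M := M) B).injective ?_
  rw [map_zero]
  ext i
  obtain ⟨f, hf⟩ := LinearMap.exists_extend (B.coord i)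
  rw [Finsupp.zero_apply, ZeroMemClass.coe_zero, ← h f]
  clear h
  induction t with
  | zero => simp
  | add x y hx hy => simp only [map_add, Finsupp.add_apply, Submodule.coe_add, hx, hy]
  | tmul p q =>
    have h2 : B.repr q i = f q.1 := (LinearMap.congr_fun hf q).symm
    rw [TensorProduct.sliceMap_tmul,
      TensorProduct.equivFinsuppOfBasisRight_apply_tmul_apply (M := M) B p q i, h2,
      Submodule.coe_smul]

end

namespace DimerModel

open ArrowQuiver

variable {Q : DimerModel}

/-! ### Slices of tensors -/

/-- The element `x ⊗ y` of `A u ⊗ w A`. -/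
def tmul {u w : Q.V} (x : leftMod u) (y : rightMod w) : Bimod u w :=
  TensorProduct.tmul ℂ (M := leftMod u) (N := rightMod w) x y

/-- The map `q₁ ⊗ q₂ ↦ f(q₂) q₁`. -/
def slice {u w : Q.V} (f : Q.Jacobi →ₗ[ℂ] ℂ) : Bimod u w →ₗ[ℂ] Q.Jacobi :=
  TensorProduct.sliceMap (leftMod u) (rightMod w) f

theorem slice_tmul {u w : Q.V} (f : Q.Jacobi →ₗ[ℂ] ℂ) (x : leftMod u) (y : rightMod w) :
    slice f (tmul x y) = f y.1 • x.1 := TensorProduct.sliceMap_tmul _ _ f x y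

theorem bimod_induction {u w : Q.V} {P : Bimod u w → Prop} (zero : P 0)
    (tmul : ∀ (x : leftMod u) (y : rightMod w), P (tmul x y))
    (add : ∀ x y, P x → P y → P (x + y)) (t : Bimod u w) : P t :=
  TensorProduct.induction_on (motive := P) t zero tmul add

theorem slice_mul_idem {u w : Q.V} (f : Q.Jacobi →ₗ[ℂ] ℂ) (t : Bimod u w) :
    slice f t * idem u = slice f t := by
  induction t using bimod_induction with
  | zero => simp
  | add x y hx hy => rw [map_add, add_mul, hx, hy]
  | tmul x y => rw [slice_tmul, smul_mul_assoc, mem_leftMod.1 x.2]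

theorem slice_comp_idem {u w : Q.V} (f : Q.Jacobi →ₗ[ℂ] ℂ) (t : Bimod u w) :
    slice (f ∘ₗ LinearMap.mulLeft ℂ (idem w)) t = slice f t := by
  induction t using bimod_induction with
  | zero => simp
  | add x y hx hy => rw [map_add, map_add, hx, hy]
  | tmul x y =>
    rw [slice_tmul, slice_tmul, LinearMap.comp_apply, LinearMap.mulLeft_apply, mem_rightMod.1 y.2]

theorem sandwich_tmul {u w u' w' : Q.V} (x y : Q.Jacobi) (p : leftMod u) (q : rightMod w) :
    sandwich u w u' w' x y (tmul p q) =
      tmul ⟨p.1 * x * idem u', ⟨p.1 * x, rfl⟩⟩ ⟨idem w' * (y * q.1), ⟨y * q.1, rfl⟩⟩ := rfl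

theorem slice_sandwich {u w u' w' : Q.V} (f : Q.Jacobi →ₗ[ℂ] ℂ) (x y : Q.Jacobi) (t : Bimod u w) :
    slice f (sandwich u w u' w' x y t) =
      slice (f ∘ₗ LinearMap.mulLeft ℂ (idem w' * y)) t * (x * idem u') := by
  induction t using bimod_induction with
  | zero => simp
  | add x y hx hy => simp only [map_add, hx, hy, add_mul]
  | tmul p q =>
    rw [sandwich_tmul, slice_tmul, slice_tmul]
    simp only [LinearMap.comp_apply, LinearMap.mulLeft_apply, smul_mul_assoc, mul_assoc]

theorem eq_zero_of_slice {u w : Q.V} {t : Bimod u w} (h : ∀ f, slice f t = 0) : t = 0 :=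
  TensorProduct.eq_zero_of_sliceMap h

open Classical in
theorem slice_lof {I : Type} {l r : I → Q.V} (f : Q.Jacobi →ₗ[ℂ] ℂ) (i j : I)
    (t : Bimod (l i) (r i)) :
    slice f ((DirectSum.lof ℂ I (fun i => Bimod (l i) (r i)) i t) j) =
      if i = j then slice f t else 0 := by
  split_ifs with h
  · subst h
    rw [DirectSum.lof_apply]
  · rw [DirectSum.lof_eq_of, DirectSum.of_eq_of_ne _ _ _ (Ne.symm h), map_zero]

theorem eq_zero_of_slices {I : Type} {l r : I → Q.V} {z : ⨁ i, Bimod (l i) (r i)}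
    (h : ∀ i f, slice f (z i) = 0) : z = 0 :=
  DFinsupp.ext fun i => eq_zero_of_slice (h i)

open Classical in
theorem directSum_induction {I : Type} {l r : I → Q.V} {P : (⨁ i, Bimod (l i) (r i)) → Prop}
    (zero : P 0) (lof : ∀ i t, P (DirectSum.lof ℂ I (fun i => Bimod (l i) (r i)) i t))
    (add : ∀ x y, P x → P y → P (x + y)) (z : ⨁ i, Bimod (l i) (r i)) : P z :=
  DirectSum.induction_on z zero lof add

open Classical in
theorem delta1_lof (b : Q.E) (t : Bimod (Q.head b) (Q.tail b)) :
    Q.delta1 (DirectSum.lof ℂ Q.E (fun b => Bimod (Q.head b) (Q.tail b)) b t) =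
      DirectSum.lof ℂ Q.V (fun v => Bimod v v) (Q.tail b)
        (sandwich _ _ _ _ (arr b) (idem (Q.tail b)) t) -
      DirectSum.lof ℂ Q.V (fun v => Bimod v v) (Q.head b)
        (sandwich _ _ _ _ (idem (Q.head b)) (arr b) t) :=
  DirectSum.toModule_lof ℂ _ _

open Classical in
theorem slice_lof_arrow {l r : Q.E → Q.V} (f : Q.Jacobi →ₗ[ℂ] ℂ) (i j : Q.E)
    (t : Bimod (l i) (r i)) :
    slice f ((DirectSum.lof ℂ Q.E (fun i => Bimod (l i) (r i)) i t) j) =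
      if i = j then slice f t else 0 := slice_lof f i j t

open Classical in
theorem slice_lof_vertex (f : Q.Jacobi →ₗ[ℂ] ℂ) (u v : Q.V) (t : Bimod u u) :
    slice f ((DirectSum.lof ℂ Q.V (fun v => Bimod v v) u t) v) =
      if u = v then slice f t else 0 := slice_lof (l := fun v => v) (r := fun v => v) f u v t

open Classical in
-- The first sum multiplies the left factor by an arrow and so raises its length; the second leaves
-- the left factor alone and only changes the functional. This splitting, also visible in
-- `slice_delta2` and `slice_delta3`, is what the filtration argument uses.
theorem slice_delta1 (z : Q.C1) (v : Q.V) (f : Q.Jacobi →ₗ[ℂ] ℂ) :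
    slice f (Q.delta1 z v) =
      ∑ b ∈ (Q.finite_tail v).toFinset, slice f (z b) * arr b -
      ∑ b ∈ (Q.finite_head v).toFinset, slice (f ∘ₗ LinearMap.mulLeft ℂ (arr b)) (z b) := by
  induction z using directSum_induction with
  | zero => simp
  | add x y hx hy =>
    simp only [map_add, DirectSum.add_apply, hx, hy, add_mul, Finset.sum_add_distrib]
    abel
  | lof b t =>
    rw [delta1_lof, DirectSum.sub_apply, map_sub]
    simp only [slice_lof_arrow, slice_lof_vertex, ite_mul, zero_mul, Finset.sum_ite_eq,
      Set.Finite.mem_toFinset, Set.mem_ofPred_eq, slice_sandwich, idem_mul_idem, idem_mul_arr,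
      arr_mul_idem, slice_comp_idem, slice_mul_idem]

open Classical in
theorem delta3_lof (v : Q.V) (t : Bimod v v) :
    Q.delta3 (DirectSum.lof ℂ Q.V (fun v => Bimod v v) v t) =
      ∑ a ∈ (Q.finite_head v).toFinset,
        DirectSum.lof ℂ Q.E (fun a => Bimod (Q.tail a) (Q.head a)) a
          (sandwich _ _ _ _ (arr a) (idem v) t) -
      ∑ a ∈ (Q.finite_tail v).toFinset,
        DirectSum.lof ℂ Q.E (fun a => Bimod (Q.tail a) (Q.head a)) a
          (sandwich _ _ _ _ (idem v) (arr a) t) := by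
  refine (DirectSum.toModule_lof ℂ _ _).trans ?_
  simp only [LinearMap.sub_apply, LinearMap.sum_apply, LinearMap.comp_apply]

open Classical in
theorem slice_delta3 (z : Q.C3) (a : Q.E) (f : Q.Jacobi →ₗ[ℂ] ℂ) :
    slice f (Q.delta3 z a) = slice f (z (Q.head a)) * arr a -
      slice (f ∘ₗ LinearMap.mulLeft ℂ (arr a)) (z (Q.tail a)) := by
  induction z using directSum_induction with
  | zero => simp
  | add x y hx hy =>
    simp only [map_add, DirectSum.add_apply, hx, hy, add_mul]
    abel
  | lof v t =>
    rw [delta3_lof, DirectSum.sub_apply, map_sub, DFinsupp.finsetSum_apply,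
      DFinsupp.finsetSum_apply, map_sum, map_sum]
    simp only [slice_lof_arrow, slice_lof_vertex, ite_mul, zero_mul, Finset.sum_ite_eq',
      Set.Finite.mem_toFinset, Set.mem_ofPred_eq, slice_sandwich]
    congr 1
    · by_cases h : Q.head a = v
      · subst h
        simp only [if_true, idem_mul_idem, slice_comp_idem, arr_mul_idem]
      · rw [if_neg h, if_neg (Ne.symm h)]
    · by_cases h : Q.tail a = v
      · subst h
        simp only [if_true, idem_mul_idem, idem_mul_arr, slice_mul_idem]
      · rw [if_neg h, if_neg (Ne.symm h)]

theorem proj_word_pair {u : Q.V} {b : Q.E} (h : Q.head b = u) :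
    Q.proj (word u [b]) = arr b := by
  subst h
  rw [word_eq_ofPath (isPath_cons (l := []) rfl rfl)]
  rfl

open Classical in
theorem pathDerivation_pair {u w : Q.V} {b c : Q.E} (h : Q.head b = u) (h' : Q.head c = Q.tail b)
    (t : Bimod u w) :
    Q.pathDerivation u w [b, c] t =
      DirectSum.lof ℂ Q.E (fun b => Bimod (Q.head b) (Q.tail b)) b
        (sandwich _ _ _ _ (idem u) (arr c) t) +
      DirectSum.lof ℂ Q.E (fun b => Bimod (Q.head b) (Q.tail b)) c
        (sandwich _ _ _ _ (arr b) (idem (Q.tail c)) t) := by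
  rw [pathDerivation, LinearMap.sum_apply]
  refine (Fin.sum_univ_two _).trans ?_
  rw [← proj_word_pair h, ← proj_word_pair h']
  rfl

theorem slice_sandwich_arr {u w v : Q.V} {b : Q.E} (f : Q.Jacobi →ₗ[ℂ] ℂ) (h : Q.tail b = v)
    (t : Bimod u w) {w' : Q.V} (h' : w' = w) :
    slice f (sandwich u w v w' (arr b) (idem w') t) = slice f t * arr b := by
  subst h h'
  rw [slice_sandwich, idem_mul_idem, slice_comp_idem, arr_mul_idem]

theorem slice_arr_sandwich {u w v : Q.V} {b : Q.E} (f : Q.Jacobi →ₗ[ℂ] ℂ) (h : Q.head b = v)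
    (t : Bimod u w) {u' : Q.V} (h' : u' = u) :
    slice f (sandwich u w u' v (idem u) (arr b) t) =
      slice (f ∘ₗ LinearMap.mulLeft ℂ (arr b)) t := by
  subst h h'
  rw [slice_sandwich, idem_mul_idem, slice_mul_idem, idem_mul_arr]

namespace Triangulation

variable (T : Q.Triangulation)

open Classical in
theorem delta2_lof (a : Q.E) (t : Bimod (Q.tail a) (Q.head a)) :
    Q.delta2 (DirectSum.lof ℂ Q.E (fun a => Bimod (Q.tail a) (Q.head a)) a t) =
      (DirectSum.lof ℂ Q.E (fun b => Bimod (Q.head b) (Q.tail b)) (T.φ a)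
        (sandwich _ _ _ _ (idem (Q.tail a)) (arr (T.φ (T.φ a))) t) +
      DirectSum.lof ℂ Q.E (fun b => Bimod (Q.head b) (Q.tail b)) (T.φ (T.φ a))
        (sandwich _ _ _ _ (arr (T.φ a)) (idem (Q.tail (T.φ (T.φ a)))) t)) -
      (DirectSum.lof ℂ Q.E (fun b => Bimod (Q.head b) (Q.tail b)) (T.ψ a)
        (sandwich _ _ _ _ (idem (Q.tail a)) (arr (T.ψ (T.ψ a))) t) +
      DirectSum.lof ℂ Q.E (fun b => Bimod (Q.head b) (Q.tail b)) (T.ψ (T.ψ a))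
        (sandwich _ _ _ _ (arr (T.ψ a)) (idem (Q.tail (T.ψ (T.ψ a)))) t)) := by
  refine (DirectSum.toModule_lof ℂ _ _).trans ?_
  rw [LinearMap.sub_apply, T.posPath_eq, T.negPath_eq,
    pathDerivation_pair (T.head_φ a) (T.head_φ _), pathDerivation_pair (T.head_ψ a) (T.head_ψ _)]

open Classical in
-- The arrow b is the second factor of the positive path of rₐ for a = φ b and the first factor for
-- a = φ² b, and similarly for ψ. Hence four relations contribute at b.
theorem slice_delta2 (z : Q.C2) (b : Q.E) (f : Q.Jacobi →ₗ[ℂ] ℂ) :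
    slice f (Q.delta2 z b) =
      (slice f (z (T.φ b)) * arr (T.φ (T.φ b)) +
        slice (f ∘ₗ LinearMap.mulLeft ℂ (arr (T.φ b))) (z (T.φ (T.φ b)))) -
      (slice f (z (T.ψ b)) * arr (T.ψ (T.ψ b)) +
        slice (f ∘ₗ LinearMap.mulLeft ℂ (arr (T.ψ b))) (z (T.ψ (T.ψ b)))) := by
  induction z using directSum_induction with
  | zero => simp
  | add x y hx hy =>
    simp only [map_add, DirectSum.add_apply, hx, hy, add_mul]
    abel
  | lof a t =>
    rw [T.delta2_lof, DirectSum.sub_apply, map_sub, DirectSum.add_apply, DirectSum.add_apply,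
      map_add, map_add]
    simp only [slice_lof_arrow, ite_mul, zero_mul]
    rw [slice_arr_sandwich f (T.head_φ _) t (T.head_φ a),
      slice_sandwich_arr f (T.head_φ _).symm t (T.tail_φ_φ a),
      slice_arr_sandwich f (T.head_ψ _) t (T.head_ψ a),
      slice_sandwich_arr f (T.head_ψ _).symm t (T.tail_ψ_ψ a)]
    have e1 : T.φ a = b ↔ a = T.φ (T.φ b) :=
      ⟨fun h => by rw [← h, T.φ_φ_φ], fun h => by rw [h, T.φ_φ_φ]⟩
    have e2 : T.φ (T.φ a) = b ↔ a = T.φ b :=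
      ⟨fun h => by rw [← h, T.φ_φ_φ], fun h => by rw [h, T.φ_φ_φ]⟩
    have e3 : T.ψ a = b ↔ a = T.ψ (T.ψ b) :=
      ⟨fun h => by rw [← h, T.ψ_ψ_ψ], fun h => by rw [h, T.ψ_ψ_ψ]⟩
    have e4 : T.ψ (T.ψ a) = b ↔ a = T.ψ b :=
      ⟨fun h => by rw [← h, T.ψ_ψ_ψ], fun h => by rw [h, T.ψ_ψ_ψ]⟩
    simp only [e1, e2, e3, e4]
    rw [add_comm (ite _ _ _), add_comm (ite (a = T.ψ (T.ψ b)) _ _)]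
    congr 2 <;> split_ifs with h <;> first | rfl | (subst h; simp only [T.φ_φ_φ, T.ψ_ψ_ψ])

end Triangulation

variable {Q : DimerModel}

/-! ### Exactness at the vertices -/

open Classical in
theorem augmentation_lof (v : Q.V) (x : leftMod v) (y : rightMod v) :
    Q.augmentation (DirectSum.lof ℂ Q.V (fun v => Bimod v v) v (tmul x y)) = x.1 * y.1 :=
  DirectSum.toModule_lof ℂ _ _

open Classical in
theorem augmentation_delta1 (z : Q.C1) : Q.augmentation (Q.delta1 z) = 0 := by
  induction z using directSum_induction with
  | zero => simp
  | add x y hx hy => rw [map_add, map_add, hx, hy, add_zero]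
  | lof b t =>
    induction t using bimod_induction with
    | zero => simp
    | add x y hx hy => rw [map_add, map_add, map_add, hx, hy, add_zero]
    | tmul x y =>
      rw [delta1_lof, map_sub, sandwich_tmul, sandwich_tmul, augmentation_lof, augmentation_lof]
      dsimp only
      rw [mem_rightMod.1 y.2, mem_rightMod.1 y.2, mul_arr_mul_idem, mem_leftMod.1 x.2,
        mem_leftMod.1 x.2, ← mul_assoc (idem _) (arr b), idem_mul_arr, mul_assoc, sub_self]

/-- The map sending `x` and `y` to the element `x u ⊗ w y` of `A u ⊗ w A`. -/
def bitmul (u w : Q.V) : Q.Jacobi →ₗ[ℂ] Q.Jacobi →ₗ[ℂ] Bimod u w :=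
  (TensorProduct.mk ℂ (leftMod u) (rightMod w)).compl₁₂
    (LinearMap.mulRight ℂ (idem u)).rangeRestrict (LinearMap.mulLeft ℂ (idem w)).rangeRestrict

theorem bitmul_apply (u w : Q.V) (x y : Q.Jacobi) :
    bitmul u w x y = tmul ⟨x * idem u, x, rfl⟩ ⟨idem w * y, y, rfl⟩ := rfl

theorem bitmul_congr {u w : Q.V} {x x' y y' : Q.Jacobi} (hx : x * idem u = x' * idem u)
    (hy : idem w * y = idem w * y') : bitmul u w x y = bitmul u w x' y' := by
  rw [bitmul_apply, bitmul_apply]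
  congr 1
  · exact Subtype.ext hx
  · exact Subtype.ext hy

theorem tmul_eq_bitmul {u w : Q.V} (x : leftMod u) (y : rightMod w) :
    tmul x y = bitmul u w x.1 y.1 := by
  rw [bitmul_apply]
  congr 1
  · exact Subtype.ext (mem_leftMod.1 x.2).symm
  · exact Subtype.ext (mem_rightMod.1 y.2).symm

theorem sandwich_bitmul {u w u' w' : Q.V} (x y p q : Q.Jacobi) :
    sandwich u w u' w' x y (bitmul u w p q) = bitmul u' w' (p * idem u * x) (y * (idem w * q)) := by
  rw [bitmul_apply, sandwich_tmul]
  rfl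

open Classical in
theorem delta1_lof_bitmul (b : Q.E) (x y : Q.Jacobi) :
    Q.delta1 (DirectSum.lof ℂ Q.E (fun b => Bimod (Q.head b) (Q.tail b)) b (bitmul _ _ x y)) =
      DirectSum.lof ℂ Q.V (fun v => Bimod v v) (Q.tail b) (bitmul _ _ (x * arr b) y) -
      DirectSum.lof ℂ Q.V (fun v => Bimod v v) (Q.head b) (bitmul _ _ x (arr b * y)) := by
  rw [delta1_lof, sandwich_bitmul, sandwich_bitmul]
  congr 2
  · apply bitmul_congr
    · rw [mul_assoc x, idem_mul_arr]
    · rw [← mul_assoc, ← mul_assoc, idem_mul_idem, idem_mul_idem]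
  · apply bitmul_congr
    · rw [mul_assoc x, idem_mul_idem, mul_assoc x, idem_mul_idem]
    · rw [← mul_assoc (arr b), arr_mul_idem]

open Classical in
/-- The map `p ↦ h(p) ⊗ p`. -/
def headTmul : Q.PathAlgebra →ₗ[ℂ] Q.C0 :=
  Triangulation.linearExt fun p =>
    DirectSum.lof ℂ Q.V (fun v => Bimod v v) p.head (bitmul _ _ (idem p.head) (cls p))

open Classical in
-- The right side depends only on the class of x in the Jacobi algebra, so `headTmul` vanishes on
-- the ideal. This gives exactness at `C0`.
theorem headTmul_apply (x : Q.PathAlgebra) (v : Q.V) :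
    headTmul x v = bitmul v v (idem v) (Q.proj x) := by
  induction x using pathAlgebra_induction with
  | zero => simp
  | add x y hx hy => simp only [map_add, DirectSum.add_apply, hx, hy]
  | smul c x hx => rw [map_smul, map_smul, map_smul, DirectSum.smul_apply, hx]
  | path p =>
    rw [headTmul, Triangulation.linearExt_ofPath]
    by_cases h : p.head = v
    · subst h
      exact DirectSum.lof_apply ..
    · rw [DirectSum.lof_eq_of, DirectSum.of_eq_of_ne _ _ _ (Ne.symm h)]
      refine (map_zero (bitmul v v (idem v))).symm.trans (bitmul_congr rfl ?_)
      rw [mul_zero]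
      exact (idem_mul_cls_of_ne p (Ne.symm h)).symm

open Classical in
-- Modulo the image of δ₁ one has x b ⊗ y = x ⊗ b y, so the arrows of p can be moved across the
-- tensor sign one at a time, starting with the rightmost.
theorem lof_bitmul_sub_mem (p : Q.Path) : ∀ (v : Q.V) (_ : p.tail = v) (y : Q.Jacobi),
    DirectSum.lof ℂ Q.V (fun v => Bimod v v) v (bitmul v v (cls p) y) -
      DirectSum.lof ℂ Q.V (fun v => Bimod v v) p.head (bitmul _ _ (idem p.head) (cls p * y)) ∈
      LinearMap.range Q.delta1 := by
  induction p using Path.snoc_induction with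
  | triv v =>
    rintro _ rfl y
    refine (congrArg (· ∈ LinearMap.range Q.delta1) (sub_eq_zero.2 ?_)).mpr (zero_mem _)
    change DirectSum.lof ℂ Q.V (fun v => Bimod v v) v (bitmul _ _ (idem v) _) =
      DirectSum.lof ℂ Q.V (fun v => Bimod v v) v (bitmul _ _ (idem v) (idem v * y))
    rw [bitmul_congr rfl]
    rw [← mul_assoc, idem_mul_idem]
  | snoc p b hb ih =>
    rintro _ rfl y
    have h := add_mem (⟨_, delta1_lof_bitmul b (cls p) y⟩ : _ ∈ LinearMap.range Q.delta1)
      (ih _ hb (arr b * y))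
    rw [sub_add_sub_cancel, ← mul_assoc, cls_mul_arr p b hb] at h
    exact h

open Classical in
theorem exists_sub_headTmul_mem (z : Q.C0) : ∃ x, Q.proj x = Q.augmentation z ∧
    z - headTmul x ∈ LinearMap.range Q.delta1 := by
  have zero : ∃ x, Q.proj x = Q.augmentation 0 ∧
      0 - headTmul x ∈ LinearMap.range Q.delta1 := ⟨0, by simp, by simp⟩
  have add (z w : Q.C0) : (∃ x, Q.proj x = Q.augmentation z ∧
      z - headTmul x ∈ LinearMap.range Q.delta1) → (∃ x, Q.proj x = Q.augmentation w ∧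
      w - headTmul x ∈ LinearMap.range Q.delta1) → ∃ x, Q.proj x = Q.augmentation (z + w) ∧
      (z + w) - headTmul x ∈ LinearMap.range Q.delta1 := by
    rintro ⟨x, hx, hx'⟩ ⟨y, hy, hy'⟩
    refine ⟨x + y, by rw [map_add, map_add, hx, hy], ?_⟩
    rw [map_add, add_sub_add_comm]
    exact add_mem hx' hy'
  have smul (c : ℂ) (z : Q.C0) : (∃ x, Q.proj x = Q.augmentation z ∧
      z - headTmul x ∈ LinearMap.range Q.delta1) → ∃ x, Q.proj x = Q.augmentation (c • z) ∧
      (c • z) - headTmul x ∈ LinearMap.range Q.delta1 := by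
    rintro ⟨x, hx, hx'⟩
    refine ⟨c • x, by rw [map_smul, map_smul, hx], ?_⟩
    rw [map_smul, ← smul_sub]
    exact Submodule.smul_mem _ _ hx'
  induction z using directSum_induction with
  | zero => exact zero
  | add x y hx hy => exact add _ _ hx hy
  | lof v t =>
    induction t using bimod_induction with
    | zero => rw [map_zero]; exact zero
    | add x y hx hy => rw [map_add]; exact add _ _ hx hy
    | tmul x y =>
      rw [tmul_eq_bitmul]
      generalize x.1 = x
      generalize y.1 = y
      induction x using jacobi_induction with
      | zero => rw [map_zero, LinearMap.zero_apply, map_zero]; exact zero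
      | add x y hx hy => rw [map_add, LinearMap.add_apply, map_add]; exact add _ _ hx hy
      | smul c x hx => rw [map_smul, LinearMap.smul_apply, map_smul]; exact smul _ _ hx
      | path p =>
      induction y using jacobi_induction with
      | zero => rw [map_zero, map_zero]; exact zero
      | add x y hx hy => rw [map_add, map_add]; exact add _ _ hx hy
      | smul c x hx => rw [map_smul, map_smul]; exact smul _ _ hx
      | path q =>
      by_cases hp : p.tail = v
      · by_cases hq : q.head = v
        · refine ⟨ofPath (p.comp q (hp.trans hq.symm)), ?_, ?_⟩
          · rw [bitmul_apply, augmentation_lof]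
            subst hp
            dsimp only
            rw [cls_mul_idem, show idem p.tail * cls q = cls q from hq ▸ idem_mul_cls q,
              cls_mul_cls p q hq.symm]
            rfl
          · rw [headTmul, Triangulation.linearExt_ofPath, ← cls_mul_cls p q (hp.trans hq.symm)]
            exact lof_bitmul_sub_mem p v hp (cls q)
        · rw [bitmul_congr (x' := cls p) (y' := 0) rfl
            ((idem_mul_cls_of_ne q (Ne.symm hq)).trans (mul_zero _).symm), map_zero, map_zero]
          exact zero
      · rw [bitmul_congr (x' := 0) (y' := cls q)
          ((cls_mul_idem_of_ne p hp).trans (zero_mul _).symm) rfl, map_zero, LinearMap.zero_apply,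
          map_zero]
        exact zero

theorem exact_delta1_augmentation : Function.Exact Q.delta1 Q.augmentation := by
  classical
  intro z
  constructor
  · intro hz
    obtain ⟨x, hx, h⟩ := exists_sub_headTmul_mem z
    have h' : headTmul x = 0 := by
      refine DFinsupp.ext fun v => ?_
      exact (headTmul_apply x v).trans (by rw [hx, hz, map_zero]; rfl)
    rw [h', sub_zero] at h
    exact h
  · rintro ⟨w, rfl⟩
    exact augmentation_delta1 w

theorem surjective_augmentation : Function.Surjective Q.augmentation := by
  classical
  intro x
  induction x using jacobi_induction with
  | zero => exact ⟨0, map_zero _⟩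
  | add x y hx hy =>
    obtain ⟨a, rfl⟩ := hx
    obtain ⟨b, rfl⟩ := hy
    exact ⟨a + b, map_add _ _ _⟩
  | smul c x hx =>
    obtain ⟨a, rfl⟩ := hx
    exact ⟨c • a, map_smul _ _ _⟩
  | path p =>
    refine ⟨DirectSum.lof ℂ Q.V (fun v => Bimod v v) p.head (bitmul _ _ (idem p.head) (cls p)), ?_⟩
    refine (augmentation_lof _ _ _).trans ?_
    change idem p.head * idem p.head * (idem p.head * cls p) = _
    rw [idem_mul_idem, idem_mul_cls, idem_mul_cls]

end DimerModel

/-- A linear map over a field has a generalized inverse. -/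
theorem LinearMap.exists_generalizedInverse {K M N : Type*} [Field K] [AddCommGroup M] [Module K M]
    [AddCommGroup N] [Module K N] (f : M →ₗ[K] N) :
    ∃ g : N →ₗ[K] M, ∀ x, f (g (f x)) = f x := by
  obtain ⟨s, hs⟩ := LinearMap.exists_rightInverse_of_surjective f.rangeRestrict
    f.range_rangeRestrict
  obtain ⟨g, hg⟩ := LinearMap.exists_extend s
  refine ⟨g, fun x => ?_⟩
  have h1 : g (f x) = s (f.rangeRestrict x) := LinearMap.congr_fun hg (f.rangeRestrict x)
  rw [h1]
  exact congrArg Subtype.val (LinearMap.congr_fun hs (f.rangeRestrict x))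

namespace DimerModel

open ArrowQuiver

variable {Q : DimerModel}

/-! ### Linear operations on the left factor -/

/-- The map `x ⊗ y ↦ h(x) u' ⊗ w' y`. -/
def mapLeft {u w : Q.V} (u' w' : Q.V) (h : Q.Jacobi →ₗ[ℂ] Q.Jacobi) :
    Bimod u w →ₗ[ℂ] Bimod u' w' :=
  TensorProduct.map
    ((LinearMap.mulRight ℂ (idem u')).rangeRestrict ∘ₗ h ∘ₗ (leftMod u).subtype)
    ((LinearMap.mulLeft ℂ (idem w')).rangeRestrict ∘ₗ (rightMod w).subtype)

theorem mapLeft_tmul {u w u' w' : Q.V} (h : Q.Jacobi →ₗ[ℂ] Q.Jacobi) (x : leftMod u)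
    (y : rightMod w) : mapLeft u' w' h (tmul x y) = bitmul u' w' (h x.1) y.1 := rfl

theorem slice_bitmul {u w : Q.V} (f : Q.Jacobi →ₗ[ℂ] ℂ) (x y : Q.Jacobi) :
    slice f (bitmul u w x y) = f (idem w * y) • (x * idem u) := by
  rw [bitmul_apply, slice_tmul]

theorem slice_mapLeft {u w u' w' : Q.V} (f : Q.Jacobi →ₗ[ℂ] ℂ) (h : Q.Jacobi →ₗ[ℂ] Q.Jacobi)
    (hw : w' = w) (t : Bimod u w) :
    slice f (mapLeft u' w' h t) = h (slice f t) * idem u' := by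
  subst hw
  induction t using bimod_induction with
  | zero => simp
  | add x y hx hy => simp only [map_add, hx, hy, add_mul]
  | tmul x y =>
    rw [mapLeft_tmul, slice_bitmul, slice_tmul, map_smul, smul_mul_assoc, mem_rightMod.1 y.2]

section

variable {I I' : Type} {l r : I → Q.V} {l' r' : I' → Q.V}

open Classical in
/-- The sum over the indices `i` and `i'` with `r i = r' i'` of maps given by linear operations on
the left factor. -/
def assemble (fib : Q.V → Finset I') (h : I → I' → Q.Jacobi →ₗ[ℂ] Q.Jacobi) :
    (⨁ i, Bimod (l i) (r i)) →ₗ[ℂ] ⨁ i, Bimod (l' i) (r' i) :=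
  DirectSum.toModule ℂ I _ fun i => ∑ i' ∈ fib (r i),
    DirectSum.lof ℂ I' (fun i => Bimod (l' i) (r' i)) i' ∘ₗ mapLeft _ _ (h i i')

open Classical in
-- Operations on left factors commute with slicing. A linear solution operator for the slices thus
-- becomes a solution operator for tensors.
theorem slice_assemble {fib : Q.V → Finset I'} (hfib : ∀ v i, i ∈ fib v ↔ r' i = v)
    {fib' : Q.V → Finset I} (hfib' : ∀ v i, i ∈ fib' v ↔ r i = v)
    (h : I → I' → Q.Jacobi →ₗ[ℂ] Q.Jacobi) (z : ⨁ i, Bimod (l i) (r i)) (i' : I')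
    (f : Q.Jacobi →ₗ[ℂ] ℂ) :
    slice f (assemble (l' := l') (r' := r') fib h z i') =
      (∑ i ∈ fib' (r' i'), h i i' (slice f (z i))) * idem (l' i') := by
  induction z using directSum_induction with
  | zero => simp
  | add x y hx hy =>
    simp only [map_add, DirectSum.add_apply, hx, hy, Finset.sum_add_distrib, add_mul]
  | lof i t =>
    have e : assemble (l' := l') (r' := r') fib h
        (DirectSum.lof ℂ I (fun i => Bimod (l i) (r i)) i t) =
        ∑ i' ∈ fib (r i), DirectSum.lof ℂ I' (fun i => Bimod (l' i) (r' i)) i'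
          (mapLeft _ _ (h i i') t) := by
      refine (DirectSum.toModule_lof ℂ _ _).trans ?_
      simp only [LinearMap.sum_apply, LinearMap.comp_apply]
    rw [e, DFinsupp.finsetSum_apply, map_sum]
    simp only [slice_lof, apply_ite (h _ _), map_zero, Finset.sum_ite_eq, Finset.sum_ite_eq']
    by_cases hr : r' i' = r i
    · rw [if_pos ((hfib _ _).2 hr), slice_mapLeft f _ hr, if_pos ((hfib' _ _).2 hr.symm)]
    · rw [if_neg (mt (hfib _ _).1 hr), if_neg (fun h' => hr ((hfib' _ _).1 h').symm), zero_mul]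

end

namespace Triangulation

variable (T : Q.Triangulation)

/-! ### The complex -/

/-- After slicing, the terms with one arrow on each side of the tensor sign cancel within each
triangle. The terms with both arrows on one side cancel between the two triangles by the relation.
-/
theorem delta2_delta3 (T : Q.Triangulation) (z : Q.C3) : Q.delta2 (Q.delta3 z) = 0 := by
  refine eq_zero_of_slices fun b f => ?_
  have comp_mulLeft (f : Q.Jacobi →ₗ[ℂ] ℂ) (x y : Q.Jacobi) :
      (f ∘ₗ LinearMap.mulLeft ℂ x) ∘ₗ LinearMap.mulLeft ℂ y = f ∘ₗ LinearMap.mulLeft ℂ (x * y) := by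
    ext z
    simp
  obtain ⟨Z, hZ⟩ : ∃ Z : Q.V → (Q.Jacobi →ₗ[ℂ] ℂ) → Q.Jacobi, ∀ v f, slice f (z v) = Z v f :=
    ⟨_, fun _ _ => rfl⟩
  simp only [T.slice_delta2, slice_delta3, hZ, T.head_φ, T.head_ψ, T.tail_φ_φ, T.tail_ψ_ψ, sub_mul,
    mul_assoc, T.arr_mul_arr, comp_mulLeft]
  abel

theorem delta1_delta2 (T : Q.Triangulation) (z : Q.C2) : Q.delta1 (Q.delta2 z) = 0 := by
  refine eq_zero_of_slices (l := fun v => v) (r := fun v => v) fun v f => ?_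
  have comp_mulLeft (f : Q.Jacobi →ₗ[ℂ] ℂ) (x y : Q.Jacobi) :
      (f ∘ₗ LinearMap.mulLeft ℂ x) ∘ₗ LinearMap.mulLeft ℂ y = f ∘ₗ LinearMap.mulLeft ℂ (x * y) := by
    ext z
    simp
  obtain ⟨Z, hZ⟩ : ∃ Z : Q.E → (Q.Jacobi →ₗ[ℂ] ℂ) → Q.Jacobi, ∀ v f, slice f (z v) = Z v f :=
    ⟨_, fun _ _ => rfl⟩
  -- Rotation of the triangles by φ, and likewise by ψ, is a bijection from the arrows with tail v
  -- to those with head v. It brings all six sums that occur to a common index set.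
  have hφ (F : Q.E → Q.Jacobi) : ∑ b ∈ (Q.finite_tail v).toFinset, F (T.φ b) =
      ∑ a ∈ (Q.finite_head v).toFinset, F a :=
    Finset.sum_nbij' T.φ (fun a => T.φ (T.φ a)) (by simp [T.head_φ]) (by simp [T.tail_φ_φ])
      (fun a _ => T.φ_φ_φ a) (fun a _ => T.φ_φ_φ a) (fun _ _ => rfl)
  have hψ (F : Q.E → Q.Jacobi) : ∑ b ∈ (Q.finite_tail v).toFinset, F (T.ψ b) =
      ∑ a ∈ (Q.finite_head v).toFinset, F a :=
    Finset.sum_nbij' T.ψ (fun a => T.ψ (T.ψ a)) (by simp [T.head_ψ]) (by simp [T.tail_ψ_ψ])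
      (fun a _ => T.ψ_ψ_ψ a) (fun a _ => T.ψ_ψ_ψ a) (fun _ _ => rfl)
  simp only [slice_delta1, T.slice_delta2, hZ, sub_mul, add_mul, Finset.sum_sub_distrib,
    Finset.sum_add_distrib, mul_assoc, comp_mulLeft]
  have h1 := hφ fun a => Z a f * (arr (T.φ a) * arr (T.φ (T.φ a)))
  have h2 := hψ fun a => Z a f * (arr (T.ψ a) * arr (T.ψ (T.ψ a)))
  have h3 := hφ fun a => Z (T.φ a) (f ∘ₗ LinearMap.mulLeft ℂ (arr a)) * arr (T.φ (T.φ a))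
  have h4 := hψ fun a => Z (T.ψ a) (f ∘ₗ LinearMap.mulLeft ℂ (arr a)) * arr (T.ψ (T.ψ a))
  have h5 := hφ fun a => Z (T.φ (T.φ a)) (f ∘ₗ LinearMap.mulLeft ℂ (arr a * arr (T.φ a)))
  have h6 := hψ fun a => Z (T.ψ (T.ψ a)) (f ∘ₗ LinearMap.mulLeft ℂ (arr a * arr (T.ψ a)))
  simp only [T.φ_φ_φ, T.ψ_ψ_ψ] at h1 h2 h3 h4 h5 h6
  rw [h1, h2, h3, h4, ← h5, ← h6]
  simp only [T.arr_mul_arr]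
  abel

end Triangulation

variable {Q : DimerModel}

namespace Triangulation

variable (T : Q.Triangulation)

/-! ### Syzygies of the arrows with a given tail -/

open Classical in
/-- The class of `q` if `p = q b`, and `0` if the path `p` does not end in the arrow `b`. -/
def stripPath (b : Q.E) (p : Q.Path) : Q.Jacobi :=
  if h : ∃ (q : Q.Path) (hq : q.tail = Q.head b), p = q.comp (Path.ofArrow b) hq then
    cls h.choose else 0

open Classical in
theorem stripPath_comp (b c : Q.E) (p : Q.Path) (h : p.tail = Q.head c) :
    stripPath b (p.comp (Path.ofArrow c) h) = if b = c then cls p else 0 := by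
  unfold stripPath
  split_ifs with h1 h2 h2
  · congr 1
    subst h2
    obtain ⟨h3, h4⟩ := h1.choose_spec
    refine ArrowQuiver.Path.ext ?_ (h3.trans h.symm) ?_
    · exact (congrArg Path.head h4).symm
    · exact (List.append_cancel_right (congrArg Path.arrows h4)).symm
  · obtain ⟨h3, h4⟩ := h1.choose_spec
    have h5 := congrArg (fun p : Q.Path => p.arrows.getLast?) h4
    simp [Path.comp, Path.ofArrow] at h5
    exact absurd h5.symm h2
  · subst h2
    exact absurd ⟨p, h, rfl⟩ h1
  · rfl

/-- The linear extension of `stripPath`. -/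
def strip (b : Q.E) : Q.PathAlgebra →ₗ[ℂ] Q.Jacobi := linearExt (stripPath b)

open Classical in
theorem strip_mul_arr (b c : Q.E) (x : Q.PathAlgebra) :
    strip b (x * ofPath (Path.ofArrow c)) = if b = c then Q.proj x * idem (Q.head c) else 0 := by
  induction x using pathAlgebra_induction with
  | zero => simp
  | add x y hx hy => rw [add_mul, map_add, hx, hy, map_add, add_mul]; split_ifs <;> simp
  | smul k x hx =>
    rw [smul_mul_assoc, map_smul, hx, map_smul, smul_mul_assoc]; split_ifs <;> simp
  | path p =>
    by_cases h : p.tail = Q.head c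
    · rw [ofPath_mul_ofPath_of_eq (by exact h), strip, linearExt_ofPath, stripPath_comp, ← h]
      change _ = ite _ (cls p * _) _
      rw [cls_mul_idem]
    · rw [ofPath_mul_ofPath_of_ne (by exact h), map_zero]
      change _ = ite _ (cls p * _) _
      rw [cls_mul_idem_of_ne p h, ite_self]

/-- The elements of the path algebra whose parts ending in the various arrows are, modulo the
relations, combinations of the initial parts of the relations. -/
def syzygy : Submodule ℂ Q.PathAlgebra where
  carrier := {z | ∃ r : Q.E → Q.Jacobi, ∀ b, strip b z =
    r (T.φ b) * arr (T.φ (T.φ b)) - r (T.ψ b) * arr (T.ψ (T.ψ b))}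
  zero_mem' := ⟨0, by simp⟩
  add_mem' := by
    rintro x y ⟨r, hr⟩ ⟨s, hs⟩
    refine ⟨r + s, fun b => ?_⟩
    rw [map_add, hr, hs, Pi.add_apply, Pi.add_apply, add_mul, add_mul]
    abel
  smul_mem' := by
    rintro c x ⟨r, hr⟩
    refine ⟨c • r, fun b => ?_⟩
    rw [map_smul, hr, Pi.smul_apply, Pi.smul_apply, smul_mul_assoc, smul_mul_assoc, smul_sub]

theorem relation_eq_mul (a : Q.E) : Q.relation a =
    ofPath (Path.ofArrow (T.φ a)) * ofPath (Path.ofArrow (T.φ (T.φ a))) -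
      ofPath (Path.ofArrow (T.ψ a)) * ofPath (Path.ofArrow (T.ψ (T.ψ a))) := by
  rw [T.relation_eq, ofPath_mul_ofPath_of_eq (by exact (T.head_φ _).symm),
    ofPath_mul_ofPath_of_eq (by exact (T.head_ψ _).symm)]
  exact congrArg₂ (fun p q : Q.Path => ofPath p - ofPath q)
    (ArrowQuiver.Path.ext (T.head_φ a).symm (T.tail_φ_φ a).symm rfl)
    (ArrowQuiver.Path.ext (T.head_ψ a).symm (T.tail_ψ_ψ a).symm rfl)

/-- Consider x·rₐ·y with y a path. If y is trivial, stripping the final arrows exposes the initial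
parts of rₐ, and the family concentrated at a with value x is a witness. If y ends in an arrow,
removing that arrow leaves an element of the ideal, and the zero family works. -/
theorem jacobiIdeal_le_syzygy : Q.jacobiIdeal ≤ T.syzygy := by
  classical
  refine Submodule.span_le.2 ?_
  rintro _ ⟨x, y, a, rfl⟩
  change _ ∈ T.syzygy
  induction y using pathAlgebra_induction with
  | zero => rw [mul_zero]; exact zero_mem _
  | add x y hx hy => rw [mul_add]; exact add_mem hx hy
  | smul c x hx => rw [mul_smul_comm]; exact Submodule.smul_mem _ _ hx
  | path q =>
    induction q using Path.snoc_induction with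
    | triv w =>
      rw [T.relation_eq_mul, mul_sub, sub_mul]
      simp only [← mul_assoc]
      simp only [mul_assoc _ _ (ofPath (Path.triv w))]
      by_cases hw : Q.head a = w
      · subst hw
        have h1 (b : Q.E) (hb : Q.tail b = Q.head a) :
            ofPath (Path.ofArrow b) * ofPath (Path.triv (Q.head a)) = ofPath (Path.ofArrow b) :=
          (ofPath_mul_ofPath_of_eq (by exact hb)).trans
            (congrArg _ (ArrowQuiver.Path.ext rfl hb.symm rfl))
        rw [h1 _ (T.tail_φ_φ a), h1 _ (T.tail_ψ_ψ a)]
        refine ⟨Pi.single a (Q.proj x), fun b => ?_⟩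
        have e1 : T.φ b = a ↔ b = T.φ (T.φ a) :=
          ⟨fun h => by rw [← h, T.φ_φ_φ], fun h => by rw [h, T.φ_φ_φ]⟩
        have e2 : T.ψ b = a ↔ b = T.ψ (T.ψ a) :=
          ⟨fun h => by rw [← h, T.ψ_ψ_ψ], fun h => by rw [h, T.ψ_ψ_ψ]⟩
        rw [map_sub, strip_mul_arr, strip_mul_arr, proj_mul, proj_mul, T.head_φ, T.head_ψ]
        simp only [Pi.single_apply, e1, e2, ite_mul, zero_mul]
        congr 1 <;> split_ifs with h
        · rw [h, T.φ_φ_φ]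
          exact mul_arr_mul_idem _ _
        · rfl
        · rw [h, T.ψ_ψ_ψ]
          exact mul_arr_mul_idem _ _
        · rfl
      · rw [ofPath_mul_ofPath_of_ne (p := Path.ofArrow (T.φ (T.φ a))) (q := Path.triv w)
            (by exact fun h => hw ((T.tail_φ_φ a).symm.trans h)),
          ofPath_mul_ofPath_of_ne (p := Path.ofArrow (T.ψ (T.ψ a))) (q := Path.triv w)
            (by exact fun h => hw ((T.tail_ψ_ψ a).symm.trans h)), mul_zero, mul_zero, sub_zero]
        exact zero_mem _
    | snoc q c hq ih =>
      refine ⟨0, fun b => ?_⟩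
      rw [← ofPath_mul_ofPath_of_eq hq, ← mul_assoc, strip_mul_arr]
      have h : Q.proj (x * Q.relation a * ofPath q) = 0 :=
        (Submodule.Quotient.mk_eq_zero _).2 (Submodule.subset_span ⟨x, ofPath q, a, rfl⟩)
      simp [h]

/-- Exactness of the one-vertex complex at its third place: a lift of ∑ q b · b to the path algebra
lies in the ideal, hence in `syzygy`. No property of the particular dimer model is needed. -/
theorem exists_syzygy (v : Q.V) (q : Q.E → Q.Jacobi) (hq : ∀ b, q b * idem (Q.head b) = q b)
    (h : ∑ b ∈ (Q.finite_tail v).toFinset, q b * arr b = 0) :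
    ∃ r : Q.E → Q.Jacobi, ∀ b, Q.tail b = v →
      q b = r (T.φ b) * arr (T.φ (T.φ b)) - r (T.ψ b) * arr (T.ψ (T.ψ b)) := by
  classical
  choose x hx using fun b => Q.proj_surjective (q b)
  have hz : ∑ b ∈ (Q.finite_tail v).toFinset, x b * ofPath (Path.ofArrow b) ∈ Q.jacobiIdeal := by
    rw [← Submodule.Quotient.mk_eq_zero]
    change Q.proj _ = 0
    rw [map_sum, ← h]
    refine Finset.sum_congr rfl fun b _ => ?_
    rw [proj_mul, hx]
    rfl
  obtain ⟨r, hr⟩ := T.jacobiIdeal_le_syzygy hz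
  refine ⟨r, fun b hb => ?_⟩
  rw [← hr b, map_sum]
  simp only [strip_mul_arr, hx, hq, Finset.sum_ite_eq]
  rw [if_pos (by simpa using hb)]

/-! ### Exactness by descending induction on the length of the left factor -/

/-- The component of degree `n - 1`. -/
def gradedPred : ℕ → Q.Jacobi →ₗ[ℂ] Q.Jacobi
  | 0 => 0
  | n + 1 => T.graded n

theorem graded_mul_arr' (n : ℕ) (x : Q.Jacobi) (b : Q.E) :
    T.graded n (x * arr b) = T.gradedPred n x * arr b := by
  cases n with
  | zero => rw [graded_zero_mul_arr, gradedPred, LinearMap.zero_apply, zero_mul]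
  | succ n => exact T.graded_mul_arr n x b

theorem graded_gradedPred {m n : ℕ} (h : m ≤ n) (x : Q.Jacobi) :
    T.graded n (T.gradedPred m x) = 0 := by
  cases m with
  | zero => rw [gradedPred, LinearMap.zero_apply, map_zero]
  | succ m => rw [gradedPred, graded_graded, if_neg (by omega)]

theorem gradedPred_gradedPred {m n : ℕ} (h : m < n) (x : Q.Jacobi) :
    T.gradedPred n (T.gradedPred m x) = 0 := by
  obtain ⟨n, rfl⟩ : ∃ k, n = k + 1 := ⟨n - 1, by omega⟩
  exact T.graded_gradedPred (by omega) x

theorem gradedPred_gradedPred_self (m : ℕ) (x : Q.Jacobi) :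
    T.gradedPred m (T.gradedPred m x) = T.gradedPred m x := by
  cases m with
  | zero => rfl
  | succ m => rw [gradedPred, graded_graded, if_pos rfl]

/-- The left factors of `z` have no components of degree at least `m`. -/
def DegreeLT {I : Type} {l r : I → Q.V} (m : ℕ) (z : ⨁ i, Bimod (l i) (r i)) : Prop :=
  ∀ n, m ≤ n → ∀ i f, T.graded n (slice f (z i)) = 0

theorem DegreeLT.eq_zero {I : Type} {l r : I → Q.V} {z : ⨁ i, Bimod (l i) (r i)}
    (h : T.DegreeLT 0 z) : z = 0 :=
  eq_zero_of_slices fun i f => T.eq_zero_of_graded fun n => h n (Nat.zero_le n) i f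

theorem exists_degreeLT {I : Type} {l r : I → Q.V} (z : ⨁ i, Bimod (l i) (r i)) :
    ∃ m, T.DegreeLT m z := by
  classical
  have add (z w : ⨁ i, Bimod (l i) (r i)) (hz : ∃ m, T.DegreeLT m z) (hw : ∃ m, T.DegreeLT m w) :
      ∃ m, T.DegreeLT m (z + w) := by
    obtain ⟨m, hm⟩ := hz
    obtain ⟨n, hn⟩ := hw
    refine ⟨max m n, fun k hk i f => ?_⟩
    rw [DirectSum.add_apply, map_add, map_add, hm k (by omega), hn k (by omega), add_zero]
  have zero : ∃ m, T.DegreeLT m (0 : ⨁ i, Bimod (l i) (r i)) := ⟨0, fun n _ i f => by simp⟩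
  induction z using directSum_induction with
  | zero => exact zero
  | add x y hx hy => exact add x y hx hy
  | lof i t =>
    induction t using bimod_induction with
    | zero => rw [map_zero]; exact zero
    | add x y hx hy => rw [map_add]; exact add _ _ hx hy
    | tmul x y =>
      obtain ⟨N, hN⟩ := T.exists_graded_eq_zero x.1
      refine ⟨N, fun n hn j f => ?_⟩
      rw [slice_lof]
      split_ifs
      · rw [slice_tmul, map_smul, hN n hn, smul_zero]
      · exact map_zero _

open Classical in
theorem sum_single {r : Q.E → Q.V} {fib : Q.V → Finset Q.E} (hfib : ∀ v a, a ∈ fib v ↔ r a = v)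
    (v : Q.V) (F : Q.E → Q.Jacobi) :
    ∑ a ∈ fib v, LinearMap.single ℂ (fun _ => Q.Jacobi) a (F a) =
      fun a => if r a = v then F a else 0 := by
  funext a
  simp [Finset.sum_apply, Pi.single_apply, hfib]

/-- Here K plays the role of a kernel and A of the image contained in it. Left factors have bounded
length, so killing the top degree repeatedly by elements of A terminates. -/
theorem mem_range_of_step {I : Type} {l r : I → Q.V}
    {A : Submodule ℂ (⨁ i, Bimod (l i) (r i))}
    {K : Submodule ℂ (⨁ i, Bimod (l i) (r i))} (hAK : A ≤ K)
    (step : ∀ m z, z ∈ K → T.DegreeLT (m + 1) z → ∃ w ∈ A, T.DegreeLT m (z - w)) : K ≤ A := by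
  have key (m : ℕ) : ∀ z ∈ K, T.DegreeLT m z → z ∈ A := by
    induction m with
    | zero =>
      intro z _ h
      rw [h.eq_zero]
      exact zero_mem _
    | succ m ih =>
      intro z hz h
      obtain ⟨w, hw, h'⟩ := step m z hz h
      have h2 := add_mem (ih _ (sub_mem hz (hAK hw)) h') hw
      rwa [sub_add_cancel] at h2
  intro z hz
  obtain ⟨m, hm⟩ := T.exists_degreeLT z
  exact key m z hz hm

/-- The first local exactness condition: right multiplication by the arrows with head `v` is
injective on `A v`. -/
def LocallyInjective (_ : Q.Triangulation) : Prop :=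
  ∀ (v : Q.V) (q : Q.Jacobi), q * idem v = q → (∀ a, Q.head a = v → q * arr a = 0) → q = 0

/-- The second local exactness condition: families of elements that are compatible with the
relations come from an element of `A v`. -/
def LocallyExact : Prop :=
  ∀ (v : Q.V) (q : Q.E → Q.Jacobi), (∀ a, q a * idem (Q.tail a) = q a) →
    (∀ b, Q.tail b = v → q (T.φ b) * arr (T.φ (T.φ b)) = q (T.ψ b) * arr (T.ψ (T.ψ b))) →
    ∃ x, x * idem v = x ∧ ∀ a, Q.head a = v → q a = x * arr a

variable {T}

/-- The degree m + 1 part of δ₃ z = 0 says that the top component of each slice is annihilated by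
all arrows with head v, so this component is zero. No correction term is required. -/
theorem LocallyInjective.injective_delta3 (h : T.LocallyInjective) :
    Function.Injective Q.delta3 := by
  rw [← LinearMap.ker_eq_bot, eq_bot_iff]
  refine T.mem_range_of_step bot_le
    fun m z hz hm => ⟨0, zero_mem _, ?_⟩
  rw [sub_zero]
  intro n hn v f
  obtain hn | rfl := hn.lt_or_eq
  · exact hm n hn v f
  refine h v _ (by rw [← graded_mul_idem, slice_mul_idem]) fun a ha => ?_
  subst ha
  have h1 := slice_delta3 z a f
  rw [LinearMap.mem_ker.1 hz] at h1
  have h2 := congrArg (T.graded (m + 1)) h1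
  rw [map_sub, graded_mul_arr, hm (m + 1) le_rfl, sub_zero] at h2
  rw [← h2]
  simp

/-- The top components of a cycle form a compatible family at each vertex, which `LocallyExact`
lifts to A v. Subtracting δ₃ of the lift lowers the degree. -/
theorem LocallyExact.exact_delta3_delta2 (h : T.LocallyExact) :
    Function.Exact Q.delta3 Q.delta2 := by
  classical
  have hle : LinearMap.range Q.delta3 ≤ LinearMap.ker Q.delta2 := by
    rintro _ ⟨z, rfl⟩
    exact T.delta2_delta3 z
  let A (v : Q.V) : Q.Jacobi →ₗ[ℂ] Q.E → Q.Jacobi :=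
    LinearMap.pi fun a => if Q.head a = v then LinearMap.mulRight ℂ (arr a) else 0
  choose G hG using fun v => (A v).exists_generalizedInverse
  suffices h' : LinearMap.ker Q.delta2 ≤ LinearMap.range Q.delta3 from
    fun z => ⟨fun hz => h' hz, fun hz => hle hz⟩
  refine T.mem_range_of_step hle
    fun m z hz hm => ?_
  -- Lifts chosen separately for each functional need not be the slices of one tensor; the linear
  -- generalized inverse `G v` can be applied to the left factors directly. The cut-off `gradedPred
  -- m` keeps degree m - 1 only, so that δ₃ (H z) has left degrees at most m.
  let H : Q.C2 →ₗ[ℂ] Q.C3 := assemble (fun v => {v}) fun a v =>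
    T.gradedPred m ∘ₗ G v ∘ₗ LinearMap.single ℂ (fun _ => Q.Jacobi) a ∘ₗ T.graded m
  refine ⟨Q.delta3 (H z), ⟨_, rfl⟩, ?_⟩
  have hH (v : Q.V) (f : Q.Jacobi →ₗ[ℂ] ℂ) : slice f (H z v) = T.gradedPred m (G v fun a =>
      if Q.head a = v then T.graded m (slice f (z a)) else 0) * idem v := by
    have hfib (v i : Q.V) : i ∈ ({v} : Finset Q.V) ↔ i = v := Finset.mem_singleton
    have hfib' (v : Q.V) (a : Q.E) : a ∈ (Q.finite_head v).toFinset ↔ Q.head a = v := by simp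
    refine (slice_assemble (l := Q.tail) (r := Q.head) (l' := fun v : Q.V => v)
      (r' := fun v : Q.V => v) hfib hfib' _ z v f).trans ?_
    simp only [LinearMap.comp_apply]
    rw [← map_sum, ← map_sum, sum_single hfib' v fun a => T.graded m (slice f (z a))]
  have hG' (a : Q.E) (f : Q.Jacobi →ₗ[ℂ] ℂ) :
      (G (Q.head a) fun a' => if Q.head a' = Q.head a then T.graded m (slice f (z a')) else 0) *
        arr a = T.graded m (slice f (z a)) := by
    obtain ⟨x, hx, hx'⟩ := h (Q.head a) (fun a => T.graded m (slice f (z a)))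
      (fun a => by rw [← graded_mul_idem, slice_mul_idem]) (fun b hb => by
        have h1 := T.slice_delta2 z b f
        rw [LinearMap.mem_ker.1 hz] at h1
        -- In degree m + 1 the summands that do not touch the left factor vanish by the degree bound
        -- on z, and only the leading part remains.
        have h2 := congrArg (T.graded (m + 1)) h1
        rw [map_sub, map_add, map_add, hm (m + 1) le_rfl, hm (m + 1) le_rfl, add_zero, add_zero,
          graded_mul_arr, graded_mul_arr] at h2
        rw [← sub_eq_zero, ← h2]
        simp)
    have e : (fun a' => if Q.head a' = Q.head a then T.graded m (slice f (z a')) else 0) =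
        A (Q.head a) x := by
      ext a'
      simp only [A, LinearMap.pi_apply]
      split_ifs with h3
      · exact hx' _ h3
      · rfl
    have h3 := congrFun (hG (Q.head a) x) a
    rw [← e] at h3
    simpa [A] using h3
  intro n hn a f
  rw [DirectSum.sub_apply, map_sub, slice_delta3, map_sub, map_sub, hH, hH, graded_mul_idem,
    graded_gradedPred T hn, zero_mul, sub_zero, mul_assoc, idem_mul_arr, graded_mul_arr']
  obtain hn | rfl := hn.lt_or_eq
  · rw [gradedPred_gradedPred T hn, zero_mul, sub_zero]
    exact hm n hn a f
  -- In degree m the leading part of δ₃ (H z) is exactly the top component of z. For m = 0 this says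
  -- that the top component is zero, being a multiple of an arrow.
  · rw [gradedPred_gradedPred_self, ← graded_mul_arr', hG', graded_graded, if_pos rfl, sub_self]

variable (T)

/-- The same filtration argument with `exists_syzygy` as the local input, so it holds for every
triangulated dimer model. -/
theorem exact_delta2_delta1 (T : Q.Triangulation) : Function.Exact Q.delta2 Q.delta1 := by
  classical
  have hle : LinearMap.range Q.delta2 ≤ LinearMap.ker Q.delta1 := by
    rintro _ ⟨z, rfl⟩
    exact T.delta1_delta2 z
  let A (v : Q.V) : (Q.E → Q.Jacobi) →ₗ[ℂ] Q.E → Q.Jacobi :=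
    LinearMap.pi fun b => if Q.tail b = v then
      LinearMap.mulRight ℂ (arr (T.φ (T.φ b))) ∘ₗ LinearMap.proj (T.φ b) -
      LinearMap.mulRight ℂ (arr (T.ψ (T.ψ b))) ∘ₗ LinearMap.proj (T.ψ b) else 0
  choose G hG using fun v => (A v).exists_generalizedInverse
  suffices h' : LinearMap.ker Q.delta1 ≤ LinearMap.range Q.delta2 from
    fun z => ⟨fun hz => h' hz, fun hz => hle hz⟩
  refine T.mem_range_of_step hle fun m z hz hm => ?_
  let H : Q.C1 →ₗ[ℂ] Q.C2 := assemble (fun v => (Q.finite_head v).toFinset) fun b a =>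
    T.gradedPred m ∘ₗ LinearMap.proj a ∘ₗ G (Q.head a) ∘ₗ
      LinearMap.single ℂ (fun _ => Q.Jacobi) b ∘ₗ T.graded m
  refine ⟨Q.delta2 (H z), ⟨_, rfl⟩, ?_⟩
  have hH (a : Q.E) (f : Q.Jacobi →ₗ[ℂ] ℂ) : slice f (H z a) =
      T.gradedPred m (G (Q.head a) (fun b =>
        if Q.tail b = Q.head a then T.graded m (slice f (z b)) else 0) a) * idem (Q.tail a) := by
    have hfib (v : Q.V) (a : Q.E) : a ∈ (Q.finite_head v).toFinset ↔ Q.head a = v := by simp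
    have hfib' (v : Q.V) (b : Q.E) : b ∈ (Q.finite_tail v).toFinset ↔ Q.tail b = v := by simp
    refine (slice_assemble (l := Q.head) (r := Q.tail) (l' := Q.tail) (r' := Q.head)
      hfib hfib' _ z a f).trans ?_
    simp only [LinearMap.comp_apply]
    rw [← map_sum, ← map_sum, ← map_sum,
      sum_single hfib' (Q.head a) fun b => T.graded m (slice f (z b))]
    rfl
  have hG' (b : Q.E) (f : Q.Jacobi →ₗ[ℂ] ℂ) (R : Q.E → Q.Jacobi) (hR : R = G (Q.tail b) fun b' =>
        if Q.tail b' = Q.tail b then T.graded m (slice f (z b')) else 0) :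
      R (T.φ b) * arr (T.φ (T.φ b)) - R (T.ψ b) * arr (T.ψ (T.ψ b)) =
        T.graded m (slice f (z b)) := by
    obtain ⟨r, hr⟩ := T.exists_syzygy (Q.tail b) (fun b => T.graded m (slice f (z b)))
      (fun b => by rw [← graded_mul_idem, slice_mul_idem]) (by
        have h1 := slice_delta1 z (Q.tail b) f
        rw [LinearMap.mem_ker.1 hz] at h1
        have h2 := congrArg (T.graded (m + 1)) h1
        simp only [map_sub, map_sum, hm (m + 1) le_rfl, Finset.sum_const_zero, sub_zero,
          graded_mul_arr] at h2
        rw [← h2]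
        simp)
    have e : (fun b' => if Q.tail b' = Q.tail b then T.graded m (slice f (z b')) else 0) =
        A (Q.tail b) r := by
      ext b'
      simp only [A, LinearMap.pi_apply]
      split_ifs with h3
      · exact hr _ h3
      · rfl
    have h3 := congrFun (hG (Q.tail b) r) b
    rw [← e, ← hR] at h3
    simpa [A] using h3
  intro n hn b f
  rw [DirectSum.sub_apply, map_sub, T.slice_delta2, map_sub, map_sub, map_add, map_add]
  have h0 (a : Q.E) (f : Q.Jacobi →ₗ[ℂ] ℂ) : T.graded n (slice f (H z a)) = 0 := by
    rw [hH, graded_mul_idem, graded_gradedPred T hn, zero_mul]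
  have h1 (a b : Q.E) (hab : Q.head b = Q.tail a) :
      T.graded n (slice f (H z a) * arr b) = T.gradedPred n (T.gradedPred m (G (Q.head a) (fun b =>
        if Q.tail b = Q.head a then T.graded m (slice f (z b)) else 0) a)) * arr b := by
    rw [hH, mul_assoc, ← hab, idem_mul_arr, graded_mul_arr']
  rw [h0, h0, add_zero, add_zero, h1 _ _ (T.head_φ _), h1 _ _ (T.head_ψ _), T.head_φ, T.head_ψ]
  obtain hn | rfl := hn.lt_or_eq
  · rw [gradedPred_gradedPred T hn, gradedPred_gradedPred T hn, zero_mul, zero_mul, sub_zero,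
      sub_zero]
    exact hm n hn b f
  · rw [gradedPred_gradedPred_self, gradedPred_gradedPred_self, ← graded_mul_arr',
      ← graded_mul_arr', ← map_sub, hG' b f _ rfl, graded_graded, if_pos rfl, sub_self]

variable {T}

theorem LocallyExact.isCY3 (h : T.LocallyExact) (h' : T.LocallyInjective) : Q.IsCY3 where
  injective_delta3 := h'.injective_delta3
  exact_delta3_delta2 := h.exact_delta3_delta2
  exact_delta2_delta1 := T.exact_delta2_delta1
  exact_delta1_augmentation := exact_delta1_augmentation
  surjective_augmentation := surjective_augmentation

end Triangulation

end DimerModel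

namespace ModifiedGrid

open ArrowQuiver DimerModel Vertex Arrow

/-! ### The faces of the modified grid -/

/-- The arrow following `a` in the list of arrows of its anticlockwise triangle. -/
def next : Arrow → Arrow
  | right i j => if h : (i, j) ≠ (0, 0) then diag i j h else xA00
  | up i j => if (i - 1, j) ≠ (0, 0) then right (i - 1) j else xB10
  | diag i j _ => up (i + 1) j
  | x01A => xB01
  | x10A => right 0 0
  | x11B => up 1 0
  | xAB => x01A
  | xA00 => x10A
  | xB01 => xAB
  | xB10 => x11B

/-- The arrow following `a` in the list of arrows of its clockwise triangle. -/
def next' : Arrow → Arrow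
  | right i j => if (i, j - 1) ≠ (0, 0) then up i (j - 1) else xB01
  | up i j => if h : (i, j) ≠ (0, 0) then diag i j h else xA00
  | diag i j _ => right i (j + 1)
  | x01A => up 0 0
  | x10A => xB10
  | x11B => right 0 1
  | xAB => x10A
  | xA00 => x01A
  | xB01 => x11B
  | xB10 => xAB

theorem next_right {i j : ℤ} (h : (i, j) ≠ (0, 0)) : next (right i j) = diag i j h := dif_pos h

theorem next_up {i j : ℤ} (h : (i, j) ≠ (0, 0)) : next (up (i + 1) j) = right i j := by
  rw [next, add_sub_cancel_right, if_pos h]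

theorem next'_right {i j : ℤ} (h : (i, j) ≠ (0, 0)) : next' (right i (j + 1)) = up i j := by
  rw [next', add_sub_cancel_right, if_pos h]

theorem next'_up {i j : ℤ} (h : (i, j) ≠ (0, 0)) : next' (up i j) = diag i j h := dif_pos h

/-- Case distinction according to the anticlockwise triangle of an arrow. -/
theorem pos_cases {P : Arrow → Prop} (hdiag : ∀ i j h, P (diag i j h))
    (hup : ∀ i j, (i, j) ≠ ((0 : ℤ), (0 : ℤ)) → P (up (i + 1) j))
    (hright : ∀ i j, (i, j) ≠ ((0 : ℤ), (0 : ℤ)) → P (right i j))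
    (hup0 : P (up 1 0)) (hright0 : P (right 0 0))
    (h1 : P x01A) (h2 : P x10A) (h3 : P x11B) (h4 : P xAB) (h5 : P xA00) (h6 : P xB01)
    (h7 : P xB10) : ∀ a, P a
  | right i j => by
    by_cases h : (i, j) = (0, 0)
    · obtain ⟨rfl, rfl⟩ := Prod.mk.inj h
      exact hright0
    · exact hright i j h
  | up i j => by
    by_cases h : (i - 1, j) = (0, 0)
    · obtain ⟨h, rfl⟩ := Prod.mk.inj h
      obtain rfl : i = 1 := by lia
      exact hup0
    · have := hup (i - 1) j h
      rwa [sub_add_cancel] at this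
  | diag i j h => hdiag i j h
  | x01A => h1
  | x10A => h2
  | x11B => h3
  | xAB => h4
  | xA00 => h5
  | xB01 => h6
  | xB10 => h7

/-- Case distinction according to the clockwise triangle of an arrow. -/
theorem neg_cases {P : Arrow → Prop} (hdiag : ∀ i j h, P (diag i j h))
    (hright : ∀ i j, (i, j) ≠ ((0 : ℤ), (0 : ℤ)) → P (right i (j + 1)))
    (hup : ∀ i j, (i, j) ≠ ((0 : ℤ), (0 : ℤ)) → P (up i j))
    (hright0 : P (right 0 1)) (hup0 : P (up 0 0))
    (h1 : P x01A) (h2 : P x10A) (h3 : P x11B) (h4 : P xAB) (h5 : P xA00) (h6 : P xB01)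
    (h7 : P xB10) : ∀ a, P a
  | right i j => by
    by_cases h : (i, j - 1) = (0, 0)
    · obtain ⟨rfl, h⟩ := Prod.mk.inj h
      obtain rfl : j = 1 := by lia
      exact hright0
    · have := hright i (j - 1) h
      rwa [sub_add_cancel] at this
  | up i j => by
    by_cases h : (i, j) = (0, 0)
    · obtain ⟨rfl, rfl⟩ := Prod.mk.inj h
      exact hup0
    · exact hup i j h
  | diag i j h => hdiag i j h
  | x01A => h1
  | x10A => h2
  | x11B => h3
  | xAB => h4
  | xA00 => h5
  | xB01 => h6
  | xB10 => h7

theorem next_spec (a : Arrow) : next (next (next a)) = a ∧ quiver.head (next a) = quiver.tail a ∧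
    (([a, next a, next (next a)] : List Arrow) : Cycle Arrow) ∈ posFaces := by
  induction a using pos_cases with
  | hdiag i j h =>
    refine ⟨?_, rfl, .inl ⟨i, j, h, ?_⟩⟩
    · rw [next, next_up h, next_right h]
    · rw [next, next_up h]
  | hup i j h =>
    rw [next_up h, next_right h]
    exact ⟨rfl, rfl, .inl ⟨i, j, h, Cycle.coe_eq_coe.2 ⟨2, rfl⟩⟩⟩
  | hright i j h =>
    rw [next_right h]
    exact ⟨next_up h, rfl, .inl ⟨i, j, h, Cycle.coe_eq_coe.2 ⟨1, rfl⟩⟩⟩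
  | hup0 => exact ⟨rfl, rfl, .inr (.inr (.inr (Cycle.coe_eq_coe.2 ⟨1, rfl⟩)))⟩
  | hright0 => exact ⟨rfl, rfl, .inr (.inr (.inl (Cycle.coe_eq_coe.2 ⟨1, rfl⟩)))⟩
  | h1 => exact ⟨rfl, rfl, .inr (.inl (Cycle.coe_eq_coe.2 ⟨1, rfl⟩))⟩
  | h2 => exact ⟨rfl, rfl, .inr (.inr (.inl (Cycle.coe_eq_coe.2 ⟨2, rfl⟩)))⟩
  | h3 => exact ⟨rfl, rfl, .inr (.inr (.inr (Cycle.coe_eq_coe.2 ⟨2, rfl⟩)))⟩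
  | h4 => exact ⟨rfl, rfl, .inr (.inl (Cycle.coe_eq_coe.2 ⟨2, rfl⟩))⟩
  | h5 => exact ⟨rfl, rfl, .inr (.inr (.inl rfl))⟩
  | h6 => exact ⟨rfl, rfl, .inr (.inl rfl)⟩
  | h7 => exact ⟨rfl, rfl, .inr (.inr (.inr rfl))⟩

theorem next'_spec (a : Arrow) : next' (next' (next' a)) = a ∧
    quiver.head (next' a) = quiver.tail a ∧
    (([a, next' a, next' (next' a)] : List Arrow) : Cycle Arrow) ∈ negFaces := by
  induction a using neg_cases with
  | hdiag i j h =>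
    refine ⟨?_, rfl, .inl ⟨i, j, h, ?_⟩⟩
    · rw [next', next'_right h, next'_up h]
    · rw [next', next'_right h]
  | hright i j h =>
    rw [next'_right h, next'_up h]
    exact ⟨rfl, rfl, .inl ⟨i, j, h, Cycle.coe_eq_coe.2 ⟨2, rfl⟩⟩⟩
  | hup i j h =>
    rw [next'_up h]
    exact ⟨next'_right h, rfl, .inl ⟨i, j, h, Cycle.coe_eq_coe.2 ⟨1, rfl⟩⟩⟩
  | hright0 => exact ⟨rfl, rfl, .inr (.inl (Cycle.coe_eq_coe.2 ⟨1, rfl⟩))⟩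
  | hup0 => exact ⟨rfl, rfl, .inr (.inr (.inl (Cycle.coe_eq_coe.2 ⟨1, rfl⟩)))⟩
  | h1 => exact ⟨rfl, rfl, .inr (.inr (.inl (Cycle.coe_eq_coe.2 ⟨2, rfl⟩)))⟩
  | h2 => exact ⟨rfl, rfl, .inr (.inr (.inr (Cycle.coe_eq_coe.2 ⟨1, rfl⟩)))⟩
  | h3 => exact ⟨rfl, rfl, .inr (.inl (Cycle.coe_eq_coe.2 ⟨2, rfl⟩))⟩
  | h4 => exact ⟨rfl, rfl, .inr (.inr (.inr (Cycle.coe_eq_coe.2 ⟨2, rfl⟩)))⟩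
  | h5 => exact ⟨rfl, rfl, .inr (.inr (.inl rfl))⟩
  | h6 => exact ⟨rfl, rfl, .inr (.inl rfl)⟩
  | h7 => exact ⟨rfl, rfl, .inr (.inr (.inr rfl))⟩

/-- The faces of the modified grid are triangles. -/
def triangulation : dimer.Triangulation where
  φ := next
  ψ := next'
  φ_φ_φ a := (next_spec a).1
  ψ_ψ_ψ a := (next'_spec a).1
  head_φ a := (next_spec a).2.1
  head_ψ a := (next'_spec a).2.1
  posPath_eq a := ((dimer.existsUnique_posPath a).choose_spec.2 _ (next_spec a).2.2).symm
  negPath_eq a := ((dimer.existsUnique_negPath a).choose_spec.2 _ (next'_spec a).2.2).symm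

/-- The class of an arrow in the Jacobi algebra of the modified grid. -/
abbrev cl (a : Arrow) : dimer.Jacobi := arr (Q := dimer) a

theorem cl_relation (a : Arrow) : cl (next a) * cl (next (next a)) =
    cl (next' a) * cl (next' (next' a)) := triangulation.arr_mul_arr a

/-- The relation of a diagonal makes its square commute. The central square has no diagonal, which
is the source of κ. -/
theorem up_mul_right {i j : ℤ} (h : (i, j) ≠ (0, 0)) :
    cl (up (i + 1) j) * cl (right i j) = cl (right i (j + 1)) * cl (up i j) := by
  have := cl_relation (diag i j h)
  rwa [next, next_up h, next', next'_right h] at this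

theorem right_mul_diag {i j : ℤ} (h : (i, j) ≠ (0, 0)) (h' : (i + 1, j) ≠ (0, 0)) :
    cl (right i j) * cl (diag i j h) = cl (diag (i + 1) j h') * cl (right (i + 1) (j + 1)) := by
  have := cl_relation (up (i + 1) j)
  rwa [next_up h, next_right h, next'_up h'] at this

theorem up_mul_diag {i j : ℤ} (h : (i, j) ≠ (0, 0)) (h' : (i, j + 1) ≠ (0, 0)) :
    cl (up i j) * cl (diag i j h) = cl (diag i (j + 1) h') * cl (up (i + 1) (j + 1)) := by
  have := cl_relation (right i (j + 1))
  rw [next_right h', next'_right h, next'_up h] at this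
  exact this.symm

theorem right_mul_diag_neg :
    cl (right (-1) 0) * cl (diag (-1) 0 (by simp)) = cl xA00 * cl x01A := by
  have := cl_relation (up 0 0)
  rwa [show up 0 0 = up (-1 + 1) 0 from rfl, next_up (by simp), next_right (by simp)] at this

theorem up_mul_diag_neg :
    cl (up 0 (-1)) * cl (diag 0 (-1) (by simp)) = cl xA00 * cl x10A := by
  have := cl_relation (right 0 0)
  rw [show right 0 0 = right 0 (-1 + 1) from rfl, next'_right (by simp), next'_up (by simp)] at this
  exact this.symm

theorem diag_mul_right :
    cl (diag 1 0 (by simp)) * cl (right 1 1) = cl xB10 * cl x11B := by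
  have := cl_relation (up 1 0)
  rw [next'_up (by simp)] at this
  exact this.symm

theorem diag_mul_up :
    cl (diag 0 1 (by simp)) * cl (up 1 1) = cl xB01 * cl x11B := by
  have := cl_relation (right 0 1)
  rwa [next_right (by simp)] at this

theorem B01_mul_AB : cl xB01 * cl xAB = cl (up 0 0) * cl xA00 := cl_relation x01A

theorem right_mul_A00 : cl (right 0 0) * cl xA00 = cl xB10 * cl xAB := cl_relation x10A

theorem up_mul_B10 : cl (up 1 0) * cl xB10 = cl (right 0 1) * cl xB01 := cl_relation x11B

theorem x10A_mul_right : cl x10A * cl (right 0 0) = cl x01A * cl (up 0 0) := cl_relation xA00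

theorem AB_mul_01A : cl xAB * cl x01A = cl x11B * cl (right 0 1) := cl_relation xB01

theorem x11B_mul_up : cl x11B * cl (up 1 0) = cl xAB * cl x10A := cl_relation xB10

/-! ### Degrees of paths -/

/-- The degree of the arrows with respect to a perfect matching of the faces. -/
def zdeg : Arrow → ℤ
  | right _ _ => 0
  | up _ _ => 0
  | diag _ _ _ => 1
  | x01A => 0
  | x10A => 0
  | x11B => 0
  | xAB => 0
  | xA00 => 1
  | xB01 => 1
  | xB10 => 1

/-- A potential on the vertices: an arrow `a` raises it by `1 - 3 zdeg a`. -/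
def level : Vertex → ℤ
  | grid i j => i + j
  | A => 2
  | B => 3

/-- Consequently a path of degree c from v to u has length `level u - level v + 3 * c`, the quantity
that the inductions over paths use as measure. -/
theorem level_head (a : Arrow) :
    level (quiver.head a) = level (quiver.tail a) + 1 - 3 * zdeg a := by
  cases a <;> simp only [quiver, level, zdeg] <;> ring

theorem zdeg_next (a : Arrow) : zdeg a + zdeg (next a) + zdeg (next (next a)) = 1 := by
  induction a using pos_cases with
  | hdiag i j h => rw [next, next_up h]; rfl
  | hup i j h => rw [next_up h, next_right h]; rfl
  | hright i j h => rw [next_right h]; rfl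
  | _ => rfl

theorem zdeg_next' (a : Arrow) : zdeg a + zdeg (next' a) + zdeg (next' (next' a)) = 1 := by
  induction a using neg_cases with
  | hdiag i j h => rw [next', next'_right h]; rfl
  | hup i j h => rw [next'_up h]; rfl
  | hright i j h => rw [next'_right h, next'_up h]; rfl
  | _ => rfl

/-- `Admissible v u c` says that there is a path of degree `c` with tail `v` and head `u`. -/
def Admissible : Vertex → Vertex → ℤ → Prop
  -- The bounds are those of the unmodified grid, where a diagonal is the only arrow that decreases
  -- coordinates. The excluded case is the path consisting of diagonals only, which would have to
  -- use the missing diagonal of the central square; the exclusions for A and B below have the same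
  -- origin.
  | grid i j, grid k l, c => 0 ≤ c ∧ i - k ≤ c ∧ j - l ≤ c ∧
      ¬ (i = j ∧ 1 ≤ i ∧ k = l ∧ l ≤ 0 ∧ c = i - k)
  | grid i j, A, c => 0 ≤ c ∧ i - 1 ≤ c ∧ j - 1 ≤ c ∧ ¬ (i = j ∧ 1 ≤ i ∧ c = i - 1)
  | grid i j, B, c => 0 ≤ c ∧ i - 1 ≤ c ∧ j - 1 ≤ c
  | A, grid k l, c => 1 ≤ c ∧ 1 - k ≤ c ∧ 1 - l ≤ c
  | B, grid k l, c => 1 ≤ c ∧ 1 - k ≤ c ∧ 1 - l ≤ c ∧ ¬ (k = l ∧ k ≤ 0 ∧ c = 1 - k)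
  | A, A, c => 0 ≤ c
  | A, B, c => 0 ≤ c
  | B, A, c => 1 ≤ c
  | B, B, c => 0 ≤ c

theorem Admissible.refl (u : Vertex) : Admissible u u 0 := by
  cases u <;> simp only [Admissible] <;> omega

theorem Admissible.snoc {u : Vertex} {c : ℤ} (b : Arrow) (h : Admissible (quiver.head b) u c) :
    Admissible (quiver.tail b) u (c + zdeg b) := by
  cases b <;> cases u <;> simp only [quiver, Admissible, zdeg] at h ⊢ <;> try omega
  all_goals
    simp only [ne_eq, Prod.mk.injEq] at *
    omega

theorem Admissible.level_nonneg {v u : Vertex} {c : ℤ} (h : Admissible v u c) :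
    0 ≤ level u - level v + 3 * c := by
  cases v <;> cases u <;> simp only [Admissible, level] at h ⊢ <;> omega

theorem Admissible.eq_of_level {v u : Vertex} {c : ℤ} (h : Admissible v u c)
    (h' : level u - level v + 3 * c = 0) : v = u ∧ c = 0 := by
  cases v <;> cases u <;> simp only [Admissible, level] at h h' <;> try omega
  · simp only [grid.injEq]; omega
  · exact ⟨rfl, by omega⟩
  · exact ⟨rfl, by omega⟩

/-- This makes `Admissible` sharp: a first arrow can always be split off while positive length
remains. If no arrow leaving v worked, the inequalities would contradict each other. -/
theorem Admissible.descend {v u : Vertex} {c : ℤ} (h : Admissible v u c)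
    (h' : 0 < level u - level v + 3 * c) :
    ∃ b, quiver.tail b = v ∧ Admissible (quiver.head b) u (c - zdeg b) := by
  by_contra hcon
  have key (b : Arrow) (hb : quiver.tail b = v) : ¬ Admissible (quiver.head b) u (c - zdeg b) :=
    fun h => hcon ⟨b, hb, h⟩
  cases v with
  | A =>
    have h1 := key xAB rfl
    have h2 := key xA00 rfl
    cases u <;> simp only [quiver, Admissible, zdeg, level] at h h' h1 h2 <;> omega
  | B =>
    have h1 := key xB01 rfl
    have h2 := key xB10 rfl
    cases u <;> simp only [quiver, Admissible, zdeg, level] at h h' h1 h2 <;> omega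
  | grid i j =>
    have h1 := key (right i j) rfl
    have h2 := key (up i j) rfl
    by_cases h11 : (i - 1, j - 1) = (0, 0)
    · obtain ⟨hi, hj⟩ := Prod.mk.inj h11
      obtain rfl : i = 1 := by omega
      obtain rfl : j = 1 := by omega
      have h3 := key x11B rfl
      cases u <;> simp only [quiver, Admissible, zdeg, level, true_and] at h h' h1 h2 h3 <;> omega
    · have h3 := key (diag (i - 1) (j - 1) h11) (by simp [quiver])
      by_cases h01 : i = 0 ∧ j = 1
      · obtain ⟨rfl, rfl⟩ := h01
        have h4 := key x01A rfl
        cases u <;> simp only [quiver, Admissible, zdeg, level] at h h' h1 h2 h3 h4 <;> omega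
      by_cases h10 : i = 1 ∧ j = 0
      · obtain ⟨rfl, rfl⟩ := h10
        have h4 := key x10A rfl
        cases u <;> simp only [quiver, Admissible, zdeg, level] at h h' h1 h2 h3 h4 <;> omega
      simp only [Prod.mk.injEq] at h11
      cases u <;> simp only [quiver, Admissible, zdeg, level] at h h' h1 h2 h3 <;> omega

/-- Except for the paths from `A` to the upper right quadrant, a degree is admissible if the
corresponding degrees for the arrows with the given head are. -/
theorem admissible_of_forall {v u : Vertex} {c : ℤ}
    (h : ∀ a, quiver.head a = v → Admissible (quiver.tail a) u (c + zdeg a)) :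
    Admissible v u c ∨ v = A ∧ c = 0 ∧ ∃ k l, u = grid k l ∧ 1 ≤ k ∧ 1 ≤ l := by
  cases v with
  | A =>
    have h1 := h x01A rfl
    have h2 := h x10A rfl
    cases u with
    | grid k l =>
      by_cases hc : c = 0 ∧ 1 ≤ k ∧ 1 ≤ l
      · exact .inr ⟨rfl, hc.1, k, l, rfl, hc.2⟩
      · refine .inl ?_
        simp only [quiver, Admissible, zdeg] at h1 h2 ⊢
        omega
    | A =>
      refine .inl ?_
      simp only [quiver, Admissible, zdeg] at h1 h2 ⊢
      omega
    | B =>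
      refine .inl ?_
      simp only [quiver, Admissible, zdeg] at h1 h2 ⊢
      omega
  | B =>
    refine .inl ?_
    have h1 := h x11B rfl
    have h2 := h xAB rfl
    cases u <;> simp only [quiver, Admissible, zdeg, true_and] at h1 h2 ⊢ <;> omega
  | grid i j =>
    refine .inl ?_
    have h1 := h (right (i - 1) j) (by simp [quiver])
    have h2 := h (up i (j - 1)) (by simp [quiver])
    by_cases h00 : (i, j) = (0, 0)
    · obtain ⟨rfl, rfl⟩ := Prod.mk.inj h00
      have h3 := h xA00 rfl
      cases u <;> simp only [quiver, Admissible, zdeg] at h1 h2 h3 ⊢ <;> omega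
    · have h3 := h (diag i j h00) rfl
      by_cases h01 : i = 0 ∧ j = 1
      · obtain ⟨rfl, rfl⟩ := h01
        have h4 := h xB01 rfl
        cases u <;> simp only [quiver, Admissible, zdeg] at h1 h2 h3 h4 ⊢ <;> omega
      by_cases h10 : i = 1 ∧ j = 0
      · obtain ⟨rfl, rfl⟩ := h10
        have h4 := h xB10 rfl
        cases u <;> simp only [quiver, Admissible, zdeg] at h1 h2 h3 h4 ⊢ <;> omega
      simp only [Prod.mk.injEq] at h00
      cases u <;> simp only [quiver, Admissible, zdeg] at h1 h2 h3 ⊢ <;> omega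

/-! ### Connectedness of the arrows that start a path -/

/-- Two arrows with the same tail `v` are related if there are paths of degree `c` with tail `v` and
head `u` starting with the two sides of a relation, or with the two paths from `(0,0)` to
`(1,1)`. -/
inductive Step (u : Vertex) (c : ℤ) : Arrow → Arrow → Prop
  | face (a : Arrow) (h : Admissible (quiver.tail a) u (c - 1 + zdeg a)) :
      Step u c (next (next a)) (next' (next' a))
  | square (h : Admissible (grid 1 1) u c) : Step u c (up 0 0) (right 0 0)

/-- The equivalence relation generated by `Step`. -/
abbrev Conn (u : Vertex) (c : ℤ) : Arrow → Arrow → Prop := Relation.EqvGen (Step u c)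

theorem Conn.symm {u : Vertex} {c : ℤ} {a b : Arrow} (h : Conn u c a b) : Conn u c b a :=
  Relation.EqvGen.symm _ _ h

theorem Conn.trans {u : Vertex} {c : ℤ} {a b d : Arrow} (h : Conn u c a b) (h' : Conn u c b d) :
    Conn u c a d := Relation.EqvGen.trans _ _ _ h h'

/-- The commuting square provides the step, except at the origin, where the constructor `square`
replaces the missing relation. -/
theorem conn_right_up {u : Vertex} {c : ℤ} (i j : ℤ)
    (h : Admissible (grid (i + 1) (j + 1)) u c) : Conn u c (right i j) (up i j) := by
  by_cases h0 : (i, j) = (0, 0)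
  · obtain ⟨rfl, rfl⟩ := Prod.mk.inj h0
    exact .symm (.rel _ _ (.square h))
  · have := Step.face (u := u) (c := c) (diag i j h0) (by simpa [quiver, zdeg] using h)
    rw [next, next_up h0, next', next'_right h0] at this
    exact .rel _ _ this

theorem conn_up_diag {u : Vertex} {c : ℤ} (i j : ℤ) (h0 : (i - 1, j) ≠ (0, 0))
    (h1 : (i - 1, j - 1) ≠ (0, 0)) (h : Admissible (grid (i - 1) j) u (c - 1)) :
    Conn u c (up i j) (diag (i - 1) (j - 1) h1) := by
  have := Step.face (u := u) (c := c) (right (i - 1) j) (by simpa [quiver, zdeg] using h)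
  rw [next_right h0, next, sub_add_cancel, next', if_pos h1, next'_up h1] at this
  exact .rel _ _ this

theorem conn_diag_right {u : Vertex} {c : ℤ} (i j : ℤ) (h0 : (i, j - 1) ≠ (0, 0))
    (h1 : (i - 1, j - 1) ≠ (0, 0)) (h : Admissible (grid i (j - 1)) u (c - 1)) :
    Conn u c (diag (i - 1) (j - 1) h1) (right i j) := by
  have := Step.face (u := u) (c := c) (up i (j - 1)) (by simpa [quiver, zdeg] using h)
  rw [next'_up h0, next', sub_add_cancel, next, if_pos h1, next_right h1] at this
  exact .rel _ _ this

theorem tail_cases {P : Arrow → Prop} {v : Vertex}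
    (hright : ∀ i j, v = grid i j → P (right i j)) (hup : ∀ i j, v = grid i j → P (up i j))
    (hdiag : ∀ i j (h : (i - 1, j - 1) ≠ (0, 0)), v = grid i j → P (diag (i - 1) (j - 1) h))
    (h1 : v = grid 0 1 → P x01A) (h2 : v = grid 1 0 → P x10A) (h3 : v = grid 1 1 → P x11B)
    (h4 : v = A → P xAB) (h5 : v = A → P xA00) (h6 : v = B → P xB01) (h7 : v = B → P xB10) :
    ∀ a, quiver.tail a = v → P a
  | right i j, h => hright i j h.symm
  | up i j, h => hup i j h.symm
  | diag i j h', h => by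
    have := hdiag (i + 1) (j + 1) (by simpa using h') h.symm
    simpa using this
  | x01A, h => h1 h.symm
  | x10A, h => h2 h.symm
  | x11B, h => h3 h.symm
  | xAB, h => h4 h.symm
  | xA00, h => h5 h.symm
  | xB01, h => h6 h.symm
  | xB10, h => h7 h.symm

theorem conn_A {u : Vertex} {c : ℤ} (h : Admissible B u c) (h' : Admissible (grid 0 0) u (c - 1)) :
    Conn u c xAB xA00 := by
  have h1 : Admissible (grid 0 1) u (c - 1) ∨ Admissible (grid 1 0) u (c - 1) := by
    cases u <;> simp only [Admissible] at h h' ⊢ <;> omega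
  obtain h1 | h1 := h1
  · exact .rel _ _ (.face x01A (by simpa [quiver, zdeg] using h1))
  · exact .symm (.rel _ _ (.face x10A (by simpa [quiver, zdeg] using h1)))

theorem conn_B {u : Vertex} {c : ℤ} (h : Admissible (grid 0 1) u (c - 1))
    (h' : Admissible (grid 1 0) u (c - 1)) : Conn u c xB10 xB01 := by
  have h1 : Admissible (grid 1 1) u (c - 1) ∨ Admissible A u (c - 1) := by
    cases u <;> simp only [Admissible] at h h' ⊢ <;> omega
  obtain h1 | h1 := h1
  · exact .rel _ _ (.face x11B (by simpa [quiver, zdeg] using h1))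
  · exact .symm (.rel _ _ (.face xAB (by simpa [quiver, zdeg] using h1)))

/-- The arrows leaving a vertex are arranged in a cycle, with neighbours joined when a path passes
through the far corner. Two arrows that both start a path are joined along one of the two ways
around the cycle; the hypotheses reduce this to arithmetic. -/
theorem conn_of_three {u : Vertex} {c : ℤ} {b₁ b₂ b₃ : Arrow} {p₁₂ p₂₃ p₃₁ : Prop}
    {S : Arrow → Prop} (e₁₂ : p₁₂ → Conn u c b₁ b₂) (e₂₃ : p₂₃ → Conn u c b₂ b₃)
    (e₃₁ : p₃₁ → Conn u c b₃ b₁) (h₁₂ : S b₁ → S b₂ → p₁₂ ∨ p₂₃ ∧ p₃₁)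
    (h₂₃ : S b₂ → S b₃ → p₂₃ ∨ p₃₁ ∧ p₁₂) (h₃₁ : S b₃ → S b₁ → p₃₁ ∨ p₁₂ ∧ p₂₃) {x y : Arrow}
    (hx : x = b₁ ∨ x = b₂ ∨ x = b₃) (hy : y = b₁ ∨ y = b₂ ∨ y = b₃) (sx : S x) (sy : S y) :
    Conn u c x y := by
  have k₁₂ : S b₁ → S b₂ → Conn u c b₁ b₂ := fun s s' =>
    (h₁₂ s s').elim e₁₂ fun h => .symm ((e₂₃ h.1).trans (e₃₁ h.2))
  have k₂₃ : S b₂ → S b₃ → Conn u c b₂ b₃ := fun s s' =>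
    (h₂₃ s s').elim e₂₃ fun h => .symm ((e₃₁ h.1).trans (e₁₂ h.2))
  have k₃₁ : S b₃ → S b₁ → Conn u c b₃ b₁ := fun s s' =>
    (h₃₁ s s').elim e₃₁ fun h => .symm ((e₁₂ h.1).trans (e₂₃ h.2))
  obtain rfl | rfl | rfl := hx <;> obtain rfl | rfl | rfl := hy
  · exact .refl _
  · exact k₁₂ sx sy
  · exact (k₃₁ sy sx).symm
  · exact (k₁₂ sy sx).symm
  · exact .refl _
  · exact k₂₃ sx sy
  · exact k₃₁ sx sy
  · exact (k₂₃ sy sx).symm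
  · exact .refl _

theorem conn_of_four {u : Vertex} {c : ℤ} {b₁ b₂ b₃ b₄ : Arrow} {p₁₂ p₂₃ p₃₄ p₄₁ : Prop}
    {S : Arrow → Prop} (e₁₂ : p₁₂ → Conn u c b₁ b₂) (e₂₃ : p₂₃ → Conn u c b₂ b₃)
    (e₃₄ : p₃₄ → Conn u c b₃ b₄) (e₄₁ : p₄₁ → Conn u c b₄ b₁)
    (h₁₂ : S b₁ → S b₂ → p₁₂ ∨ p₂₃ ∧ p₃₄ ∧ p₄₁) (h₂₃ : S b₂ → S b₃ → p₂₃ ∨ p₃₄ ∧ p₄₁ ∧ p₁₂)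
    (h₃₄ : S b₃ → S b₄ → p₃₄ ∨ p₄₁ ∧ p₁₂ ∧ p₂₃) (h₄₁ : S b₄ → S b₁ → p₄₁ ∨ p₁₂ ∧ p₂₃ ∧ p₃₄)
    (h₁₃ : S b₁ → S b₃ → p₁₂ ∧ p₂₃ ∨ p₃₄ ∧ p₄₁) (h₂₄ : S b₂ → S b₄ → p₂₃ ∧ p₃₄ ∨ p₄₁ ∧ p₁₂)
    {x y : Arrow} (hx : x = b₁ ∨ x = b₂ ∨ x = b₃ ∨ x = b₄)
    (hy : y = b₁ ∨ y = b₂ ∨ y = b₃ ∨ y = b₄) (sx : S x) (sy : S y) : Conn u c x y := by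
  have k₁₂ : S b₁ → S b₂ → Conn u c b₁ b₂ := fun s s' =>
    (h₁₂ s s').elim e₁₂ fun h => .symm ((e₂₃ h.1).trans ((e₃₄ h.2.1).trans (e₄₁ h.2.2)))
  have k₂₃ : S b₂ → S b₃ → Conn u c b₂ b₃ := fun s s' =>
    (h₂₃ s s').elim e₂₃ fun h => .symm ((e₃₄ h.1).trans ((e₄₁ h.2.1).trans (e₁₂ h.2.2)))
  have k₃₄ : S b₃ → S b₄ → Conn u c b₃ b₄ := fun s s' =>
    (h₃₄ s s').elim e₃₄ fun h => .symm ((e₄₁ h.1).trans ((e₁₂ h.2.1).trans (e₂₃ h.2.2)))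
  have k₄₁ : S b₄ → S b₁ → Conn u c b₄ b₁ := fun s s' =>
    (h₄₁ s s').elim e₄₁ fun h => .symm ((e₁₂ h.1).trans ((e₂₃ h.2.1).trans (e₃₄ h.2.2)))
  have k₁₃ : S b₁ → S b₃ → Conn u c b₁ b₃ := fun s s' =>
    (h₁₃ s s').elim (fun h => (e₁₂ h.1).trans (e₂₃ h.2)) fun h => .symm ((e₃₄ h.1).trans (e₄₁ h.2))
  have k₂₄ : S b₂ → S b₄ → Conn u c b₂ b₄ := fun s s' =>
    (h₂₄ s s').elim (fun h => (e₂₃ h.1).trans (e₃₄ h.2)) fun h => .symm ((e₄₁ h.1).trans (e₁₂ h.2))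
  obtain rfl | rfl | rfl | rfl := hx <;> obtain rfl | rfl | rfl | rfl := hy
  · exact .refl _
  · exact k₁₂ sx sy
  · exact k₁₃ sx sy
  · exact (k₄₁ sy sx).symm
  · exact (k₁₂ sy sx).symm
  · exact .refl _
  · exact k₂₃ sx sy
  · exact k₂₄ sx sy
  · exact (k₁₃ sy sx).symm
  · exact (k₂₃ sy sx).symm
  · exact .refl _
  · exact k₃₄ sx sy
  · exact k₄₁ sx sy
  · exact (k₂₄ sy sx).symm
  · exact (k₃₄ sy sx).symm
  · exact .refl _

theorem conn_10 {u : Vertex} {c : ℤ} {b b' : Arrow} (hb : quiver.tail b = grid 1 0)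
    (hb' : quiver.tail b' = grid 1 0) (h : Admissible (quiver.head b) u (c - zdeg b))
    (h' : Admissible (quiver.head b') u (c - zdeg b')) : Conn u c b b' := by
  have e₂₃ (h : Admissible B u c) : Conn u c (up 1 0) x10A :=
    .rel _ _ (.face xB10 (by simpa [quiver, zdeg] using h))
  have e₃₄ (h : Admissible (grid 0 0) u (c - 1)) : Conn u c x10A (diag 0 (-1) (by simp)) :=
    .rel _ _ (.face (right 0 0) (by simpa [quiver, zdeg] using h))
  have key (d : Arrow) (hd : quiver.tail d = grid 1 0) :
      d = right 1 0 ∨ d = up 1 0 ∨ d = x10A ∨ d = diag 0 (-1) (by simp) := by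
    revert d
    refine tail_cases ?_ ?_ ?_ ?_ ?_ ?_ ?_ ?_ ?_ ?_ <;> simp +contextual [eq_comm]
  refine conn_of_four (S := fun b => Admissible (quiver.head b) u (c - zdeg b))
    (conn_right_up 1 0) e₂₃ e₃₄ (conn_diag_right 1 0 (by simp) (by simp)) ?_ ?_ ?_ ?_ ?_ ?_
    (key b hb) (key b' hb') h h' <;>
  cases u <;> simp only [quiver, Admissible, zdeg, true_and] <;> omega

theorem conn_01 {u : Vertex} {c : ℤ} {b b' : Arrow} (hb : quiver.tail b = grid 0 1)
    (hb' : quiver.tail b' = grid 0 1) (h : Admissible (quiver.head b) u (c - zdeg b))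
    (h' : Admissible (quiver.head b') u (c - zdeg b')) : Conn u c b b' := by
  have e₃₄ (h : Admissible (grid 0 0) u (c - 1)) : Conn u c (diag (-1) 0 (by simp)) x01A :=
    .rel _ _ (.face (up 0 0) (by simpa [quiver, zdeg] using h))
  have e₄₁ (h : Admissible B u c) : Conn u c x01A (right 0 1) :=
    .rel _ _ (.face xB01 (by simpa [quiver, zdeg] using h))
  have key (d : Arrow) (hd : quiver.tail d = grid 0 1) :
      d = right 0 1 ∨ d = up 0 1 ∨ d = diag (-1) 0 (by simp) ∨ d = x01A := by
    revert d
    refine tail_cases ?_ ?_ ?_ ?_ ?_ ?_ ?_ ?_ ?_ ?_ <;> simp +contextual [eq_comm]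
  refine conn_of_four (S := fun b => Admissible (quiver.head b) u (c - zdeg b))
    (conn_right_up 0 1) (conn_up_diag 0 1 (by simp) (by simp)) e₃₄ e₄₁ ?_ ?_ ?_ ?_ ?_ ?_
    (key b hb) (key b' hb') h h' <;>
  cases u <;> simp only [quiver, Admissible, zdeg, true_and] <;> omega

theorem conn_11 {u : Vertex} {c : ℤ} {b b' : Arrow} (hb : quiver.tail b = grid 1 1)
    (hb' : quiver.tail b' = grid 1 1) (h : Admissible (quiver.head b) u (c - zdeg b))
    (h' : Admissible (quiver.head b') u (c - zdeg b')) : Conn u c b b' := by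
  have e₂₃ (h : Admissible (grid 0 1) u (c - 1)) : Conn u c (up 1 1) x11B :=
    .rel _ _ (.face (right 0 1) (by simpa [quiver, zdeg] using h))
  have e₃₁ (h : Admissible (grid 1 0) u (c - 1)) : Conn u c x11B (right 1 1) :=
    .rel _ _ (.face (up 1 0) (by simpa [quiver, zdeg] using h))
  have key (d : Arrow) (hd : quiver.tail d = grid 1 1) :
      d = right 1 1 ∨ d = up 1 1 ∨ d = x11B := by
    revert d
    refine tail_cases ?_ ?_ ?_ ?_ ?_ ?_ ?_ ?_ ?_ ?_ <;>
      simp only [grid.injEq, reduceCtorEq] <;> grind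
  refine conn_of_three (S := fun b => Admissible (quiver.head b) u (c - zdeg b))
    (conn_right_up 1 1) e₂₃ e₃₁ ?_ ?_ ?_ (key b hb) (key b' hb') h h' <;>
  cases u <;> simp only [quiver, Admissible, zdeg, true_and] <;> omega

theorem conn_grid {u : Vertex} {c i j : ℤ} (h10 : ¬ (i = 1 ∧ j = 0)) (h01 : ¬ (i = 0 ∧ j = 1))
    (h11 : ¬ (i = 1 ∧ j = 1)) {b b' : Arrow} (hb : quiver.tail b = grid i j)
    (hb' : quiver.tail b' = grid i j) (h : Admissible (quiver.head b) u (c - zdeg b))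
    (h' : Admissible (quiver.head b') u (c - zdeg b')) : Conn u c b b' := by
  have h10' : (i - 1, j) ≠ (0, 0) := by simp only [ne_eq, Prod.mk.injEq]; omega
  have h01' : (i, j - 1) ≠ (0, 0) := by simp only [ne_eq, Prod.mk.injEq]; omega
  have h11' : (i - 1, j - 1) ≠ (0, 0) := by simp only [ne_eq, Prod.mk.injEq]; omega
  have key (d : Arrow) (hd : quiver.tail d = grid i j) :
      d = right i j ∨ d = up i j ∨ d = diag (i - 1) (j - 1) h11' := by
    revert d
    refine tail_cases ?_ ?_ ?_ ?_ ?_ ?_ ?_ ?_ ?_ ?_ <;> simp only [grid.injEq, reduceCtorEq] <;>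
      grind
  -- At the origin the arrows `right` and `up` are also joined through A, by the relation of A →
  -- (0,0).
  have e₁₂ (h : Admissible (grid (i + 1) (j + 1)) u c ∨ i = 0 ∧ j = 0 ∧ Admissible A u c) :
      Conn u c (right i j) (up i j) := by
    obtain h | ⟨rfl, rfl, h⟩ := h
    · exact conn_right_up i j h
    · exact .rel _ _ (.face xA00 (by simpa [quiver, zdeg] using h))
  refine conn_of_three (S := fun b => Admissible (quiver.head b) u (c - zdeg b))
    e₁₂ (conn_up_diag i j h10' h11') (conn_diag_right i j h01' h11') ?_ ?_ ?_
    (key b hb) (key b' hb') h h' <;>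
  cases u <;> simp only [quiver, Admissible, zdeg] <;> omega

/-- The combinatorial core of the classification of paths: any two possible first arrows can be
exchanged by relations and by moves across the central square. The three grid corners other than the
origin need their own treatment because extra arrows leave them. -/
theorem conn_starts {u v : Vertex} {c : ℤ} {b b' : Arrow} (hb : quiver.tail b = v)
    (hb' : quiver.tail b' = v) (h : Admissible (quiver.head b) u (c - zdeg b))
    (h' : Admissible (quiver.head b') u (c - zdeg b')) : Conn u c b b' := by
  cases v with
  | A =>
    cases b <;> cases hb <;> cases b' <;> cases hb' <;>
      simp only [quiver, zdeg, sub_zero] at h h'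
    · exact .refl _
    · exact conn_A h h'
    · exact (conn_A h' h).symm
    · exact .refl _
  | B =>
    cases b <;> cases hb <;> cases b' <;> cases hb' <;>
      simp only [quiver, zdeg] at h h'
    · exact .refl _
    · exact (conn_B h h').symm
    · exact conn_B h' h
    · exact .refl _
  | grid i j =>
    by_cases h10 : i = 1 ∧ j = 0
    · obtain ⟨rfl, rfl⟩ := h10
      exact conn_10 hb hb' h h'
    by_cases h01 : i = 0 ∧ j = 1
    · obtain ⟨rfl, rfl⟩ := h01
      exact conn_01 hb hb' h h'
    by_cases h11 : i = 1 ∧ j = 1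
    · obtain ⟨rfl, rfl⟩ := h11
      exact conn_11 hb hb' h h'
    exact conn_grid h10 h01 h11 hb hb' h h'

/-! ### The ideal of differences of parallel paths -/

theorem head_cases {P : Arrow → Prop} {v : Vertex}
    (hright : ∀ i j, v = grid i j → P (right (i - 1) j))
    (hup : ∀ i j, v = grid i j → P (up i (j - 1)))
    (hdiag : ∀ i j (h : (i, j) ≠ (0, 0)), v = grid i j → P (diag i j h))
    (h1 : v = A → P x01A) (h2 : v = A → P x10A) (h3 : v = B → P x11B)
    (h4 : v = B → P xAB) (h5 : v = grid 0 0 → P xA00) (h6 : v = grid 0 1 → P xB01)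
    (h7 : v = grid 1 0 → P xB10) : ∀ a, quiver.head a = v → P a
  | right i j, h => by simpa using hright (i + 1) j h.symm
  | up i j, h => by simpa using hup i (j + 1) h.symm
  | diag i j h', h => hdiag i j h' h.symm
  | x01A, h => h1 h.symm
  | x10A, h => h2 h.symm
  | x11B, h => h3 h.symm
  | xAB, h => h4 h.symm
  | xA00, h => h5 h.symm
  | xB01, h => h6 h.symm
  | xB10, h => h7 h.symm

/-- The idempotent of a vertex in the Jacobi algebra of the modified grid. -/
abbrev vtx (v : Vertex) : dimer.Jacobi := idem (Q := dimer) v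

theorem cl_mul_vtx (a : Arrow) : cl a * vtx (quiver.tail a) = cl a := arr_mul_idem (Q := dimer) a

theorem vtx_mul_cl (a : Arrow) : vtx (quiver.head a) * cl a = cl a := idem_mul_arr (Q := dimer) a

/-- The difference of the two paths around the central square. -/
def kappa : dimer.Jacobi := cl (up 1 0) * cl (right 0 0) - cl (right 0 1) * cl (up 0 0)

theorem kappa_mul_vtx : kappa * vtx (grid 0 0) = kappa := by
  rw [kappa, sub_mul, mul_assoc, mul_assoc]
  exact congrArg₂ _ (congrArg _ (cl_mul_vtx (right 0 0))) (congrArg _ (cl_mul_vtx (up 0 0)))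

theorem vtx_mul_kappa : vtx (grid 1 1) * kappa = kappa := by
  rw [kappa, mul_sub, ← mul_assoc, ← mul_assoc]
  exact congrArg₂ _ (congrArg (· * _) (vtx_mul_cl (up 1 0)))
    (congrArg (· * _) (vtx_mul_cl (right 0 1)))

/-- After A → (0,0) both paths around the square can be rewritten, through B, into each other: the
relations of x10A, x11B and x01A do this in turn. -/
theorem kappa_mul_A00 : kappa * cl xA00 = 0 := by
  rw [kappa, sub_mul, mul_assoc, mul_assoc, right_mul_A00, ← B01_mul_AB, ← mul_assoc, ← mul_assoc,
    up_mul_B10, sub_self]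

/-- The mirror image: the relations of xB10, xB01 and xA00 identify the two paths once they are
followed by (1,1) → B. -/
theorem x11B_mul_kappa : cl x11B * kappa = 0 := by
  rw [kappa, mul_sub, ← mul_assoc, ← mul_assoc, x11B_mul_up, ← AB_mul_01A, mul_assoc, mul_assoc,
    x10A_mul_right, sub_self]

/-- The path of arrows `right` and `up` from `(-i,-j)` to `(0,0)`. -/
def lowerPath : ℕ → ℕ → dimer.Jacobi
  | 0, 0 => vtx (grid 0 0)
  | 0, j + 1 => lowerPath 0 j * cl (up 0 (-j - 1))
  | i + 1, j => lowerPath i j * cl (right (-i - 1) (-j))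

theorem lowerPath_mul_up (i j : ℕ) :
    lowerPath i j * cl (up (-i) (-j - 1)) = lowerPath i (j + 1) := by
  induction i with
  | zero => rw [lowerPath]; simp
  | succ i ih =>
    have h := up_mul_right (i := -(i : ℤ) - 1) (j := -(j : ℤ) - 1)
      (by simp only [ne_eq, Prod.mk.injEq]; omega)
    rw [sub_add_cancel, sub_add_cancel] at h
    rw [lowerPath, lowerPath, ← ih, mul_assoc, mul_assoc]
    push_cast
    rw [show -((i : ℤ) + 1) = -i - 1 by ring, show -((j : ℤ) + 1) = -j - 1 by ring, h]

/-- The diagonal is commuted through the monotone path towards the central square. In the last step,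
next to the origin, a relation replaces it by a path through A → (0,0), which κ annihilates. -/
theorem kappa_mul_lowerPath_mul_diag (i j : ℕ) (h : (-(i : ℤ), -(j : ℤ)) ≠ (0, 0)) :
    kappa * lowerPath i j * cl (diag (-i) (-j) h) = 0 := by
  induction i with
  | zero =>
    induction j with
    | zero => exact absurd (by simp) h
    | succ j ih =>
      have e : (diag (-(0 : ℕ)) (-(j + 1 : ℕ)) h) = diag 0 (-j - 1) (by simp only [ne_eq, Prod.mk.injEq]; omega) := by
        simp only [diag.injEq, and_true]; omega
      rw [lowerPath, mul_assoc, mul_assoc, e]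
      by_cases hj : j = 0
      · subst hj
        have h' : cl (up 0 (-(0 : ℕ) - 1)) * cl (diag 0 (-(0 : ℕ) - 1) (by simp)) =
          cl xA00 * cl x10A := up_mul_diag_neg
        rw [h', lowerPath, ← mul_assoc, ← mul_assoc, kappa_mul_vtx, kappa_mul_A00, zero_mul]
      · have h' := up_mul_diag (i := 0) (j := -(j : ℤ) - 1) (by simp only [ne_eq, Prod.mk.injEq]; omega)
          (by rw [sub_add_cancel]; simp only [ne_eq, Prod.mk.injEq]; omega)
        simp only [sub_add_cancel] at h'
        have := ih (by simp [hj])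
        simp only [Nat.cast_zero, neg_zero] at this
        rw [h', ← mul_assoc, ← mul_assoc, this, zero_mul]
  | succ i ih =>
    have e : (diag (-(i + 1 : ℕ)) (-j) h) =
        diag (-i - 1) (-j) (by simp only [ne_eq, Prod.mk.injEq]; omega) := by
      simp only [diag.injEq, and_true]; omega
    rw [lowerPath, mul_assoc, mul_assoc, e]
    by_cases hj : i = 0 ∧ j = 0
    · obtain ⟨rfl, rfl⟩ := hj
      have h' : cl (right (-(0 : ℕ) - 1) (-(0 : ℕ))) * cl (diag (-(0 : ℕ) - 1) (-(0 : ℕ)) (by simp)) =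
        cl xA00 * cl x01A := right_mul_diag_neg
      rw [h', lowerPath, ← mul_assoc, ← mul_assoc, kappa_mul_vtx, kappa_mul_A00, zero_mul]
    · have h' := right_mul_diag (i := -(i : ℤ) - 1) (j := -(j : ℤ)) (by simp only [ne_eq, Prod.mk.injEq]; omega)
        (by rw [sub_add_cancel]; simp only [ne_eq, Prod.mk.injEq]; omega)
      simp only [sub_add_cancel] at h'
      rw [h', ← mul_assoc, ← mul_assoc, ih, zero_mul]

/-- The path of arrows `right` and `up` from `(1,1)` to `(k+1,l+1)`. -/
def upperPath : ℕ → ℕ → dimer.Jacobi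
  | 0, 0 => vtx (grid 1 1)
  | 0, l + 1 => cl (up 1 (l + 1)) * upperPath 0 l
  | k + 1, l => cl (right (k + 1) (l + 1)) * upperPath k l

theorem up_mul_upperPath (k l : ℕ) :
    cl (up (k + 1) (l + 1)) * upperPath k l = upperPath k (l + 1) := by
  induction k with
  | zero => rw [upperPath]; simp
  | succ k ih =>
    have h := up_mul_right (i := (k : ℤ) + 1) (j := (l : ℤ) + 1)
      (by simp only [ne_eq, Prod.mk.injEq]; omega)
    rw [upperPath, upperPath, ← ih, ← mul_assoc, ← mul_assoc]
    push_cast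
    rw [h]

/-- On this side the diagonal is commuted towards (1,1), where it turns into a path through (1,1) →
B. -/
theorem diag_mul_upperPath_mul_kappa (k l : ℕ) (h : ((k : ℤ), (l : ℤ)) ≠ (0, 0)) :
    cl (diag k l h) * (upperPath k l * kappa) = 0 := by
  induction k with
  | zero =>
    induction l with
    | zero => exact absurd rfl h
    | succ l ih =>
      have e : (diag (0 : ℕ) (l + 1 : ℕ) h) = diag 0 (l + 1) (by simp only [ne_eq, Prod.mk.injEq]; omega) := by
        simp only [diag.injEq, and_true]; omega
      rw [upperPath, ← mul_assoc, ← mul_assoc, e]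
      by_cases hl : l = 0
      · subst hl
        have h' : cl (diag 0 ((0 : ℕ) + 1) (by simp)) * cl (up 1 ((0 : ℕ) + 1)) =
          cl xB01 * cl x11B := diag_mul_up
        rw [h', upperPath, mul_assoc, mul_assoc, vtx_mul_kappa, x11B_mul_kappa, mul_zero]
      · have h' := up_mul_diag (i := 0) (j := (l : ℤ)) (by simp only [ne_eq, Prod.mk.injEq]; omega) (by simp only [ne_eq, Prod.mk.injEq]; omega)
        rw [zero_add] at h'
        have := ih (by simp [hl])
        simp only [Nat.cast_zero] at this
        rw [← h', mul_assoc, mul_assoc, this, mul_zero]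
  | succ k ih =>
    have e : (diag (k + 1 : ℕ) l h) = diag (k + 1) l (by simp only [ne_eq, Prod.mk.injEq]; omega) := by
      simp only [diag.injEq, and_true]; omega
    rw [upperPath, ← mul_assoc, ← mul_assoc, e]
    by_cases hl : k = 0 ∧ l = 0
    · obtain ⟨rfl, rfl⟩ := hl
      have h' : cl (diag ((0 : ℕ) + 1) (0 : ℕ) (by simp)) * cl (right ((0 : ℕ) + 1) ((0 : ℕ) + 1)) =
        cl xB10 * cl x11B := diag_mul_right
      rw [h', upperPath, mul_assoc, mul_assoc, vtx_mul_kappa, x11B_mul_kappa, mul_zero]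
    · have h' := right_mul_diag (i := (k : ℤ)) (j := (l : ℤ)) (by simp only [ne_eq, Prod.mk.injEq]; omega) (by simp only [ne_eq, Prod.mk.injEq]; omega)
      rw [← h', mul_assoc, mul_assoc, ih, mul_zero]

/-- The difference of a path from `(-i,-j)` to `(k+1,l+1)` passing below the central square and
of one passing above it. -/
def defect (k l i j : ℕ) : dimer.Jacobi := upperPath k l * kappa * lowerPath i j

theorem defect_mul_right (k l i j : ℕ) :
    defect k l i j * cl (right (-i - 1) (-j)) = defect k l (i + 1) j := by
  rw [defect, mul_assoc, defect, lowerPath]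

theorem defect_mul_up (k l i j : ℕ) :
    defect k l i j * cl (up (-i) (-j - 1)) = defect k l i (j + 1) := by
  rw [defect, mul_assoc, lowerPath_mul_up, defect]

theorem defect_mul_diag (k l i j : ℕ) (h : (-(i : ℤ), -(j : ℤ)) ≠ (0, 0)) :
    defect k l i j * cl (diag (-i) (-j) h) = 0 := by
  rw [defect, mul_assoc (upperPath k l), mul_assoc, kappa_mul_lowerPath_mul_diag, mul_zero]

theorem defect_mul_A00 (k l : ℕ) : defect k l 0 0 * cl xA00 = 0 := by
  rw [defect, lowerPath, mul_assoc, mul_assoc, ← mul_assoc kappa, kappa_mul_vtx, kappa_mul_A00,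
    mul_zero]

theorem right_mul_defect (k l i j : ℕ) :
    cl (right (k + 1) (l + 1)) * defect k l i j = defect (k + 1) l i j := by
  rw [defect, ← mul_assoc, ← mul_assoc, defect, upperPath]

theorem up_mul_defect (k l i j : ℕ) :
    cl (up (k + 1) (l + 1)) * defect k l i j = defect k (l + 1) i j := by
  rw [defect, ← mul_assoc, ← mul_assoc, up_mul_upperPath, defect]

theorem diag_mul_defect (k l i j : ℕ) (h : ((k : ℤ), (l : ℤ)) ≠ (0, 0)) :
    cl (diag k l h) * defect k l i j = 0 := by
  rw [defect, ← mul_assoc, diag_mul_upperPath_mul_kappa, zero_mul]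

theorem x11B_mul_defect (i j : ℕ) : cl x11B * defect 0 0 i j = 0 := by
  rw [defect, upperPath, vtx_mul_kappa, ← mul_assoc, x11B_mul_kappa, zero_mul]

theorem lowerPath_mul_vtx (i j : ℕ) :
    lowerPath i j * vtx (grid (-i) (-j)) = lowerPath i j := by
  have key (b : Arrow) (x : dimer.Jacobi) (v : Vertex) (h : quiver.tail b = v) :
      x * cl b * vtx v = x * cl b := by
    subst h
    rw [mul_assoc, cl_mul_vtx]
  induction i with
  | zero =>
    induction j with
    | zero => simpa [lowerPath] using idem_mul_idem (Q := dimer) (grid 0 0)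
    | succ j ih =>
      rw [lowerPath]
      refine key _ _ _ (congrArg₂ grid ?_ ?_) <;> push_cast <;> ring
  | succ i ih =>
    rw [lowerPath]
    refine key _ _ _ (congrArg₂ grid ?_ ?_) <;> push_cast <;> ring

theorem vtx_mul_upperPath (k l : ℕ) :
    vtx (grid (k + 1) (l + 1)) * upperPath k l = upperPath k l := by
  have key (b : Arrow) (x : dimer.Jacobi) (v : Vertex) (h : quiver.head b = v) :
      vtx v * (cl b * x) = cl b * x := by
    subst h
    rw [← mul_assoc, vtx_mul_cl]
  induction k with
  | zero =>
    induction l with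
    | zero => simpa [upperPath] using idem_mul_idem (Q := dimer) (grid 1 1)
    | succ l ih =>
      rw [upperPath]
      refine key _ _ _ (congrArg₂ grid ?_ ?_) <;> push_cast <;> ring
  | succ k ih =>
    rw [upperPath]
    refine key _ _ _ (congrArg₂ grid ?_ ?_) <;> push_cast <;> ring

theorem defect_mul_vtx (k l i j : ℕ) : defect k l i j * vtx (grid (-i) (-j)) = defect k l i j := by
  rw [defect, mul_assoc, lowerPath_mul_vtx]

theorem vtx_mul_defect (k l i j : ℕ) :
    vtx (grid (k + 1) (l + 1)) * defect k l i j = defect k l i j := by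
  rw [defect, ← mul_assoc, ← mul_assoc, vtx_mul_upperPath]

/-- The span of the elements `defect k l i j`. -/
def defects : Submodule ℂ dimer.Jacobi :=
  Submodule.span ℂ (Set.range fun k : ℕ × ℕ × ℕ × ℕ => defect k.1 k.2.1 k.2.2.1 k.2.2.2)

theorem defect_mem (k l i j : ℕ) : defect k l i j ∈ defects :=
  Submodule.subset_span ⟨(k, l, i, j), rfl⟩

theorem defects_induction {P : (x : dimer.Jacobi) → x ∈ defects → Prop}
    (h : ∀ k l i j, P (defect k l i j) (defect_mem k l i j)) (zero : P 0 (zero_mem _))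
    (add : ∀ x y hx hy, P x hx → P y hy → P (x + y) (add_mem hx hy))
    (smul : ∀ (c : ℂ) x hx, P x hx → P (c • x) (Submodule.smul_mem _ c hx))
    {x : dimer.Jacobi} (hx : x ∈ defects) : P x hx := by
  induction hx using Submodule.span_induction with
  | mem x hx => obtain ⟨k, rfl⟩ := hx; exact h _ _ _ _
  | zero => exact zero
  | add x y h1 h2 hx hy => exact add x y h1 h2 hx hy
  | smul c x h1 hx => exact smul c x h1 hx

theorem defect_mul_of_ne {k l i j : ℕ} {b : Arrow} (h : grid (-i) (-j) ≠ quiver.head b) :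
    defect k l i j * cl b = 0 :=
  mul_arr_eq_zero (Q := dimer) (defect_mul_vtx k l i j) h

theorem mul_defect_of_ne {k l i j : ℕ} {b : Arrow} (h : quiver.tail b ≠ grid (k + 1) (l + 1)) :
    cl b * defect k l i j = 0 :=
  arr_mul_eq_zero (Q := dimer) (vtx_mul_defect k l i j) h

theorem defects_mul_diag {x : dimer.Jacobi} (hx : x ∈ defects) (i j : ℤ) (h : (i, j) ≠ (0, 0)) :
    x * cl (diag i j h) = 0 := by
  induction hx using defects_induction with
  | h k l i' j' =>
    by_cases hij : -(i' : ℤ) = i ∧ -(j' : ℤ) = j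
    · obtain ⟨rfl, rfl⟩ := hij
      exact defect_mul_diag k l i' j' h
    · refine defect_mul_of_ne ?_
      simpa only [quiver, ne_eq, grid.injEq] using hij
  | zero => rw [zero_mul]
  | add x y _ _ hx hy => rw [add_mul, hx, hy, add_zero]
  | smul c x _ hx => rw [smul_mul_assoc, hx, smul_zero]

theorem defects_mul_A00 {x : dimer.Jacobi} (hx : x ∈ defects) : x * cl xA00 = 0 := by
  induction hx using defects_induction with
  | h k l i j =>
    by_cases hij : i = 0 ∧ j = 0
    · obtain ⟨rfl, rfl⟩ := hij
      exact defect_mul_A00 k l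
    · refine defect_mul_of_ne ?_
      simp only [quiver, ne_eq, grid.injEq]
      omega
  | zero => rw [zero_mul]
  | add x y _ _ hx hy => rw [add_mul, hx, hy, add_zero]
  | smul c x _ hx => rw [smul_mul_assoc, hx, smul_zero]

/-- An arrow `right` or `up` extends the lower path, while a diagonal or A → (0,0) gives 0; no other
arrow ends in the lower left quadrant. Together with `cl_mul_defects` this makes the span of the
defects a two-sided ideal. -/
theorem defects_mul_cl {x : dimer.Jacobi} (hx : x ∈ defects) (b : Arrow) : x * cl b ∈ defects := by
  induction hx using defects_induction with
  | h k l i j =>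
    by_cases h : quiver.head b = grid (-i) (-j)
    · revert b
      refine head_cases ?_ ?_ ?_ ?_ ?_ ?_ ?_ ?_ ?_ ?_ <;>
        try simp only [reduceCtorEq, false_imp_iff]
      · rintro _ _ ⟨⟩
        rw [defect_mul_right]
        exact defect_mem _ _ _ _
      · rintro _ _ ⟨⟩
        rw [defect_mul_up]
        exact defect_mem _ _ _ _
      · rintro _ _ h _
        rw [defects_mul_diag (defect_mem _ _ _ _)]
        exact zero_mem _
      · intro _
        rw [defects_mul_A00 (defect_mem _ _ _ _)]
        exact zero_mem _
      · simp only [grid.injEq]; omega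
      · simp only [grid.injEq]; omega
    · rw [defect_mul_of_ne (Ne.symm h)]
      exact zero_mem _
  | zero => rw [zero_mul]; exact zero_mem _
  | add x y _ _ hx hy => rw [add_mul]; exact add_mem hx hy
  | smul c x _ hx => rw [smul_mul_assoc]; exact Submodule.smul_mem _ c hx

theorem cl_mul_defects {x : dimer.Jacobi} (hx : x ∈ defects) (b : Arrow) : cl b * x ∈ defects := by
  induction hx using defects_induction with
  | h k l i j =>
    by_cases h : quiver.tail b = grid (k + 1) (l + 1)
    · revert b
      refine tail_cases ?_ ?_ ?_ ?_ ?_ ?_ ?_ ?_ ?_ ?_ <;>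
        try simp only [reduceCtorEq, false_imp_iff]
      · rintro _ _ ⟨⟩
        rw [right_mul_defect]
        exact defect_mem _ _ _ _
      · rintro _ _ ⟨⟩
        rw [up_mul_defect]
        exact defect_mem _ _ _ _
      · rintro _ _ h ⟨⟩
        have e : diag ((k : ℤ) + 1 - 1) ((l : ℤ) + 1 - 1) h = diag k l (by simpa using h) := by simp
        rw [e, diag_mul_defect]
        exact zero_mem _
      · simp only [grid.injEq]; omega
      · simp only [grid.injEq]; omega
      · simp only [grid.injEq]
        intro h
        obtain rfl : k = 0 := by omega
        obtain rfl : l = 0 := by omega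
        rw [x11B_mul_defect]
        exact zero_mem _
    · rw [mul_defect_of_ne h]
      exact zero_mem _
  | zero => rw [mul_zero]; exact zero_mem _
  | add x y _ _ hx hy => rw [mul_add]; exact add_mem hx hy
  | smul c x _ hx => rw [mul_smul_comm]; exact Submodule.smul_mem _ c hx

theorem vtx_mul_defects {x : dimer.Jacobi} (hx : x ∈ defects) (v : Vertex) :
    vtx v * x ∈ defects := by
  induction hx using defects_induction with
  | h k l i j =>
    by_cases h : v = grid (k + 1) (l + 1)
    · rw [h, vtx_mul_defect]
      exact defect_mem _ _ _ _
    · rw [← vtx_mul_defect, ← mul_assoc, idem_mul_idem_of_ne (Q := dimer) h, zero_mul]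
      exact zero_mem _
  | zero => rw [mul_zero]; exact zero_mem _
  | add x y _ _ hx hy => rw [mul_add]; exact add_mem hx hy
  | smul c x _ hx => rw [mul_smul_comm]; exact Submodule.smul_mem _ c hx

theorem kappa_mem : kappa ∈ defects := by
  have h : defect 0 0 0 0 = kappa := by
    rw [defect, upperPath, lowerPath, vtx_mul_kappa, kappa_mul_vtx]
  exact h ▸ defect_mem 0 0 0 0

/-! ### Paths of given degree -/

/-- `Walk u v c x` says that `x` is the class of a path of degree `c` with head `u` and tail `v`. -/
inductive Walk (u : Vertex) : Vertex → ℤ → dimer.Jacobi → Prop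
  | nil : Walk u u 0 (vtx u)
  | snoc {v : Vertex} {c : ℤ} {x : dimer.Jacobi} (b : Arrow) (hb : quiver.tail b = v)
      (h : Walk u (quiver.head b) (c - zdeg b) x) : Walk u v c (x * cl b)

theorem Walk.admissible {u v : Vertex} {c : ℤ} {x : dimer.Jacobi} (h : Walk u v c x) :
    Admissible v u c := by
  induction h with
  | nil => exact .refl u
  | snoc b hb _ ih =>
    have := ih.snoc b
    rwa [sub_add_cancel, hb] at this

theorem Walk.mul_vtx {u v : Vertex} {c : ℤ} {x : dimer.Jacobi} (h : Walk u v c x) :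
    x * vtx v = x := by
  cases h with
  | nil => exact idem_mul_idem (Q := dimer) u
  | snoc b hb h => rw [← hb, mul_assoc, cl_mul_vtx]

theorem Walk.mul_mem_defects {u : Vertex} {c : ℤ} {x : dimer.Jacobi} (h : Walk u v c x)
    {y : dimer.Jacobi} (hy : y ∈ defects) : x * y ∈ defects := by
  induction h generalizing y with
  | nil => exact vtx_mul_defects hy u
  | snoc b hb _ ih =>
    rw [mul_assoc]
    exact ih (cl_mul_defects hy b)

/-- Induction on the length `level u - level v + 3 * c`, splitting off the first arrow with
`Admissible.descend`. -/
theorem exists_walk {u v : Vertex} {c : ℤ} (h : Admissible v u c) : ∃ x, Walk u v c x := by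
  obtain ⟨n, hn⟩ := Int.eq_ofNat_of_zero_le h.level_nonneg
  induction n generalizing v c with
  | zero =>
    obtain ⟨rfl, rfl⟩ := h.eq_of_level hn
    exact ⟨_, .nil⟩
  | succ n ih =>
    obtain ⟨b, rfl, hb⟩ := h.descend (by omega)
    have := level_head b
    obtain ⟨x, hx⟩ := ih hb (by omega)
    exact ⟨_, .snoc b rfl hx⟩

/-- Modulo the span of the elements `defect k l i j`, a path is determined by its head, its tail
and its degree. -/
theorem Walk.sub_mem_defects {u v : Vertex} {c : ℤ} {x y : dimer.Jacobi} (hx : Walk u v c x)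
    (hy : Walk u v c y) : x - y ∈ defects := by
  obtain ⟨n, hn⟩ := Int.eq_ofNat_of_zero_le hx.admissible.level_nonneg
  induction n generalizing v c x y with
  | zero =>
    have key {w : dimer.Jacobi} (hw : Walk u v c w) : v = u ∧ w = vtx u := by
      cases hw with
      | nil => exact ⟨rfl, rfl⟩
      | snoc b hb h =>
        have h1 := h.admissible.level_nonneg
        have h2 := level_head b
        rw [hb] at h2
        omega
    rw [(key hx).2, (key hy).2, sub_self]
    exact zero_mem _
  | succ n ih =>
    have key {w : dimer.Jacobi} (hw : Walk u v c w) : ∃ b z, quiver.tail b = v ∧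
        Walk u (quiver.head b) (c - zdeg b) z ∧ w = z * cl b := by
      cases hw with
      | nil => rw [sub_self] at hn; omega
      | snoc b hb h => exact ⟨b, _, hb, h, rfl⟩
    obtain ⟨b, x', hb, hx', rfl⟩ := key hx
    obtain ⟨b', y', hb', hy', rfl⟩ := key hy
    have hconn := conn_starts hb hb' hx'.admissible hy'.admissible
    clear key
    let S (b : Arrow) : Prop := quiver.tail b = v ∧ Admissible (quiver.head b) u (c - zdeg b)
    -- The claim for first arrows b and b'. The equivalence of `S b` and `S b'` is carried along so
    -- that every intermediate arrow in a chain of steps really starts a path.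
    let D (b b' : Arrow) : Prop := (S b ↔ S b') ∧ (S b → ∀ x y,
      Walk u (quiver.head b) (c - zdeg b) x → Walk u (quiver.head b') (c - zdeg b') y →
        x * cl b - y * cl b' ∈ defects)
    have hih {b : Arrow} (hb : quiver.tail b = v) {x y : dimer.Jacobi}
        (hx : Walk u (quiver.head b) (c - zdeg b) x)
        (hy : Walk u (quiver.head b) (c - zdeg b) y) : x * cl b - y * cl b ∈ defects := by
      rw [← sub_mul]
      refine defects_mul_cl (ih hx hy ?_) b
      have := level_head b
      rw [hb] at this
      omega
    have hD : Equivalence D :=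
      { refl := fun b => ⟨Iff.rfl, fun hb x y hx hy => hih hb.1 hx hy⟩
        symm := fun {b b'} h => ⟨h.1.symm, fun hb' x y hx hy => by
          rw [← neg_sub]
          exact Submodule.neg_mem _ (h.2 (h.1.2 hb') y x hy hx)⟩
        trans := fun {b b' b''} h h' => ⟨h.1.trans h'.1, fun hb x y hx hy => by
          -- Transitivity compares both paths with an auxiliary path through the middle arrow, which
          -- exists by admissibility.
          obtain ⟨z, hz⟩ := exists_walk (h.1.1 hb).2
          rw [← sub_add_sub_cancel _ (z * cl b') _]
          exact add_mem (h.2 hb x z hx hz) (h'.2 (h.1.1 hb) z y hz hy)⟩ }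
    have hstep : ∀ b b', Step u c b b' → D b b' := by
      rintro _ _ (⟨a, h⟩ | h)
      · obtain ⟨z, hz⟩ := exists_walk h
        have e1 := zdeg_next a
        have e2 := zdeg_next' a
        have t1 : quiver.tail (next (next a)) = quiver.head a := triangulation.tail_φ_φ a
        have t2 : quiver.tail (next' (next' a)) = quiver.head a := triangulation.tail_ψ_ψ a
        have z1 : Walk u (quiver.head (next (next a))) (c - zdeg (next (next a)))
            (z * cl (next a)) := by
          refine .snoc _ (next_spec (next a)).2.1.symm ?_
          rw [(next_spec a).2.1]
          convert hz using 1
          omega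
        have z2 : Walk u (quiver.head (next' (next' a))) (c - zdeg (next' (next' a)))
            (z * cl (next' a)) := by
          refine .snoc _ (next'_spec (next' a)).2.1.symm ?_
          rw [(next'_spec a).2.1]
          convert hz using 1
          omega
        refine ⟨⟨fun h => ⟨?_, z2.admissible⟩, fun h => ⟨?_, z1.admissible⟩⟩,
          fun h x y hx hy => ?_⟩
        · rw [t2, ← t1, h.1]
        · rw [t1, ← t2, h.1]
        · have h1 := hih h.1 hx z1
          have h2 := hih (by rw [t2, ← t1, h.1]) hy z2
          have := Submodule.sub_mem _ h1 h2
          rw [mul_assoc, mul_assoc, cl_relation] at this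
          simpa using this
      · obtain ⟨z, hz⟩ := exists_walk h
        have z1 : Walk u (grid 0 1) (c - 0) (z * cl (right 0 1)) :=
          .snoc (right 0 1) rfl (by simpa [quiver, zdeg] using hz)
        have z2 : Walk u (grid 1 0) (c - 0) (z * cl (up 1 0)) :=
          .snoc (up 1 0) rfl (by simpa [quiver, zdeg] using hz)
        refine ⟨⟨fun h => ⟨h.1, z2.admissible⟩, fun h => ⟨h.1, z1.admissible⟩⟩,
          fun h x y hx hy => ?_⟩
        have h1 := hih h.1 hx z1
        have h2 := hih (b := right 0 0) h.1 hy z2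
        -- Crossing the central square costs z·κ, which is a combination of defects. This is the
        -- only step at which the two paths are not equal modulo the induction hypothesis.
        have h3 := hz.mul_mem_defects kappa_mem
        have := Submodule.sub_mem _ (Submodule.sub_mem _ h1 h2) h3
        rw [kappa, mul_sub, ← mul_assoc, ← mul_assoc] at this
        convert this using 1
        abel
    have hbb' : D b b' := by
      clear hx hx' hy hy' hb hb'
      induction hconn with
      | rel _ _ h => exact hstep _ _ h
      | refl _ => exact hD.refl _
      | symm _ _ _ ih => exact hD.symm ih
      | trans _ _ _ _ _ ih ih' => exact hD.trans ih ih'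
    exact hbb'.2 ⟨hb, hx'.admissible⟩ x' y' hx' hy'

/-! ### The masses of an element -/

/-- The degree of a path. -/
def degree (p : dimer.Path) : ℤ := (p.arrows.map zdeg).sum

theorem degree_snoc (p : dimer.Path) (b : Arrow) (h : p.tail = dimer.head b) :
    degree (p.comp (Path.ofArrow b) h) = degree p + zdeg b := by
  have aux (l : List Arrow) : ((l ++ [b]).map zdeg).sum = (l.map zdeg).sum + zdeg b := by simp
  exact aux p.arrows

open Classical in
-- Each triangle contains exactly one arrow of degree 1, so the two sides of rₐ both have degree `1
-- - zdeg a`.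
theorem invariant_mass (v : Vertex) : triangulation.Invariant fun p : dimer.Path =>
    if p.tail = v then (Finsupp.single (p.head, degree p) 1 : Vertex × ℤ →₀ ℂ) else 0 := by
  intro a u w l m h h'
  have e : degree ⟨u, w, _, h⟩ = degree ⟨u, w, _, h'⟩ := by
    have aux (l m : List Arrow) : (List.map zdeg (l ++ [next a, next (next a)] ++ m)).sum =
        (List.map zdeg (l ++ [next' a, next' (next' a)] ++ m)).sum := by
      have e1 := zdeg_next a
      have e2 := zdeg_next' a
      simp only [List.map_append, List.map_cons, List.map_nil, List.sum_append, List.sum_cons,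
        List.sum_nil]
      omega
    exact aux l m
  simp only [e]

/-- The coefficient of `mass v x` at `(u, c)` is the sum of the coefficients in `x` of the paths of
degree `c` with tail `v` and head `u`. -/
def mass (v : Vertex) : dimer.Jacobi →ₗ[ℂ] (Vertex × ℤ →₀ ℂ) :=
  triangulation.lift _ (invariant_mass v)

open Classical in
theorem mass_cls (v : Vertex) (p : dimer.Path) : mass v (cls p) =
    if p.tail = v then Finsupp.single (p.head, degree p) 1 else 0 :=
  triangulation.lift_cls _ _ _

/-- No mass is lost under right multiplication by an arrow, so the masses of x can be recovered from
those of x·b. This is how cancellation survives modulo defects. -/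
theorem mass_mul_cl (b : Arrow) (x : dimer.Jacobi) (u : Vertex) (c : ℤ) :
    mass (quiver.tail b) (x * cl b) (u, c) = mass (quiver.head b) x (u, c - zdeg b) := by
  induction x using jacobi_induction with
  | path p =>
    by_cases h : p.tail = quiver.head b
    · have h1 := (mass_cls (quiver.tail b) (p.comp (Path.ofArrow b) h)).trans (if_pos rfl)
      have h2 := (mass_cls (quiver.head b) p).trans (if_pos h)
      rw [degree_snoc p b h] at h1
      rw [cls_mul_arr p b h, h1, h2]
      classical
      refine (Finsupp.single_apply ..).trans (Eq.trans ?_ (Finsupp.single_apply ..).symm)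
      refine if_congr ?_ rfl rfl
      exact ⟨fun e => Prod.ext (congrArg Prod.fst e :) (eq_sub_of_add_eq (congrArg Prod.snd e :)),
        fun e => Prod.ext (congrArg Prod.fst e :) (add_eq_of_eq_sub (congrArg Prod.snd e :))⟩
    · rw [cls_mul_arr_of_ne p h, (mass_cls (quiver.head b) p).trans (if_neg h), map_zero]
      rfl
  | zero => rw [zero_mul, map_zero, map_zero]; rfl
  | add x y hx hy => rw [add_mul, map_add, map_add, Finsupp.add_apply, Finsupp.add_apply, hx, hy]
  | smul c x hx =>
    rw [smul_mul_assoc, map_smul, map_smul, Finsupp.smul_apply, Finsupp.smul_apply, hx]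

theorem walk_cls (p : dimer.Path) : Walk p.head p.tail (degree p) (cls p) := by
  induction p using Path.snoc_induction with
  | triv v => exact .nil
  | snoc p b h ih =>
    rw [← cls_mul_arr, degree_snoc p b h]
    refine .snoc b rfl ?_
    have h' : p.tail = quiver.head b := h
    rwa [add_sub_cancel_right, ← h']

theorem mass_eq_zero {v u : Vertex} {c : ℤ} (h : ¬ Admissible v u c) (x : dimer.Jacobi) :
    mass v x (u, c) = 0 := by
  induction x using jacobi_induction with
  | path p =>
    rw [mass_cls]
    split_ifs with h'
    · refine Finsupp.single_eq_of_ne fun e => h ?_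
      obtain ⟨rfl, rfl⟩ := Prod.mk.inj e
      subst h'
      exact (walk_cls p).admissible
    · rfl
  | zero => rw [map_zero]; rfl
  | add x y hx hy => rw [map_add, Finsupp.add_apply, hx, hy, add_zero]
  | smul c x hx => rw [map_smul, Finsupp.smul_apply, hx, smul_zero]

theorem Walk.mass_eq {u v : Vertex} {c : ℤ} {x : dimer.Jacobi} (h : Walk u v c x) :
    mass v x = Finsupp.single (u, c) 1 := by
  induction h with
  | nil => exact (mass_cls u (Path.triv u)).trans (if_pos rfl)
  | snoc b hb h ih =>
    subst hb
    ext ⟨w, d⟩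
    rw [mass_mul_cl, ih]
    classical
    simp [Finsupp.single_apply]

open Classical in
/-- The combination of paths with tail `v` with given masses. -/
def ofMass (v : Vertex) : (Vertex × ℤ →₀ ℂ) →ₗ[ℂ] dimer.Jacobi :=
  Finsupp.linearCombination ℂ fun k : Vertex × ℤ =>
    if h : ∃ x, Walk k.1 v k.2 x then h.choose else 0

theorem ofMass_mul_vtx (v : Vertex) (g : Vertex × ℤ →₀ ℂ) : ofMass v g * vtx v = ofMass v g := by
  induction g using Finsupp.induction_linear with
  | zero => rw [map_zero, zero_mul]
  | add f g hf hg => rw [map_add, add_mul, hf, hg]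
  | single k r =>
    rw [ofMass, Finsupp.linearCombination_single, smul_mul_assoc]
    split_ifs with h
    · rw [h.choose_spec.mul_vtx]
    · rw [zero_mul]

theorem mass_ofMass {v : Vertex} {g : Vertex × ℤ →₀ ℂ}
    (hg : ∀ u c, g (u, c) ≠ 0 → Admissible v u c) : mass v (ofMass v g) = g := by
  rw [ofMass, Finsupp.linearCombination_apply, Finsupp.sum, map_sum]
  conv_rhs => rw [← Finsupp.sum_single g]
  refine Finset.sum_congr rfl fun k hk => ?_
  obtain ⟨u, c⟩ := k
  have h := exists_walk (hg u c (Finsupp.mem_support_iff.1 hk))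
  rw [dif_pos h, map_smul, h.choose_spec.mass_eq]
  simp

theorem Walk.sub_ofMass_mem {u v : Vertex} {c : ℤ} {x : dimer.Jacobi} (hx : Walk u v c x)
    {g : Vertex × ℤ →₀ ℂ} (hg : g = Finsupp.single (u, c) 1) : x * vtx v - ofMass v g ∈ defects := by
  have h : ∃ x, Walk u v c x := ⟨x, hx⟩
  rw [hg, ofMass, Finsupp.linearCombination_single, dif_pos h, one_smul, hx.mul_vtx]
  exact hx.sub_mem_defects h.choose_spec

theorem mul_vtx_sub_ofMass_mem (v : Vertex) (x : dimer.Jacobi) :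
    x * vtx v - ofMass v (mass v x) ∈ defects := by
  induction x using jacobi_induction with
  | path p =>
    by_cases h : p.tail = v
    · subst h
      exact (walk_cls p).sub_ofMass_mem ((mass_cls p.tail p).trans (if_pos rfl))
    · have h1 : mass v (cls p) = 0 := (mass_cls v p).trans (if_neg h)
      have h2 : cls p * vtx v = 0 := cls_mul_idem_of_ne p h
      rw [h1, h2, map_zero, sub_self]
      exact zero_mem _
  | zero => rw [zero_mul, map_zero, map_zero, sub_self]; exact zero_mem _
  | add x y hx hy =>
    rw [add_mul, map_add, map_add, add_sub_add_comm]
    exact add_mem hx hy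
  | smul c x hx =>
    rw [smul_mul_assoc, map_smul, map_smul, ← smul_sub]
    exact Submodule.smul_mem _ c hx

/-- An element without masses is a combination of the elements `defect k l i j`. -/
theorem mem_defects_of_mass_eq_zero {v : Vertex} {x : dimer.Jacobi} (hx : x * vtx v = x)
    (h : mass v x = 0) : x ∈ defects := by
  have := mul_vtx_sub_ofMass_mem v x
  rwa [h, map_zero, sub_zero, hx] at this

/-! ### Counting paths above the central square -/

/-- The arrows `right` and `up`. -/
def IsMonotone : Arrow → Prop
  | right _ _ => True
  | up _ _ => True
  | _ => False

/-- The arrows `right` directly above the central square. -/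
def IsTop : Arrow → Prop
  | right i j => i = 0 ∧ 1 ≤ j
  | _ => False

/-- A path of arrows `right` and `up` passing above the central square. -/
def IsAbove (l : List Arrow) : Prop := (∀ a ∈ l, IsMonotone a) ∧ ∃ a ∈ l, IsTop a

theorem isAbove_iff (l m : List Arrow) (a b : Arrow) : IsAbove (l ++ [a, b] ++ m) ↔
    (IsMonotone a ∧ IsMonotone b) ∧ ((IsTop a ∨ IsTop b) ∨ ∃ d ∈ l ++ m, IsTop d) ∧
      ∀ d ∈ l ++ m, IsMonotone d := by
  simp only [IsAbove, List.mem_append, List.mem_cons, List.not_mem_nil, or_false]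
  grind

theorem isMonotone_next_iff (a : Arrow) :
    IsMonotone (next a) ∧ IsMonotone (next (next a)) ↔ ∃ i j h, a = diag i j h := by
  induction a using pos_cases with
  | hdiag i j h =>
    rw [next, next_up h]
    exact iff_of_true ⟨trivial, trivial⟩ ⟨i, j, h, rfl⟩
  | hup i j h => simp [next_up h, next_right h, IsMonotone]
  | hright i j h => simp [next_right h, IsMonotone]
  | _ => simp [next, IsMonotone]

theorem isMonotone_next'_iff (a : Arrow) :
    IsMonotone (next' a) ∧ IsMonotone (next' (next' a)) ↔ ∃ i j h, a = diag i j h := by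
  induction a using neg_cases with
  | hdiag i j h =>
    rw [next', next'_right h]
    exact iff_of_true ⟨trivial, trivial⟩ ⟨i, j, h, rfl⟩
  | hup i j h => simp [next'_up h, IsMonotone]
  | hright i j h => simp [next'_right h, next'_up h, IsMonotone]
  | _ => simp [next', IsMonotone]

/-- In the square at (i,j) the two horizontal sides lie at heights j and j + 1. They fall on
different sides of the condition 1 ≤ height in column 0 only for i = j = 0, and the central square
has no such relation. -/
theorem isTop_next_iff (a : Arrow) (h : ∃ i j h, a = diag i j h) :
    IsTop (next a) ∨ IsTop (next (next a)) ↔ IsTop (next' a) ∨ IsTop (next' (next' a)) := by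
  obtain ⟨i, j, h, rfl⟩ := h
  rw [next, next_up h, next', next'_right h]
  simp only [IsTop, false_or, or_false]
  simp only [ne_eq, Prod.mk.injEq] at h
  omega

theorem isAbove_next_iff (a : Arrow) (l m : List Arrow) :
    IsAbove (l ++ [next a, next (next a)] ++ m) ↔
      IsAbove (l ++ [next' a, next' (next' a)] ++ m) := by
  rw [isAbove_iff, isAbove_iff, isMonotone_next_iff, isMonotone_next'_iff]
  exact and_congr_right fun h => by rw [isTop_next_iff a h]

open Classical in
theorem invariant_top (u v : Vertex) : triangulation.Invariant fun p : dimer.Path =>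
    if p.head = u ∧ p.tail = v ∧ IsAbove p.arrows then (1 : ℂ) else 0 := by
  intro a u' v' l m h h'
  have e := isAbove_next_iff a l m
  exact if_congr (and_congr_right' (and_congr_right' e)) rfl rfl

/-- The number of paths in an element with head `u` and tail `v` that pass above the central
square. -/
def top (u v : Vertex) : dimer.Jacobi →ₗ[ℂ] ℂ := triangulation.lift _ (invariant_top u v)

open Classical in
theorem top_cls (u v : Vertex) (p : dimer.Path) : top u v (cls p) =
    if p.head = u ∧ p.tail = v ∧ IsAbove p.arrows then 1 else 0 :=
  triangulation.lift_cls _ _ _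

/-- The arrows `right` and `up` except those directly above the central square. -/
def IsLow (a : Arrow) : Prop := IsMonotone a ∧ ¬ IsTop a

theorem exists_path_lowerPath (i j : ℕ) : ∃ p : dimer.Path, cls p = lowerPath i j ∧
    p.head = grid 0 0 ∧ p.tail = grid (-i) (-j) ∧ ∀ a ∈ p.arrows, IsLow a := by
  have key (p : dimer.Path) (b : Arrow) {v w : Vertex} (hv : p.tail = v)
      (hb : quiver.head b = v) (hw : quiver.tail b = w) (hp : ∀ a ∈ p.arrows, IsLow a)
      (h : IsLow b) : ∃ q : dimer.Path, cls q = cls p * cl b ∧ q.head = p.head ∧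
        q.tail = w ∧ ∀ a ∈ q.arrows, IsLow a := by
    refine ⟨p.comp (Path.ofArrow b) (hv.trans hb.symm), (cls_mul_arr p b _).symm, rfl, hw, ?_⟩
    intro a ha
    obtain ha | ha := List.mem_append.1 ha
    · exact hp a ha
    · exact List.eq_of_mem_singleton ha ▸ h
  induction i with
  | zero =>
    induction j with
    | zero => exact ⟨Path.triv (Q := dimer.toArrowQuiver) (grid 0 0), by rw [lowerPath]; rfl, rfl,
        congrArg₂ grid (by simp) (by simp), fun a ha => absurd ha List.not_mem_nil⟩
    | succ j ih =>
      obtain ⟨p, hp, h1, h2, h3⟩ := ih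
      obtain ⟨q, h4, h5, h6⟩ := key p (up 0 (-j - 1)) h2 (by simp [quiver]) rfl h3
        (by simp [IsLow, IsMonotone, IsTop])
      refine ⟨q, ?_, h5.trans h1, h6.1.trans (congrArg₂ grid ?_ ?_), h6.2⟩
      · rw [h4, hp, lowerPath]
      · simp
      · push_cast; ring
  | succ i ih =>
    obtain ⟨p, hp, h1, h2, h3⟩ := ih
    obtain ⟨q, h4, h5, h6⟩ := key p (right (-i - 1) (-j)) h2 (by simp [quiver]) rfl h3
      ⟨trivial, by simp only [IsTop]; omega⟩
    refine ⟨q, ?_, h5.trans h1, h6.1.trans (congrArg₂ grid ?_ rfl), h6.2⟩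
    · rw [h4, hp, lowerPath]
    · push_cast; ring

theorem exists_path_upperPath (k l : ℕ) : ∃ p : dimer.Path, cls p = upperPath k l ∧
    p.head = grid (k + 1) (l + 1) ∧ p.tail = grid 1 1 ∧ ∀ a ∈ p.arrows, IsLow a := by
  have key (p : dimer.Path) (b : Arrow) {v w : Vertex} (hv : p.head = v)
      (hb : quiver.tail b = v) (hw : quiver.head b = w) (hp : ∀ a ∈ p.arrows, IsLow a)
      (h : IsLow b) : ∃ q : dimer.Path, cls q = cl b * cls p ∧ q.head = w ∧
        q.tail = p.tail ∧ ∀ a ∈ q.arrows, IsLow a := by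
    refine ⟨(Path.ofArrow (Q := dimer.toArrowQuiver) b).comp p (hb.trans hv.symm),
      (arr_mul_cls p b _).symm, hw, rfl, ?_⟩
    intro a ha
    obtain ha | ha := List.mem_append.1 ha
    · exact List.eq_of_mem_singleton ha ▸ h
    · exact hp a ha
  induction k with
  | zero =>
    induction l with
    | zero => exact ⟨Path.triv (Q := dimer.toArrowQuiver) (grid 1 1), by rw [upperPath]; rfl,
        congrArg₂ grid (by simp) (by simp), rfl, fun a ha => absurd ha List.not_mem_nil⟩
    | succ l ih =>
      obtain ⟨p, hp, h1, h2, h3⟩ := ih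
      obtain ⟨q, h4, h5, h6⟩ := key p (up 1 (l + 1)) h1 (by simp [quiver]) rfl h3
        (by simp [IsLow, IsMonotone, IsTop])
      refine ⟨q, ?_, h5.trans (congrArg₂ grid ?_ ?_), h6.1.trans h2, h6.2⟩
      · rw [h4, hp, upperPath]
      · simp
      · push_cast; ring
  | succ k ih =>
    obtain ⟨p, hp, h1, h2, h3⟩ := ih
    obtain ⟨q, h4, h5, h6⟩ := key p (right (k + 1) (l + 1)) h1 rfl rfl h3
      ⟨trivial, by simp only [IsTop]; omega⟩
    refine ⟨q, ?_, h5.trans (congrArg₂ grid ?_ rfl), h6.1.trans h2, h6.2⟩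
    · rw [h4, hp, upperPath]
    · push_cast; ring

theorem isAbove_append_append {l m n : List Arrow} (hl : ∀ a ∈ l, IsLow a)
    (hm : ∀ a ∈ m, IsMonotone a) (hn : ∀ a ∈ n, IsLow a) :
    IsAbove (l ++ m ++ n) ↔ ∃ a ∈ m, IsTop a := by
  simp only [IsAbove, List.mem_append]
  constructor
  · rintro ⟨_, a, (ha | ha) | ha, h⟩
    · exact absurd h (hl a ha).2
    · exact ⟨a, ha, h⟩
    · exact absurd h (hn a ha).2
  · rintro ⟨a, ha, h⟩
    refine ⟨?_, a, .inl (.inr ha), h⟩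
    rintro b ((hb | hb) | hb)
    · exact (hl b hb).1
    · exact hm b hb
    · exact (hn b hb).1

open Classical in
theorem top_upperPath_mul_mul_lowerPath (u v : Vertex) (k l i j : ℕ) (m : dimer.Path)
    (hm : m.head = grid 1 1) (hm' : m.tail = grid 0 0)
    (h : ∀ a ∈ m.arrows, IsMonotone a) : top u v (upperPath k l * cls m * lowerPath i j) =
      if u = grid (k + 1) (l + 1) ∧ v = grid (-i) (-j) ∧ ∃ a ∈ m.arrows, IsTop a then 1 else 0 := by
  obtain ⟨p, hp, h1, h2, h3⟩ := exists_path_upperPath k l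
  obtain ⟨r, hr, h4, h5, h6⟩ := exists_path_lowerPath i j
  have e : upperPath k l * cls m * lowerPath i j =
      cls ((p.comp m (h2.trans hm.symm)).comp r (hm'.trans h4.symm)) := by
    rw [← hp, ← hr, cls_mul_cls p m (h2.trans hm.symm)]
    exact cls_mul_cls (p.comp m (h2.trans hm.symm)) r (hm'.trans h4.symm)
  refine (congrArg _ e).trans ((top_cls u v _).trans (if_congr ?_ rfl rfl))
  refine and_congr ?_ (and_congr ?_ (isAbove_append_append h3 h h6))
  · exact h1 ▸ eq_comm
  · exact h5 ▸ eq_comm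

/-- The path around the central square through `(1,0)`. -/
def lowerCorner : dimer.Path :=
  ⟨grid 1 1, grid 0 0, ([up 1 0, right 0 0] : List Arrow), rfl, rfl, rfl⟩

/-- The path around the central square through `(0,1)`. -/
def upperCorner : dimer.Path :=
  ⟨grid 1 1, grid 0 0, ([right 0 1, up 0 0] : List Arrow), rfl, rfl, rfl⟩

theorem kappa_eq : kappa = cls lowerCorner - cls upperCorner :=
  congrArg₂ (· - ·) (cls_mul_cls (Q := dimer) (Path.ofArrow (Q := dimer.toArrowQuiver) (up 1 0))
    (Path.ofArrow (Q := dimer.toArrowQuiver) (right 0 0)) rfl)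
    (cls_mul_cls (Q := dimer) (Path.ofArrow (Q := dimer.toArrowQuiver) (right 0 1))
    (Path.ofArrow (Q := dimer.toArrowQuiver) (up 0 0)) rfl)

theorem isMonotone_lowerCorner : ∀ a ∈ lowerCorner.arrows, IsMonotone a := by
  change ∀ a ∈ [up 1 0, right 0 0], IsMonotone a
  simp [IsMonotone]

theorem isMonotone_upperCorner : ∀ a ∈ upperCorner.arrows, IsMonotone a := by
  change ∀ a ∈ [right 0 1, up 0 0], IsMonotone a
  simp [IsMonotone]

theorem not_exists_isTop_lowerCorner : ¬ ∃ a ∈ lowerCorner.arrows, IsTop a := by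
  change ¬ ∃ a ∈ [up 1 0, right 0 0], IsTop a
  simp [IsTop]

theorem exists_isTop_upperCorner : ∃ a ∈ upperCorner.arrows, IsTop a := by
  change ∃ a ∈ [right 0 1, up 0 0], IsTop a
  simp [IsTop]

open Classical in
-- Of the two monotone paths in a defect only the subtracted one passes above the central square,
-- and the extending paths contain no arrow directly above it.
theorem top_defect (u v : Vertex) (k l i j : ℕ) : top u v (defect k l i j) =
    if u = grid (k + 1) (l + 1) ∧ v = grid (-i) (-j) then -1 else 0 := by
  rw [defect, kappa_eq, mul_sub, sub_mul, map_sub,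
    top_upperPath_mul_mul_lowerPath u v k l i j lowerCorner rfl rfl isMonotone_lowerCorner,
    top_upperPath_mul_mul_lowerPath u v k l i j upperCorner rfl rfl isMonotone_upperCorner,
    if_neg fun h => not_exists_isTop_lowerCorner h.2.2]
  simp only [exists_isTop_upperCorner, and_true]
  split_ifs <;> simp

theorem top_eq_zero {x : dimer.Jacobi} (hx : x ∈ defects) (u : Vertex) {v : Vertex}
    (h : ∀ i j, v = grid i j → ¬ (i ≤ 0 ∧ j ≤ 0)) : top u v x = 0 := by
  induction hx using defects_induction with
  | h k l i j =>
    classical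
    rw [top_defect, if_neg]
    exact fun h' => h _ _ h'.2 (by omega)
  | zero => rw [map_zero]
  | add x y _ _ hx hy => rw [map_add, hx, hy, add_zero]
  | smul c x _ hx => rw [map_smul, hx, smul_zero]

theorem top_mul_right {x : dimer.Jacobi} (hx : x ∈ defects) (u : Vertex) (i j : ℤ) (h : i ≤ 0) :
    top u (grid (i - 1) j) (x * cl (right (i - 1) j)) = top u (grid i j) x := by
  induction hx using defects_induction with
  | h k l i' j' =>
    by_cases hij : -(i' : ℤ) = i ∧ -(j' : ℤ) = j
    · obtain ⟨rfl, rfl⟩ := hij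
      classical
      rw [defect_mul_right, top_defect, top_defect]
      refine if_congr (and_congr_right fun _ => iff_of_true ?_ rfl) rfl rfl
      exact congrArg₂ grid (by push_cast; ring) rfl
    · classical
      rw [defect_mul_of_ne, map_zero, top_defect, if_neg]
      · rintro ⟨-, h⟩
        obtain ⟨h1, h2⟩ := grid.inj h
        omega
      · refine fun h => hij ?_
        obtain ⟨h1, h2⟩ := grid.inj h
        omega
  | zero => rw [zero_mul, map_zero, map_zero]
  | add x y _ _ hx hy => rw [add_mul, map_add, map_add, hx, hy]
  | smul c x _ hx => rw [smul_mul_assoc, map_smul, map_smul, hx]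

theorem top_mul_up {x : dimer.Jacobi} (hx : x ∈ defects) (u : Vertex) (i j : ℤ) (h : j ≤ 0) :
    top u (grid i (j - 1)) (x * cl (up i (j - 1))) = top u (grid i j) x := by
  induction hx using defects_induction with
  | h k l i' j' =>
    by_cases hij : -(i' : ℤ) = i ∧ -(j' : ℤ) = j
    · obtain ⟨rfl, rfl⟩ := hij
      classical
      rw [defect_mul_up, top_defect, top_defect]
      refine if_congr (and_congr_right fun _ => iff_of_true ?_ rfl) rfl rfl
      exact congrArg₂ grid rfl (by push_cast; ring)
    · classical
      rw [defect_mul_of_ne, map_zero, top_defect, if_neg]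
      · rintro ⟨-, h⟩
        obtain ⟨h1, h2⟩ := grid.inj h
        omega
      · refine fun h => hij ?_
        obtain ⟨h1, h2⟩ := grid.inj h
        omega
  | zero => rw [zero_mul, map_zero, map_zero]
  | add x y _ _ hx hy => rw [add_mul, map_add, map_add, hx, hy]
  | smul c x _ hx => rw [smul_mul_assoc, map_smul, map_smul, hx]

theorem top_mul_vtx_of_ne {v w : Vertex} (h : v ≠ w) {x : dimer.Jacobi} (hx : x * vtx v = x)
    (u : Vertex) : top u w x = 0 := by
  have key (x : dimer.Jacobi) : top u w (x * vtx v) = 0 := by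
    induction x using jacobi_induction with
    | path p =>
      by_cases hp : p.tail = v
      · have h1 : cls p * vtx v = cls p := hp ▸ cls_mul_idem p
        rw [h1, top_cls, if_neg]
        exact fun h' => h (hp.symm.trans h'.2.1)
      · have h1 : cls p * vtx v = 0 := cls_mul_idem_of_ne p hp
        rw [h1, map_zero]
    | zero => rw [zero_mul, map_zero]
    | add x y hx hy => rw [add_mul, map_add, hx, hy, add_zero]
    | smul c x hx => rw [smul_mul_assoc, map_smul, hx, smul_zero]
  exact hx ▸ key x

/-- Different defects have different pairs of endpoints, so `top` at one pair isolates one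
coefficient. In particular the defects are linearly independent. -/
theorem eq_zero_of_top {x : dimer.Jacobi} (hx : x ∈ defects) (h : ∀ u v, top u v x = 0) :
    x = 0 := by
  obtain ⟨f, rfl⟩ := (Finsupp.mem_span_range_iff_exists_finsupp).1 hx
  have hf : f = 0 := by
    ext ⟨k, l, i, j⟩
    have := h (grid (k + 1) (l + 1)) (grid (-i) (-j))
    classical
    rw [map_finsuppSum, Finsupp.sum, Finset.sum_eq_single (k, l, i, j)] at this
    · rw [map_smul, top_defect, if_pos ⟨rfl, rfl⟩] at this
      simpa using this
    · rintro ⟨k', l', i', j'⟩ _ hne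
      rw [map_smul, top_defect, if_neg, smul_zero]
      intro h
      simp only [grid.injEq] at h
      exact hne (by simp only [Prod.mk.injEq]; omega)
    · intro h
      rw [Finsupp.notMem_support_iff.1 h, zero_smul, map_zero]
  rw [hf, Finsupp.sum_zero_index]

theorem eq_of_top {v : Vertex} {x y : dimer.Jacobi} (hx : x ∈ defects) (hy : y ∈ defects)
    (hx' : x * vtx v = x) (hy' : y * vtx v = y) (h : ∀ u, top u v x = top u v y) : x = y := by
  refine sub_eq_zero.1 (eq_zero_of_top (Submodule.sub_mem _ hx hy) fun u w => ?_)
  by_cases hw : v = w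
  · subst hw
    rw [map_sub, h, sub_self]
  · rw [map_sub, top_mul_vtx_of_ne hw hx', top_mul_vtx_of_ne hw hy', sub_self]

/-! ### Injectivity -/

theorem exists_head (v : Vertex) : ∃ a, quiver.head a = v := by
  cases v with
  | grid i j => exact ⟨right (i - 1) j, by simp [quiver]⟩
  | A => exact ⟨x01A, rfl⟩
  | B => exact ⟨xAB, rfl⟩

/-- Multiplication by a single arrow already forces all masses to vanish, so q consists of defects.
For v in a column i ≤ 0 the arrow `right` into v preserves `top`; for other v no nonzero defect
starts at v. -/
theorem locallyInjective : triangulation.LocallyInjective := by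
  intro v q hq h
  have hmass : mass v q = 0 := by
    obtain ⟨a, ha⟩ := exists_head v
    ext ⟨u, c⟩
    have h1 := mass_mul_cl a q u (c + zdeg a)
    have h2 : q * cl a = 0 := h a ha
    rw [h2, add_sub_cancel_right, ha, map_zero] at h1
    exact h1.symm
  have hmem := mem_defects_of_mass_eq_zero hq hmass
  refine eq_of_top hmem (zero_mem _) hq (zero_mul _) fun u => ?_
  rw [map_zero]
  by_cases hv : ∃ i j, v = grid i j ∧ i ≤ 0
  · obtain ⟨i, j, rfl, hi⟩ := hv
    have h1 := top_mul_right hmem u i j hi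
    have h2 : q * cl (right (i - 1) j) = 0 := h _ (by simp [dimer, quiver])
    rw [← h1, h2, map_zero]
  · refine top_eq_zero hmem u ?_
    rintro i j rfl h
    exact hv ⟨i, j, rfl, h.1⟩

/-! ### Failure of cancellation -/

/-- The two paths around the central square agree after right multiplication by A → (0,0), but `top`
tells them apart. -/
theorem not_isCancellation : ¬ dimer.IsCancellation := by
  intro h
  have h1 : cls lowerCorner * cl xA00 = cls upperCorner * cl xA00 := by
    have := kappa_mul_A00
    rwa [kappa_eq, sub_mul, sub_eq_zero] at this
  have h2 := congrArg (top (grid 1 1) (grid 0 0)) ((h xA00).1 _ _ rfl rfl h1)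
  rw [top_cls, top_cls, if_neg fun h => not_exists_isTop_lowerCorner h.2.2.2,
    if_pos ⟨rfl, rfl, isMonotone_upperCorner, exists_isTop_upperCorner⟩] at h2
  exact zero_ne_one h2

/-! ### Exactness -/

/-- A function on the arrows with head `v` is constant if its values on neighbouring arrows agree. -/
theorem eq_of_forall_next {α : Type*} {v : Vertex} {f : Arrow → α}
    (h : ∀ b, quiver.tail b = v → f (next b) = f (next' b)) {a a' : Arrow}
    (ha : quiver.head a = v) (ha' : quiver.head a' = v) : f a = f a' := by
  suffices ∃ z, ∀ a, quiver.head a = v → f a = z by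
    obtain ⟨z, hz⟩ := this
    rw [hz a ha, hz a' ha']
  cases v with
  | A =>
    refine ⟨f x10A, head_cases ?_ ?_ ?_ ?_ ?_ ?_ ?_ ?_ ?_ ?_⟩ <;> intros <;>
      first | contradiction | exact h xAB rfl | rfl
  | B =>
    refine ⟨f x11B, head_cases ?_ ?_ ?_ ?_ ?_ ?_ ?_ ?_ ?_ ?_⟩ <;> intros <;>
      first | contradiction | exact h xB01 rfl | rfl
  | grid i j =>
    -- Around v, an outgoing arrow b lies between the incoming arrows `next b` and `next' b`. Going
    -- around v with the outgoing arrows links all the incoming ones.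
    have hu := h (up i j) rfl
    have hr := h (right i j) rfl
    by_cases h00 : (i, j) = (0, 0)
    · obtain ⟨rfl, rfl⟩ := Prod.mk.inj h00
      have hu : f (right (0 - 1) 0) = f xA00 := hu
      have hr : f xA00 = f (up 0 (0 - 1)) := hr
      refine ⟨f xA00, head_cases ?_ ?_ ?_ ?_ ?_ ?_ ?_ ?_ ?_ ?_⟩
      · rintro _ _ ⟨⟩; exact hu
      · rintro _ _ ⟨⟩; exact hr.symm
      · rintro _ _ h ⟨⟩; exact absurd rfl h
      all_goals intro h; first | exact rfl | simp at h
    by_cases h10 : (i, j) = (1, 0)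
    · obtain ⟨rfl, rfl⟩ := Prod.mk.inj h10
      have hu : f xB10 = f (diag 1 0 h00) := hu
      have hr : f (diag 1 0 h00) = f (up 1 (0 - 1)) := hr
      have hx : f (right (1 - 1) 0) = f xB10 := h x10A rfl
      refine ⟨f xB10, head_cases ?_ ?_ ?_ ?_ ?_ ?_ ?_ ?_ ?_ ?_⟩
      · rintro _ _ ⟨⟩; exact hx
      · rintro _ _ ⟨⟩; exact (hu.trans hr).symm
      · rintro _ _ h ⟨⟩; exact hu.symm
      all_goals intro h; first | exact rfl | simp at h
    by_cases h01 : (i, j) = (0, 1)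
    · obtain ⟨rfl, rfl⟩ := Prod.mk.inj h01
      have hu : f (right (0 - 1) 1) = f (diag 0 1 h00) := hu
      have hr : f (diag 0 1 h00) = f xB01 := hr
      have hx : f xB01 = f (up 0 (1 - 1)) := h x01A rfl
      refine ⟨f xB01, head_cases ?_ ?_ ?_ ?_ ?_ ?_ ?_ ?_ ?_ ?_⟩
      · rintro _ _ ⟨⟩; exact hu.trans hr
      · rintro _ _ ⟨⟩; exact hx.symm
      · rintro _ _ h ⟨⟩; exact hr
      all_goals intro h; first | exact rfl | simp at h
    have h10' : (i - 1, j) ≠ (0, 0) := by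
      simp only [ne_eq, Prod.mk.injEq] at h10 ⊢
      omega
    have h01' : (i, j - 1) ≠ (0, 0) := by
      simp only [ne_eq, Prod.mk.injEq] at h01 ⊢
      omega
    rw [next, if_pos h10', next'_up h00] at hu
    rw [next', if_pos h01', next_right h00] at hr
    refine ⟨f (diag i j h00), head_cases ?_ ?_ ?_ ?_ ?_ ?_ ?_ ?_ ?_ ?_⟩
    · rintro _ _ ⟨⟩; exact hu
    · rintro _ _ ⟨⟩; exact hr.symm
    · rintro _ _ h ⟨⟩; rfl
    · rintro ⟨⟩
    · rintro ⟨⟩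
    · rintro ⟨⟩
    · rintro ⟨⟩
    · rintro ⟨⟩; exact absurd rfl h00
    · rintro ⟨⟩; exact absurd rfl h01
    · rintro ⟨⟩; exact absurd rfl h10

/-! ### Paths of degree zero and paths above the central square. -/

theorem isAbove_snoc (l : List Arrow) (b : Arrow) : IsAbove (l ++ [b]) ↔
    IsMonotone b ∧ (∀ a ∈ l, IsMonotone a) ∧ (IsTop b ∨ ∃ a ∈ l, IsTop a) := by
  simp only [IsAbove, List.mem_append, List.mem_singleton]
  grind

theorem isAbove_snoc_of_isLow (l : List Arrow) {b : Arrow} (h : IsLow b) :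
    IsAbove (l ++ [b]) ↔ IsAbove l := by
  rw [isAbove_snoc, IsAbove]
  have h1 := h.1
  have h2 := h.2
  tauto

theorem top_mul_cl {b : Arrow} (hb : IsLow b) (u : Vertex) (x : dimer.Jacobi) :
    top u (quiver.tail b) (x * cl b) = top u (quiver.head b) x := by
  classical
  induction x using jacobi_induction with
  | path p =>
    by_cases h : p.tail = quiver.head b
    · rw [cls_mul_arr p b h]
      refine (top_cls _ _ _).trans (Eq.trans (if_congr ?_ rfl rfl) (top_cls _ _ _).symm)
      refine and_congr Iff.rfl (and_congr (iff_of_true rfl h) ?_)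
      exact isAbove_snoc_of_isLow p.arrows hb
    · have h1 : top u (quiver.head b) (cls p) = 0 :=
        (top_cls _ _ _).trans (if_neg fun h' => h h'.2.1)
      rw [cls_mul_arr_of_ne p h, h1, map_zero]
  | zero => rw [zero_mul, map_zero, map_zero]
  | add x y hx hy => rw [add_mul, map_add, map_add, hx, hy]
  | smul c x hx => rw [smul_mul_assoc, map_smul, map_smul, hx]

/-- The arrow above the square starts in column 0, and going backwards along a monotone path never
increases the column. -/
theorem exists_tail_of_isAbove (p : dimer.Path) (h : IsAbove p.arrows) :
    ∃ i j, p.tail = grid i j ∧ i ≤ 0 := by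
  induction p using Path.snoc_induction with
  | triv v =>
    obtain ⟨_, a, ha, _⟩ := h
    exact absurd ha List.not_mem_nil
  | snoc p b hp ih =>
    obtain ⟨h1, h2, h3 | h3⟩ := (isAbove_snoc p.arrows b).1 h
    · cases b with
      | right i j => exact ⟨i, j, rfl, h3.1.le⟩
      | _ => exact h3.elim
    · obtain ⟨i, j, h4, h5⟩ := ih ⟨h2, h3⟩
      have h6 := h4.symm.trans hp
      cases b with
      | right i' j' =>
        have h6 : grid i j = grid (i' + 1) j' := h6
        obtain ⟨h7, -⟩ := grid.inj h6
        exact ⟨i', j', rfl, by omega⟩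
      | up i' j' =>
        have h6 : grid i j = grid i' (j' + 1) := h6
        obtain ⟨h7, -⟩ := grid.inj h6
        exact ⟨i', j', rfl, by omega⟩
      | _ => exact h1.elim

theorem top_eq_zero_of_pos (u : Vertex) {i j : ℤ} (hi : 0 < i) (x : dimer.Jacobi) :
    top u (grid i j) x = 0 := by
  induction x using jacobi_induction with
  | path p =>
    refine (top_cls _ _ _).trans (if_neg fun h => ?_)
    obtain ⟨i', j', h1, h2⟩ := exists_tail_of_isAbove p h.2.2
    have h3 : grid i' j' = grid i j := h1.symm.trans h.2.1
    obtain ⟨h4, -⟩ := grid.inj h3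
    omega
  | zero => rw [map_zero]
  | add x y hx hy => rw [map_add, hx, hy, add_zero]
  | smul c x hx => rw [map_smul, hx, smul_zero]

theorem zdeg_nonneg (a : Arrow) : 0 ≤ zdeg a := by cases a <;> simp [zdeg]

theorem degree_nonneg (p : dimer.Path) : 0 ≤ degree p := by
  induction p using Path.snoc_induction with
  | triv v => exact le_rfl
  | snoc p b hp ih =>
    rw [degree_snoc p b hp]
    exact add_nonneg ih (zdeg_nonneg b)

/-- The path is followed backwards from its head. Every arrow of degree 0 into a grid vertex is
`right` or `up`, and column 0 is entered backwards either at height at least 1, through an arrow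
above the square, or at height at most 0, and then the height stays there. -/
theorem of_degree_eq_zero (p : dimer.Path) {k l : ℤ} (hk : 0 < k) (hp : p.head = grid k l)
    (h : degree p = 0) : (∀ a ∈ p.arrows, IsMonotone a) ∧
      ∃ i j, p.tail = grid i j ∧ (0 < i ∨ j ≤ 0 ∨ ∃ a ∈ p.arrows, IsTop a) := by
  induction p using Path.snoc_induction with
  | triv v => exact ⟨fun a ha => absurd ha List.not_mem_nil, k, l, hp, .inl hk⟩
  | snoc p b hb ih =>
    have h1 := degree_snoc p b hb
    have h2 := degree_nonneg p
    have h3 := zdeg_nonneg b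
    obtain ⟨h4, i, j, h5, h6⟩ := ih hp (by omega)
    have h7 : zdeg b = 0 := by omega
    have h8 := h5.symm.trans hb
    have key {l : List Arrow} (h4 : ∀ a ∈ l, IsMonotone a) {b : Arrow} (h : IsMonotone b) :
        ∀ a ∈ l ++ [b], IsMonotone a := by
      intro a ha
      obtain ha | ha := List.mem_append.1 ha
      · exact h4 a ha
      · exact List.eq_of_mem_singleton ha ▸ h
    cases b with
    | right i' j' =>
      have h8 : grid i j = grid (i' + 1) j' := h8
      obtain ⟨h9, rfl⟩ := grid.inj h8
      refine ⟨key h4 trivial, i', j, rfl, ?_⟩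
      obtain h6 | h6 | ⟨a, ha, h6⟩ := h6
      · by_cases h10 : 0 < i'
        · exact .inl h10
        · by_cases h11 : j ≤ 0
          · exact .inr (.inl h11)
          · exact .inr (.inr ⟨right i' j, List.mem_append_right _ (List.mem_singleton_self _),
              by simp only [IsTop]; omega⟩)
      · exact .inr (.inl h6)
      · exact .inr (.inr ⟨a, List.mem_append_left _ ha, h6⟩)
    | up i' j' =>
      have h8 : grid i j = grid i' (j' + 1) := h8
      obtain ⟨rfl, h9⟩ := grid.inj h8
      refine ⟨key h4 trivial, i, j', rfl, ?_⟩
      obtain h6 | h6 | ⟨a, ha, h6⟩ := h6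
      · exact .inl h6
      · exact .inr (.inl (by omega))
      · exact .inr (.inr ⟨a, List.mem_append_left _ ha, h6⟩)
    | diag i j h => exact absurd h7 one_ne_zero
    | xA00 => exact absurd h7 one_ne_zero
    | xB01 => exact absurd h7 one_ne_zero
    | xB10 => exact absurd h7 one_ne_zero
    | x01A => cases h8
    | x10A => cases h8
    | x11B => cases h8
    | xAB => cases h8

theorem degree_eq_zero (p : dimer.Path) (h : ∀ a ∈ p.arrows, IsMonotone a) : degree p = 0 := by
  have key (a : Arrow) (h : IsMonotone a) : zdeg a = 0 := by
    cases a <;> first | rfl | exact h.elim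
  refine List.sum_eq_zero fun z hz => ?_
  obtain ⟨a, ha, rfl⟩ := List.mem_map.1 hz
  exact key a (h a ha)

/-- Seen from (0,1), the paths of degree 0 to a column k > 0 are precisely the monotone paths above
the central square, since their tail has column 0 and height 1. It serves the exceptional case of
`admissible_of_forall`. -/
theorem mass_eq_top {k l : ℤ} (hk : 0 < k) (x : dimer.Jacobi) :
    mass (grid 0 1) x (grid k l, 0) = top (grid k l) (grid 0 1) x := by
  induction x using jacobi_induction with
  | path p =>
    rw [mass_cls, top_cls]
    by_cases hp : p.tail = grid 0 1
    · rw [if_pos hp]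
      classical
      refine (Finsupp.single_apply ..).trans (if_congr ⟨fun h => ?_, fun h => ?_⟩ rfl rfl)
      · have h1 : p.head = grid k l := (congrArg Prod.fst h :)
        obtain ⟨h2, i, j, h3, h4⟩ := of_degree_eq_zero p hk h1 (congrArg Prod.snd h :)
        have h5 : grid i j = grid 0 1 := h3.symm.trans hp
        obtain ⟨rfl, rfl⟩ := grid.inj h5
        refine ⟨h1, hp, h2, ?_⟩
        obtain h4 | h4 | h4 := h4
        · omega
        · omega
        · exact h4
      · exact Prod.ext h.1 (degree_eq_zero p h.2.2.1)
    · rw [if_neg hp, if_neg fun h => hp h.2.1]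
      rfl
  | zero => rw [map_zero, map_zero]; rfl
  | add x y hx hy => rw [map_add, map_add, Finsupp.add_apply, hx, hy]
  | smul c x hx => rw [map_smul, map_smul, Finsupp.smul_apply, hx]

/-- A defect starting at (i-1,j) with i ≤ 0 has a lower path with first arrow `right (i-1) j`, by
the recursive form of `lowerPath`, and that arrow can be removed. -/
theorem exists_mul_right_of_mem {y : dimer.Jacobi} (hy : y ∈ defects) {i j : ℤ} (hi : i ≤ 0) :
    ∃ x ∈ defects, x * vtx (grid i j) = x ∧
      y * vtx (grid (i - 1) j) = x * cl (right (i - 1) j) := by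
  induction hy using defects_induction with
  | h k l i' j' =>
    by_cases h : grid (-i') (-j') = grid (i - 1) j
    · obtain ⟨h1, h2⟩ := grid.inj h
      obtain ⟨n, rfl⟩ : ∃ n, i' = n + 1 := ⟨i' - 1, by omega⟩
      obtain rfl : i = -n := by push_cast at h1; omega
      subst h2
      refine ⟨defect k l n j', defect_mem k l n j', defect_mul_vtx k l n j', ?_⟩
      rw [← h, defect_mul_vtx, defect_mul_right]
    · exact ⟨0, zero_mem _, zero_mul _, by
        rw [mul_idem_of_ne (Q := dimer) (defect_mul_vtx k l i' j') h, zero_mul]⟩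
  | zero => exact ⟨0, zero_mem _, zero_mul _, by rw [zero_mul, zero_mul]⟩
  | add x y _ _ hx hy =>
    obtain ⟨x', h1, h2, h3⟩ := hx
    obtain ⟨y', h4, h5, h6⟩ := hy
    exact ⟨x' + y', Submodule.add_mem _ h1 h4, by rw [add_mul, h2, h5],
      by rw [add_mul, add_mul, h3, h6]⟩
  | smul c x _ hx =>
    obtain ⟨x', h1, h2, h3⟩ := hx
    exact ⟨c • x', Submodule.smul_mem _ c h1, by rw [smul_mul_assoc, h2],
      by rw [smul_mul_assoc, smul_mul_assoc, h3]⟩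

theorem eq_zero_of_mem_defects {x : dimer.Jacobi} (hx : x ∈ defects) {v : Vertex}
    (hx' : x * vtx v = x) (h : ∀ i j, v = grid i j → ¬ (i ≤ 0 ∧ j ≤ 0)) : x = 0 :=
  eq_of_top hx (zero_mem _) hx' (zero_mul _) fun u => by rw [top_eq_zero hx u h, map_zero]

/-- A family `q a` of elements of `defects` indexed by the arrows with head `v`, that satisfies the
linearized relations, comes from an element at `v`. -/
theorem exists_mul_cl_of_mem_defects {v : Vertex} {q : Arrow → dimer.Jacobi}
    (hmem : ∀ a, quiver.head a = v → q a ∈ defects)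
    (hq : ∀ a, quiver.head a = v → q a * vtx (quiver.tail a) = q a)
    (hrel : ∀ b, quiver.tail b = v →
      q (next b) * cl (next (next b)) = q (next' b) * cl (next' (next' b))) :
    ∃ x, x * vtx v = x ∧ ∀ a, quiver.head a = v → q a = x * cl a := by
  have htail (a : Arrow) (ha : quiver.head a = v)
      (h : ∀ i j, quiver.tail a = grid i j → ¬ (i ≤ 0 ∧ j ≤ 0)) : q a = 0 :=
    eq_zero_of_mem_defects (hmem a ha) (hq a ha) h
  cases v with
  | A =>
    refine ⟨0, zero_mul _, fun a ha => ?_⟩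
    rw [zero_mul]
    refine htail a ha ?_
    cases a <;> cases ha
    · rintro _ _ ⟨⟩; omega
    · rintro _ _ ⟨⟩; omega
  | B =>
    refine ⟨0, zero_mul _, fun a ha => ?_⟩
    rw [zero_mul]
    refine htail a ha ?_
    cases a <;> cases ha
    · rintro _ _ ⟨⟩; omega
    · rintro _ _ ⟨⟩
  | grid i j =>
    have hr : quiver.head (right (i - 1) j) = grid i j := congrArg₂ grid (by ring) rfl
    have hu : quiver.head (up i (j - 1)) = grid i j := congrArg₂ grid rfl (by ring)
    have hright (h : ¬ (i - 1 ≤ 0 ∧ j ≤ 0)) : q (right (i - 1) j) = 0 :=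
      htail _ hr (by rintro _ _ ⟨⟩; exact h)
    have hup (h : ¬ (i ≤ 0 ∧ j - 1 ≤ 0)) : q (up i (j - 1)) = 0 :=
      htail _ hu (by rintro _ _ ⟨⟩; exact h)
    have hdiag (h) (hij : ¬ (i + 1 ≤ 0 ∧ j + 1 ≤ 0)) : q (diag i j h) = 0 :=
      htail _ rfl (by rintro _ _ ⟨⟩; exact hij)
    -- Continuing both values to (i-1,j-1) preserves `top`, and the results agree by the relation of
    -- the diagonal of that square. For the central square both values are 0 anyway, as their tails
    -- lie outside the lower left quadrant.
    have hru (u : Vertex) : top u (grid (i - 1) j) (q (right (i - 1) j)) =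
        top u (grid i (j - 1)) (q (up i (j - 1))) := by
      by_cases h11 : (i - 1, j - 1) = (0, 0)
      · obtain ⟨h1, h2⟩ := Prod.mk.inj h11
        rw [hright (by omega), hup (by omega), map_zero, map_zero]
      · have h := hrel (diag (i - 1) (j - 1) h11) (congrArg₂ grid (by ring) (by ring))
        rw [next, next_up h11, next', next'_right h11, sub_add_cancel, sub_add_cancel] at h
        have h1 : top u (grid (i - 1) (j - 1)) (q (up i (j - 1)) * cl (right (i - 1) (j - 1))) =
            top u (grid i (j - 1)) (q (up i (j - 1))) := by
          by_cases hi : i ≤ 0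
          · exact top_mul_right (hmem _ hu) u i (j - 1) hi
          · rw [hup (by omega), zero_mul, map_zero, map_zero]
        have h2 : top u (grid (i - 1) (j - 1)) (q (right (i - 1) j) * cl (up (i - 1) (j - 1))) =
            top u (grid (i - 1) j) (q (right (i - 1) j)) := by
          by_cases hj : j ≤ 0
          · exact top_mul_up (hmem _ hr) u (i - 1) j hj
          · rw [hright (by omega), zero_mul, map_zero, map_zero]
        rw [← h1, ← h2, h]
    -- In the lower left quadrant the lift is read off from the arrow `right` alone. The values at
    -- the other arrows are defects and are compared through `top`.
    by_cases hij : i ≤ 0 ∧ j ≤ 0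
    · obtain ⟨x, hx, hx', h⟩ := exists_mul_right_of_mem (hmem _ hr) (j := j) hij.1
      have h : q (right (i - 1) j) = x * cl (right (i - 1) j) := (hq _ hr).symm.trans h
      refine ⟨x, hx', head_cases ?_ ?_ ?_ ?_ ?_ ?_ ?_ ?_ ?_ ?_⟩
      · rintro _ _ ⟨⟩
        exact h
      · rintro _ _ ⟨⟩
        refine eq_of_top (hmem _ hu) (defects_mul_cl hx _) (hq _ hu) ?_ fun u => ?_
        · rw [mul_assoc, cl_mul_vtx]
        · refine (hru u).symm.trans ?_
          rw [h, top_mul_right hx u i j hij.1]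
          exact (top_mul_up hx u i j hij.2).symm
      · rintro _ _ h0 ⟨⟩
        rw [defects_mul_diag hx]
        by_cases hij' : i + 1 ≤ 0 ∧ j + 1 ≤ 0
        · have h01 : (i, j - 1) ≠ (0, 0) := by
            simp only [ne_eq, Prod.mk.injEq]
            omega
          -- Defects are killed by diagonals, so this relation shows that the value at the diagonal
          -- times `up` is 0; as `up` preserves `top`, the value itself is 0.
          have h1 := hrel (right i j) rfl
          rw [next_right h0, next, next', if_pos h01, next'_up h01,
            defects_mul_diag (hmem _ hu)] at h1
          refine eq_of_top (hmem _ rfl) (zero_mem _) (hq _ rfl) (zero_mul _) fun u => ?_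
          have h2 := top_mul_up (hmem (diag i j h0) rfl) u (i + 1) (j + 1) hij'.2
          rw [add_sub_cancel_right, h1, map_zero] at h2
          rw [map_zero]
          exact h2.symm
        · exact hdiag h0 hij'
      · rintro ⟨⟩
      · rintro ⟨⟩
      · rintro ⟨⟩
      · rintro ⟨⟩
      · intro hv
        rw [defects_mul_A00 hx]
        exact htail _ hv.symm (by rintro _ _ ⟨⟩)
      · intro hv
        obtain ⟨-, h2⟩ := grid.inj hv
        omega
      · intro hv
        obtain ⟨h1, -⟩ := grid.inj hv
        omega
    -- Outside the quadrant at least one of (i-1,j) and (i,j-1) also lies outside it, so one of the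
    -- two values vanishes, and `hru` transfers this to the other.
    · refine ⟨0, zero_mul _, fun a ha => ?_⟩
      rw [zero_mul]
      revert a
      refine head_cases ?_ ?_ ?_ ?_ ?_ ?_ ?_ ?_ ?_ ?_
      · rintro _ _ ⟨⟩
        refine eq_of_top (hmem _ hr) (zero_mem _) (hq _ hr) (zero_mul _) fun u => ?_
        by_cases hi : i ≤ 0
        · rw [hright (by omega)]
        · refine (hru u).trans ?_
          rw [hup (by omega), map_zero, map_zero]
      · rintro _ _ ⟨⟩
        refine eq_of_top (hmem _ hu) (zero_mem _) (hq _ hu) (zero_mul _) fun u => ?_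
        by_cases hi : i ≤ 0
        · refine (hru u).symm.trans ?_
          rw [hright (by omega), map_zero, map_zero]
        · rw [hup (by omega)]
      · rintro _ _ h ⟨⟩
        exact hdiag h (by omega)
      · rintro ⟨⟩
      · rintro ⟨⟩
      · rintro ⟨⟩
      · rintro ⟨⟩
      · exact fun hv => htail _ hv.symm (by rintro _ _ ⟨⟩)
      · exact fun hv => htail _ hv.symm (by rintro _ _ ⟨⟩)
      · exact fun hv => htail _ hv.symm (by rintro _ _ ⟨⟩)

/-- A family `q a` indexed by the arrows with head `v`, that satisfies the linearized relations,
comes from an element at `v`. -/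
theorem exists_mul_cl {v : Vertex} {q : Arrow → dimer.Jacobi}
    (hq : ∀ a, q a * vtx (quiver.tail a) = q a)
    (hrel : ∀ b, quiver.tail b = v →
      q (next b) * cl (next (next b)) = q (next' b) * cl (next' (next' b))) :
    ∃ x, x * vtx v = x ∧ ∀ a, quiver.head a = v → q a = x * cl a := by
  obtain ⟨a₀, ha₀⟩ : ∃ a : Arrow, quiver.head a = v := exists_head v
  -- If q a = x·a, then these shifted masses are the masses of x. They are thus the only candidate,
  -- and must be independent of a.
  let f (a : Arrow) (k : Vertex × ℤ) : ℂ := mass (quiver.tail a) (q a) (k.1, k.2 + zdeg a)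
  have hf (a : Arrow) (ha : quiver.head a = v) : f a = f a₀ := by
    refine eq_of_forall_next (fun b hb => ?_) ha ha₀
    ext ⟨u, c⟩
    have e1 := zdeg_next b
    have e2 := zdeg_next' b
    have t1 : quiver.tail (next (next b)) = quiver.head b := triangulation.tail_φ_φ b
    have t2 : quiver.tail (next' (next' b)) = quiver.head b := triangulation.tail_ψ_ψ b
    -- The degrees in a triangle add up to 1, so removing the third arrow from degree `c + 1 - zdeg
    -- b` leaves `c + zdeg (next b)`, as in `f`.
    have m1 := mass_mul_cl (next (next b)) (q (next b)) u (c + 1 - zdeg b)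
    have m2 := mass_mul_cl (next' (next' b)) (q (next' b)) u (c + 1 - zdeg b)
    rw [t1, hrel b hb, ← t2, m2, (next_spec (next b)).2.1, (next'_spec (next' b)).2.1,
      show c + 1 - zdeg b - zdeg (next (next b)) = c + zdeg (next b) by omega,
      show c + 1 - zdeg b - zdeg (next' (next' b)) = c + zdeg (next' b) by omega] at m1
    exact m1.symm
  have hadm (u : Vertex) (c : ℤ) (h : f a₀ (u, c) ≠ 0) : Admissible v u c := by
    have h1 (a : Arrow) (ha : quiver.head a = v) :
        Admissible (quiver.tail a) u (c + zdeg a) := by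
      by_contra h2
      refine h ?_
      rw [← hf a ha]
      exact mass_eq_zero h2 _
    -- In the exceptional case v = A the masses are values of `top`. The relation of A → (0,0) moves
    -- them from paths through (0,1) to paths through (1,0), where `top` vanishes because the tail
    -- has a positive column.
    obtain h2 | ⟨rfl, rfl, k, l, rfl, hk, hl⟩ := admissible_of_forall h1
    · exact h2
    · refine absurd ?_ h
      rw [← hf x01A rfl]
      refine (mass_eq_top (l := l) (show 0 < k from hk) (q x01A)).trans ?_
      have h3 := top_mul_cl (b := up 0 0) ⟨trivial, id⟩ (grid k l) (q x01A)
      have h4 := top_mul_cl (b := right 0 0) ⟨trivial, by simp [IsTop]⟩ (grid k l) (q x10A)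
      have h5 : q x10A * cl (right 0 0) = q x01A * cl (up 0 0) := hrel xA00 rfl
      have h6 := top_eq_zero_of_pos (grid k l) (i := 0 + 1) (j := 0) one_pos (q x10A)
      rw [h5] at h4
      exact (h3.symm.trans h4).trans h6
  let F : Vertex × ℤ →₀ ℂ :=
    (mass (quiver.tail a₀) (q a₀)).comapDomain (fun k => (k.1, k.2 + zdeg a₀)) fun k _ k' _ h =>
      Prod.ext (congrArg Prod.fst h :) (add_right_cancel (congrArg Prod.snd h :))
  have hF : mass v (ofMass v F) = F := mass_ofMass hadm
  have hx₀ := ofMass_mul_vtx v F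
  set x₀ := ofMass v F
  -- Since `x₀` has the required masses, every difference has mass zero and is a combination of
  -- defects.
  obtain ⟨x, hx, hx'⟩ := exists_mul_cl_of_mem_defects (v := v) (q := fun a => q a - x₀ * cl a)
    (fun (a : Arrow) ha => by
      have h1 : (q a - x₀ * cl a) * vtx (quiver.tail a) = q a - x₀ * cl a := by
        rw [sub_mul, hq, mul_assoc, cl_mul_vtx]
      refine mem_defects_of_mass_eq_zero h1 ?_
      ext ⟨u, c⟩
      rw [map_sub, Finsupp.sub_apply, mass_mul_cl, ha, hF]
      have h2 := congrFun (hf a ha) (u, c - zdeg a)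
      have h3 : f a (u, c - zdeg a) = mass (quiver.tail a) (q a) (u, c) := by
        simp only [f, sub_add_cancel]
      rw [← h3, h2]
      exact sub_self _)
    (fun (a : Arrow) _ => by rw [sub_mul, hq, mul_assoc, cl_mul_vtx])
    (fun (b : Arrow) hb => by
      rw [sub_mul, sub_mul, hrel b hb, mul_assoc, mul_assoc, cl_relation])
  refine ⟨x₀ + x, ?_, fun a ha => ?_⟩
  · rw [add_mul, hx₀, hx]
  · rw [add_mul, ← hx' a ha, add_sub_cancel]

theorem locallyExact : triangulation.LocallyExact := fun _ _ hq hrel => exists_mul_cl hq hrel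

theorem isCY3 : dimer.IsCY3 := locallyExact.isCY3 locallyInjective

end ModifiedGrid

namespace DimerModel

variable {Q : DimerModel}

/-! ### Triangles in the plane -/

theorem polygon_triangle (φ : Q.V → ℝ × ℝ) (a b c : Q.E) :
    Q.polygon φ ([a, b, c] : List Q.E) =
      convexHull ℝ {φ (Q.head a), φ (Q.head b), φ (Q.head c)} := by
  refine congrArg _ (Set.ext fun x => ?_)
  simp

theorem signedArea_rotate (p q r : ℝ × ℝ) : signedArea q r p = signedArea p q r := by
  unfold signedArea
  ring

theorem signedArea_smul_add_smul (p q x y : ℝ × ℝ) {s t : ℝ} (h : s + t = 1) :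
    signedArea p q (s • x + t • y) = s * signedArea p q x + t * signedArea p q y := by
  obtain rfl : t = 1 - s := by linarith
  simp only [signedArea, Prod.fst_add, Prod.snd_add, Prod.smul_fst, Prod.smul_snd, smul_eq_mul]
  ring

/-- The three signed areas, divided by their sum `signedArea p q r`, are the barycentric coordinates
of x. -/
theorem mem_convexHull_triangle {p q r x : ℝ × ℝ} (h : 0 < signedArea p q r)
    (h1 : 0 ≤ signedArea p q x) (h2 : 0 ≤ signedArea q r x) (h3 : 0 ≤ signedArea r p x) :
    x ∈ convexHull ℝ {p, q, r} := by
  have hsum : signedArea p q x + signedArea q r x + signedArea r p x = signedArea p q r := by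
    unfold signedArea
    ring
  set d := signedArea p q r with hd
  have key := (convex_convexHull ℝ {p, q, r}).sum_mem (t := Finset.univ)
    (w := ![signedArea q r x / d, signedArea r p x / d, signedArea p q x / d]) (z := ![p, q, r])
    (by
      intro i _
      fin_cases i
      · exact div_nonneg h2 h.le
      · exact div_nonneg h3 h.le
      · exact div_nonneg h1 h.le)
    (by
      simp only [Fin.sum_univ_three, Matrix.cons_val]
      rw [← add_div, ← add_div, div_eq_one_iff_eq h.ne', ← hsum]
      ring)
    (by
      intro i _
      refine subset_convexHull ℝ _ ?_
      fin_cases i <;> simp)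
  convert key using 1
  simp only [Fin.sum_univ_three, Matrix.cons_val]
  have e1 : d * x.1 = signedArea q r x * p.1 + signedArea r p x * q.1 + signedArea p q x * r.1 := by
    rw [hd]
    unfold signedArea
    ring
  have e2 : d * x.2 = signedArea q r x * p.2 + signedArea r p x * q.2 + signedArea p q x * r.2 := by
    rw [hd]
    unfold signedArea
    ring
  ext
  · simp only [Prod.fst_add, Prod.smul_fst, smul_eq_mul]
    field_simp
    linarith
  · simp only [Prod.snd_add, Prod.smul_snd, smul_eq_mul]
    field_simp
    linarith

theorem signedArea_nonneg_of_mem_convexHull {p q r x : ℝ × ℝ} (h : 0 < signedArea p q r)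
    (hx : x ∈ convexHull ℝ {p, q, r}) : 0 ≤ signedArea p q x := by
  refine convexHull_min (t := {x | 0 ≤ signedArea p q x}) ?_ ?_ hx
  · rintro y (rfl | rfl | rfl)
    · simp [signedArea]
    · simp [signedArea, mul_comm]
    · exact h.le
  · intro y hy z hz s t hs ht hst
    rw [Set.mem_ofPred_eq, signedArea_smul_add_smul _ _ _ _ hst]
    exact add_nonneg (mul_nonneg hs hy) (mul_nonneg ht hz)

theorem signedArea_pos_of_mem_interior {p q r x : ℝ × ℝ} (h : 0 < signedArea p q r)
    (hx : x ∈ interior (convexHull ℝ {p, q, r})) : 0 < signedArea p q x := by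
  -- This moves x perpendicularly to the edge in the direction in which the signed area strictly
  -- decreases. A short move stays in the triangle, so the area was positive at x.
  let γ (t : ℝ) : ℝ × ℝ := (x.1 + t * (q.2 - p.2), x.2 - t * (q.1 - p.1))
  have hγ : Continuous γ := by fun_prop
  have h0 : γ 0 = x := by simp [γ]
  have hopen : IsOpen (γ ⁻¹' interior (convexHull ℝ {p, q, r})) := isOpen_interior.preimage hγ
  obtain ⟨ε, hε, hball⟩ := Metric.isOpen_iff.1 hopen 0 (by rwa [Set.mem_preimage, h0])
  have hmem : γ (ε / 2) ∈ convexHull ℝ {p, q, r} := by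
    refine interior_subset (hball ?_)
    rw [Metric.mem_ball, Real.dist_eq, sub_zero, abs_of_pos (half_pos hε)]
    exact half_lt_self hε
  have h1 := signedArea_nonneg_of_mem_convexHull h hmem
  have h2 : signedArea p q (γ (ε / 2)) =
      signedArea p q x - ε / 2 * ((q.1 - p.1) ^ 2 + (q.2 - p.2) ^ 2) := by
    simp only [signedArea, γ]
    ring
  have h3 : 0 < (q.1 - p.1) ^ 2 + (q.2 - p.2) ^ 2 := by
    refine lt_of_le_of_ne (by positivity) fun h4 => h.ne ?_
    have h5 : q.1 - p.1 = 0 := by nlinarith [sq_nonneg (q.1 - p.1), sq_nonneg (q.2 - p.2)]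
    have h6 : q.2 - p.2 = 0 := by nlinarith [sq_nonneg (q.1 - p.1), sq_nonneg (q.2 - p.2)]
    rw [signedArea, h5, h6]
    ring
  nlinarith

theorem signedArea_pos_of_mem_interior' {p q r x : ℝ × ℝ} (h : 0 < signedArea p q r)
    (hx : x ∈ interior (convexHull ℝ {p, q, r})) :
    0 < signedArea p q x ∧ 0 < signedArea q r x ∧ 0 < signedArea r p x := by
  refine ⟨signedArea_pos_of_mem_interior h hx, ?_, ?_⟩
  · rw [← signedArea_rotate] at h
    refine signedArea_pos_of_mem_interior h ?_
    convert hx using 3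
    ext y
    simp only [Set.mem_insert_iff, Set.mem_singleton_iff]
    tauto
  · rw [← signedArea_rotate, ← signedArea_rotate] at h
    refine signedArea_pos_of_mem_interior h ?_
    convert hx using 3
    ext y
    simp only [Set.mem_insert_iff, Set.mem_singleton_iff]
    tauto

end DimerModel

namespace ModifiedGrid

open ArrowQuiver DimerModel Vertex Arrow

/-! ### The drawing -/

theorem corners (c : Cycle Arrow) (hc : c ∈ posFaces ∪ negFaces) (a : Arrow) (ha : a ∈ c)
    (b : Arrow) (hb : b ∈ c) (h : quiver.head a = quiver.head b) : a = b := by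
  obtain (⟨i, j, h, rfl⟩ | rfl | rfl | rfl) | (⟨i, j, h, rfl⟩ | rfl | rfl | rfl) := hc <;>
  simp only [Cycle.mem_coe_iff, List.mem_cons, List.not_mem_nil, or_false] at ha hb <;>
  obtain rfl | rfl | rfl := ha <;> obtain rfl | rfl | rfl := hb <;>
  first
    | rfl
    | simp [quiver] at h

theorem anticlockwise (c : Cycle Arrow) (hc : c ∈ posFaces) (a : Arrow) (ha : a ∈ c)
    (b : Arrow) (hb : b ∈ c) (h : quiver.head b ≠ quiver.tail a)
    (h' : quiver.head b ≠ quiver.head a) :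
    0 < signedArea (drawing (quiver.tail a)) (drawing (quiver.head a))
      (drawing (quiver.head b)) := by
  obtain ⟨i, j, h, rfl⟩ | rfl | rfl | rfl := hc <;>
  simp only [Cycle.mem_coe_iff, List.mem_cons, List.not_mem_nil, or_false] at ha hb <;>
  obtain rfl | rfl | rfl := ha <;> obtain rfl | rfl | rfl := hb <;>
  first
    | exact absurd rfl h
    | exact absurd rfl h'
    | (simp only [quiver, drawing, signedArea]
       push_cast
       ring_nf
       norm_num)

theorem clockwise (c : Cycle Arrow) (hc : c ∈ negFaces) (a : Arrow) (ha : a ∈ c)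
    (b : Arrow) (hb : b ∈ c) (h : quiver.head b ≠ quiver.tail a)
    (h' : quiver.head b ≠ quiver.head a) :
    signedArea (drawing (quiver.tail a)) (drawing (quiver.head a))
      (drawing (quiver.head b)) < 0 := by
  obtain ⟨i, j, h, rfl⟩ | rfl | rfl | rfl := hc <;>
  simp only [Cycle.mem_coe_iff, List.mem_cons, List.not_mem_nil, or_false] at ha hb <;>
  obtain rfl | rfl | rfl := ha <;> obtain rfl | rfl | rfl := hb <;>
  first
    | exact absurd rfl h
    | exact absurd rfl h'
    | (simp only [quiver, drawing, signedArea]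
       push_cast
       ring_nf
       norm_num)

open Classical in
/-- A triangle of the central square containing a given point. -/
def centralFaceAt (x : ℝ × ℝ) : Cycle Arrow :=
  if 2 * x.2 ≤ 3 * x.1 ∧ 4 * x.2 ≤ 3 - 3 * x.1 then ([xA00, x10A, right 0 0] : List Arrow)
  else if 3 * x.1 ≤ 2 * x.2 ∧ 2 * x.2 ≤ 2 - 3 * x.1 then ([xA00, x01A, up 0 0] : List Arrow)
  else if 2 * x.2 ≤ 1 ∧ 3 - 3 * x.1 ≤ 4 * x.2 ∧ 2 * x.2 ≤ 3 - 3 * x.1 then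
    ([xB10, xAB, x10A] : List Arrow)
  else if 3 - 3 * x.1 ≤ 2 * x.2 ∧ 2 * x.2 ≤ 3 * x.1 - 1 then ([xB10, x11B, up 1 0] : List Arrow)
  else if 1 ≤ 2 * x.2 ∧ 4 * x.2 ≤ 4 - 3 * x.1 ∧ 2 - 3 * x.1 ≤ 2 * x.2 then
    ([xB01, xAB, x01A] : List Arrow)
  else ([xB01, x11B, right 0 1] : List Arrow)

open Classical in
/-- A triangle containing a given point. -/
def faceAt (x : ℝ × ℝ) : Cycle Arrow :=
  if h : (⌊x.1⌋, ⌊x.2⌋) ≠ (0, 0) then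
    if x.2 - ⌊x.2⌋ ≤ x.1 - ⌊x.1⌋ then
      ([diag ⌊x.1⌋ ⌊x.2⌋ h, up (⌊x.1⌋ + 1) ⌊x.2⌋, right ⌊x.1⌋ ⌊x.2⌋] : List Arrow)
    else ([diag ⌊x.1⌋ ⌊x.2⌋ h, right ⌊x.1⌋ (⌊x.2⌋ + 1), up ⌊x.1⌋ ⌊x.2⌋] : List Arrow)
  else centralFaceAt x

/-- The triangle spanned by the heads of three arrows. -/
abbrev triangle (a b c : Arrow) : Set (ℝ × ℝ) :=
  dimer.polygon drawing (([a, b, c] : List Arrow) : Cycle Arrow)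

theorem mem_triangle {a b c : Arrow} {x : ℝ × ℝ}
    (h : 0 < signedArea (drawing (quiver.head a)) (drawing (quiver.head b))
      (drawing (quiver.head c)))
    (h1 : 0 ≤ signedArea (drawing (quiver.head a)) (drawing (quiver.head b)) x)
    (h2 : 0 ≤ signedArea (drawing (quiver.head b)) (drawing (quiver.head c)) x)
    (h3 : 0 ≤ signedArea (drawing (quiver.head c)) (drawing (quiver.head a)) x) :
    x ∈ triangle a b c := by
  have e : triangle a b c = _ := polygon_triangle (Q := dimer) drawing a b c
  rw [e]
  exact mem_convexHull_triangle h h1 h2 h3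

theorem of_mem_interior {a b c : Arrow} {x : ℝ × ℝ}
    (h : 0 < signedArea (drawing (quiver.head a)) (drawing (quiver.head b))
      (drawing (quiver.head c))) (hx : x ∈ interior (triangle a b c)) :
    0 < signedArea (drawing (quiver.head a)) (drawing (quiver.head b)) x ∧
    0 < signedArea (drawing (quiver.head b)) (drawing (quiver.head c)) x ∧
    0 < signedArea (drawing (quiver.head c)) (drawing (quiver.head a)) x := by
  have e : triangle a b c = _ := polygon_triangle (Q := dimer) drawing a b c
  rw [e] at hx
  exact signedArea_pos_of_mem_interior' h hx

theorem triangle_swap (a b c : Arrow) : triangle a b c = triangle a c b := by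
  refine (polygon_triangle (Q := dimer) drawing a b c).trans
    (Eq.trans ?_ (polygon_triangle (Q := dimer) drawing a c b).symm)
  rw [Set.pair_comm (drawing _) (drawing _)]

theorem faceAt_of_floor {x : ℝ × ℝ} (h1 : 0 < x.1) (h2 : x.1 < 1) (h3 : 0 < x.2) (h4 : x.2 < 1) :
    faceAt x = centralFaceAt x := by
  have e1 : ⌊x.1⌋ = 0 := Int.floor_eq_zero_iff.2 ⟨h1.le, h2⟩
  have e2 : ⌊x.2⌋ = 0 := Int.floor_eq_zero_iff.2 ⟨h3.le, h4⟩
  exact dif_neg fun h => h (by rw [e1, e2])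

theorem faceAt_of_lower {x : ℝ × ℝ} {i j : ℤ} (h : (i, j) ≠ (0, 0)) (h1 : i ≤ x.1)
    (h2 : x.1 < i + 1) (h3 : j ≤ x.2) (h4 : x.2 < j + 1) (h5 : x.2 - j ≤ x.1 - i) :
    faceAt x = ([diag i j h, up (i + 1) j, right i j] : List Arrow) := by
  obtain rfl : ⌊x.1⌋ = i := Int.floor_eq_iff.2 ⟨h1, h2⟩
  obtain rfl : ⌊x.2⌋ = j := Int.floor_eq_iff.2 ⟨h3, h4⟩
  rw [faceAt, dif_pos h, if_pos h5]

theorem faceAt_of_upper {x : ℝ × ℝ} {i j : ℤ} (h : (i, j) ≠ (0, 0)) (h1 : i ≤ x.1)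
    (h2 : x.1 < i + 1) (h3 : j ≤ x.2) (h4 : x.2 < j + 1) (h5 : x.1 - i < x.2 - j) :
    faceAt x = ([diag i j h, right i (j + 1), up i j] : List Arrow) := by
  obtain rfl : ⌊x.1⌋ = i := Int.floor_eq_iff.2 ⟨h1, h2⟩
  obtain rfl : ⌊x.2⌋ = j := Int.floor_eq_iff.2 ⟨h3, h4⟩
  rw [faceAt, dif_pos h, if_neg h5.not_ge]

/-- A point interior to two triangles would have both as its value of `faceAt`, so this gives the
absence of overlaps without comparing pairs of triangles. -/
theorem faceAt_of_mem_interior {c : Cycle Arrow} (hc : c ∈ posFaces ∪ negFaces) {x : ℝ × ℝ}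
    (hx : x ∈ interior (dimer.polygon drawing c)) : faceAt x = c := by
  obtain (⟨i, j, h, rfl⟩ | rfl | rfl | rfl) | (⟨i, j, h, rfl⟩ | rfl | rfl | rfl) := hc
  · have hx : x ∈ interior (triangle _ _ _) := hx
    -- Cycles are listed against the direction of travel, so the heads of an anticlockwise face
    -- appear in clockwise order; exchanging two of them makes the area positive.
    rw [triangle_swap] at hx
    obtain ⟨h1, h2, h3⟩ := of_mem_interior (by
      simp only [quiver, drawing, signedArea]; push_cast; ring_nf; norm_num) hx
    simp only [quiver, drawing, signedArea] at h1 h2 h3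
    push_cast at h1 h2 h3
    refine faceAt_of_lower h ?_ ?_ ?_ ?_ ?_ <;> linarith
  · have hx : x ∈ interior (triangle _ _ _) := hx
    rw [triangle_swap] at hx
    obtain ⟨h1, h2, h3⟩ := of_mem_interior (by
      simp only [quiver, drawing, signedArea]; norm_num) hx
    simp only [quiver, drawing, signedArea] at h1 h2 h3
    push_cast at h1 h2 h3
    rw [faceAt_of_floor (by linarith) (by linarith) (by linarith) (by linarith), centralFaceAt,
      if_neg fun h => by linarith [h.1, h.2], if_neg fun h => by linarith [h.1, h.2],
      if_neg fun h => by linarith [h.1, h.2.1, h.2.2], if_neg fun h => by linarith [h.1, h.2],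
      if_pos ⟨by linarith, by linarith, by linarith⟩]
  · have hx : x ∈ interior (triangle _ _ _) := hx
    rw [triangle_swap] at hx
    obtain ⟨h1, h2, h3⟩ := of_mem_interior (by
      simp only [quiver, drawing, signedArea]; norm_num) hx
    simp only [quiver, drawing, signedArea] at h1 h2 h3
    push_cast at h1 h2 h3
    rw [faceAt_of_floor (by linarith) (by linarith) (by linarith) (by linarith), centralFaceAt,
      if_pos ⟨by linarith, by linarith⟩]
  · have hx : x ∈ interior (triangle _ _ _) := hx
    rw [triangle_swap] at hx
    obtain ⟨h1, h2, h3⟩ := of_mem_interior (by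
      simp only [quiver, drawing, signedArea]; norm_num) hx
    simp only [quiver, drawing, signedArea] at h1 h2 h3
    push_cast at h1 h2 h3
    rw [faceAt_of_floor (by linarith) (by linarith) (by linarith) (by linarith), centralFaceAt,
      if_neg fun h => by linarith [h.1, h.2], if_neg fun h => by linarith [h.1, h.2],
      if_neg fun h => by linarith [h.1, h.2.1, h.2.2], if_pos ⟨by linarith, by linarith⟩]
  · obtain ⟨h1, h2, h3⟩ := of_mem_interior (by
      simp only [quiver, drawing, signedArea]; push_cast; ring_nf; norm_num) hx
    simp only [quiver, drawing, signedArea] at h1 h2 h3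
    push_cast at h1 h2 h3
    refine faceAt_of_upper h ?_ ?_ ?_ ?_ ?_ <;> linarith
  · obtain ⟨h1, h2, h3⟩ := of_mem_interior (by
      simp only [quiver, drawing, signedArea]; norm_num) hx
    simp only [quiver, drawing, signedArea] at h1 h2 h3
    push_cast at h1 h2 h3
    rw [faceAt_of_floor (by linarith) (by linarith) (by linarith) (by linarith), centralFaceAt,
      if_neg fun h => by linarith [h.1, h.2], if_neg fun h => by linarith [h.1, h.2],
      if_neg fun h => by linarith [h.1, h.2.1, h.2.2], if_neg fun h => by linarith [h.1, h.2],
      if_neg fun h => by linarith [h.1, h.2.1, h.2.2]]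
  · obtain ⟨h1, h2, h3⟩ := of_mem_interior (by
      simp only [quiver, drawing, signedArea]; norm_num) hx
    simp only [quiver, drawing, signedArea] at h1 h2 h3
    push_cast at h1 h2 h3
    rw [faceAt_of_floor (by linarith) (by linarith) (by linarith) (by linarith), centralFaceAt,
      if_neg fun h => by linarith [h.1, h.2], if_pos ⟨by linarith, by linarith⟩]
  · obtain ⟨h1, h2, h3⟩ := of_mem_interior (by
      simp only [quiver, drawing, signedArea]; norm_num) hx
    simp only [quiver, drawing, signedArea] at h1 h2 h3
    push_cast at h1 h2 h3
    rw [faceAt_of_floor (by linarith) (by linarith) (by linarith) (by linarith), centralFaceAt,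
      if_neg fun h => by linarith [h.1, h.2], if_neg fun h => by linarith [h.1, h.2],
      if_pos ⟨by linarith, by linarith, by linarith⟩]

theorem mem_polygon_centralFaceAt {x : ℝ × ℝ} (h1 : 0 ≤ x.1) (h2 : x.1 ≤ 1) (h3 : 0 ≤ x.2)
    (h4 : x.2 ≤ 1) : centralFaceAt x ∈ posFaces ∪ negFaces ∧
      x ∈ dimer.polygon drawing (centralFaceAt x) := by
  unfold centralFaceAt
  split_ifs with k1 k2 k3 k4 k5
  · refine ⟨pos_mem₂, ?_⟩
    change x ∈ triangle _ _ _
    rw [triangle_swap]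
    refine mem_triangle ?_ ?_ ?_ ?_ <;> simp only [quiver, drawing, signedArea] <;> push_cast
    · norm_num
    all_goals linarith
  · refine ⟨neg_mem₂, ?_⟩
    refine mem_triangle ?_ ?_ ?_ ?_ <;> simp only [quiver, drawing, signedArea] <;> push_cast
    · norm_num
    all_goals linarith
  · refine ⟨neg_mem₃, ?_⟩
    refine mem_triangle ?_ ?_ ?_ ?_ <;> simp only [quiver, drawing, signedArea] <;> push_cast
    · norm_num
    all_goals linarith
  · refine ⟨pos_mem₃, ?_⟩
    change x ∈ triangle _ _ _
    rw [triangle_swap]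
    refine mem_triangle ?_ ?_ ?_ ?_ <;> simp only [quiver, drawing, signedArea] <;> push_cast
    · norm_num
    all_goals linarith
  · refine ⟨pos_mem₁, ?_⟩
    change x ∈ triangle _ _ _
    rw [triangle_swap]
    refine mem_triangle ?_ ?_ ?_ ?_ <;> simp only [quiver, drawing, signedArea] <;> push_cast
    · norm_num
    all_goals linarith
  · refine ⟨neg_mem₁, ?_⟩
    -- A point rejected by the first five triangles must satisfy the inequalities of the two inner
    -- edges of the sixth.
    have h5 : 4 - 3 * x.1 ≤ 4 * x.2 ∧ 3 * x.1 - 1 ≤ 2 * x.2 := by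
      simp only [not_and_or, not_le] at k1 k2 k3 k4 k5
      constructor <;> rcases k1 with k1 | k1 <;> rcases k2 with k2 | k2 <;>
        rcases k3 with k3 | k3 | k3 <;> rcases k4 with k4 | k4 <;>
        rcases k5 with k5 | k5 | k5 <;> linarith
    refine mem_triangle ?_ ?_ ?_ ?_ <;> simp only [quiver, drawing, signedArea] <;> push_cast
    · norm_num
    all_goals linarith

theorem mem_polygon_faceAt (x : ℝ × ℝ) : faceAt x ∈ posFaces ∪ negFaces ∧
    x ∈ dimer.polygon drawing (faceAt x) := by
  have h1 := Int.floor_le x.1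
  have h2 := (Int.lt_floor_add_one x.1).le
  have h3 := Int.floor_le x.2
  have h4 := (Int.lt_floor_add_one x.2).le
  unfold faceAt
  split_ifs with k1 k2
  · refine ⟨pos_mem _ _ k1, ?_⟩
    change x ∈ triangle _ _ _
    rw [triangle_swap]
    refine mem_triangle ?_ ?_ ?_ ?_ <;> simp only [quiver, drawing, signedArea] <;> push_cast
    · ring_nf; norm_num
    all_goals linarith
  · refine ⟨neg_mem _ _ k1, ?_⟩
    refine mem_triangle ?_ ?_ ?_ ?_ <;> simp only [quiver, drawing, signedArea] <;> push_cast
    · ring_nf; norm_num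
    all_goals linarith
  · obtain ⟨e1, e2⟩ := Prod.mk.inj (not_not.1 k1)
    rw [e1] at h1 h2
    rw [e2] at h3 h4
    push_cast at h1 h2 h3 h4
    exact mem_polygon_centralFaceAt h1 (by linarith) h3 (by linarith)

theorem isPlaneTiling : dimer.IsPlaneTiling drawing where
  corners := corners
  anticlockwise := anticlockwise
  clockwise := clockwise
  no_overlap _ hc _ hd hcd := Set.disjoint_left.2 fun _ hx hy =>
    hcd ((faceAt_of_mem_interior hc hx).symm.trans (faceAt_of_mem_interior hd hy))
  cover := Set.eq_univ_of_forall fun x =>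
    Set.mem_iUnion₂.2 ⟨faceAt x, (mem_polygon_faceAt x).1, (mem_polygon_faceAt x).2⟩

theorem infinite_vertex : Infinite Vertex :=
  Infinite.of_injective (fun i => grid i 0) fun _ _ h => (grid.inj h).1

end ModifiedGrid

end

theorem mainTheorem9 :
    Infinite ModifiedGrid.dimer.V ∧
      ModifiedGrid.dimer.IsPlaneTiling ModifiedGrid.drawing ∧
      ModifiedGrid.dimer.IsCY3 ∧
      ¬ ModifiedGrid.dimer.IsCancellation :=
  ⟨ModifiedGrid.infinite_vertex, ModifiedGrid.isPlaneTiling, ModifiedGrid.isCY3,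
    ModifiedGrid.not_isCancellation⟩
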